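/- **Setting.** Let $S^4\subset\mathbb R^5=\mathbb R^3\oplus\mathbb R^2$ be the unit sphere, $M$ the total space of its negative spinor bundle, $r$ the norm on the fibres, and let $c\ge 0$ (for $c=0$ remove the zero section). In terms of an oriented orthonormal coframe $b_0,\dots,b_3$ of $S^4$ and the associated vertical 1-forms $\xi_0,\dots,\xi_3$ of the spin connection, the Bryant–Salamon $\mathrm{Spin}(7)$-structure is $$\Phi_c=16(c+r^2)^{-4/5}\,\xi_0\wedge\xi_1\wedge\xi_2\wedge\xi_3+25(c+r^2)^{6/5}\,b_0\wedge b_1\wedge b_2\wedge b_3+20(c+r^2)^{1/5}\sum_{i=1}^3A_i\wedge\Omega_i,$$ with $A_i=\xi_0\wedge\xi_i-\xi_j\wedge\xi_k$, $\Omega_i=b_0\wedge b_i-b_j\wedge b_k$ for $(i,j,k)$ a cyclic permutation of $(1,2,3)$; its metric is $g_c=4(c+r^2)^{-2/5}\sum\xi_i^2+5(c+r^2)^{3/5}\sum b_i^2$. A 4-dimensional submanifold is Cayley if, for a suitable orientation, $\Phi_c$ restricts to its $g_c$-volume form. Let $SU(2)$ act on $M$ by the lift of the action of $SO(3)\times\mathrm{Id}_2$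 on $S^4$. Write points of $S^4$ as $(\cos\alpha\,\mathbf u,\sin\alpha\,(\cos\beta,\sin\beta))$ with $\mathbf u\in S^2$ having spherical coordinates $(\theta,\phi)$, and, in the trivialization of the spinor bundle induced by the normalized coordinate frame $\partial_\alpha,\ \partial_\beta/\sin\alpha,\ \partial_\theta/\cos\alpha,\ \partial_\phi/(\cos\alpha\sin\theta)$, write the fibre coordinate as $$a=\Big(s\cos\tfrac{\delta-\gamma}2,\ s\sin\tfrac{\delta-\gamma}2,\ t\cos\tfrac{\delta+\gamma}2,\ t\sin\tfrac{\delta+\gamma}2\Big)\in\mathbb H.$$ Let $\mathcal U\subset M$ be the $SU(2)$-invariant region $\alpha\in(0,\pi/2)$, $s,t>0$. On it $\theta,\phi,\gamma$ parametrize the $SU(2)$-orbits (diffeomorphic to $S^3$), which are labelled by $(\alpha,\beta,s,t,\delta)$, with $\beta,\delta$ taken modulo $2\pi$. Let $H$ be a primitive of $(\cos\alpha\sin\alpha)^{3/2}$ on $(0,\pi/2)$ and put $$F:=2\sin^{5/2}\!\alpha\,\cos^{1/2}\!\alpha\; st+5c\,\frac{st}{s^2+t^2}\,H(\alpha).$$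 **Theorem.** 1. Let $\tau\mapsto(\alpha,\beta,s,t,\delta)(\tau)$, $\tau\in(-\epsilon,\epsilon)$, be a regular $C^1$ curve (nowhere vanishing derivative) with $\alpha\in(0,\pi/2)$ and $s,t>0$, and let $N\subset\mathcal U$ be the (immersed) $SU(2)$-invariant 4-dimensional submanifold which is the union of the corresponding orbits. Then $N$ is Cayley if and only if the four quantities $$\beta,\qquad \delta,\qquad \frac st,\qquad F$$ are constant along the curve. 2. Consequently the system of ODEs expressing the Cayley condition is completely integrable: $\beta,\delta,s/t,F$ are smooth functions of $(\alpha,\beta,s,t,\delta)\in(0,\pi/2)\times\mathbb R\times(0,\infty)^2\times\mathbb R$ whose differentials are linearly independent at every point. 3. The four quantities define a map $$Q=(\beta,\ \delta,\ s/t,\ F):\mathcal U\to \mathbb R/2\pi\mathbb Z\times\mathbb R/2\pi\mathbb Z\times\mathbb R\times\mathbb R,$$ which is a locally trivial fibration over its image with fibre $S^3\times\mathbb R$. All its level sets are $SU(2)$-invariant, smooth embedded Cayley submanifolds (or empty). -/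

import Mathlib

open scoped Quaternion ContDiff

noncomputable section

namespace BryantSalamon

/-!
### The negative spinor bundle of the round four-sphere

`ℝ⁵ = P ⊕ P^⊥ = ℝ³ ⊕ ℝ²` with coordinates `(x₁, x₂, x₃, y₁, y₂)` is encoded as `ℝ × ℍ` by
`(y₁, y₂ + x₁ i + x₂ j + x₃ k)`, so that `P` is the imaginary part of the quaternion and
`P^⊥` consists of the real number and the real part of the quaternion.
The spin representation of `Spin(5) = Sp(2)` is `ℍ²`.  The half-spinor bundles of `S⁴ ⊂ ℝ⁵` are
the eigenbundles, inside the trivial bundle `S⁴ × ℍ²`, of Clifford multiplication by the unit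
normal `p`.
-/

/-- `ℝ⁵ = ℝ³ ⊕ ℝ²`, a point `(x, y)` being stored as `(y₁, y₂ + x₁ i + x₂ j + x₃ k)`. -/
abbrev R5 : Type := ℝ × ℍ[ℝ]

/-- The spin representation of `Spin(5)`. -/
abbrev Spinor : Type := ℍ[ℝ] × ℍ[ℝ]

/-- The ambient vector space `ℝ⁵ × ℍ²` which contains the total space of the bundle. Only its
topology and smooth structure are used; the product norm plays no role. -/
abbrev Amb : Type := R5 × Spinor

/-- The Euclidean inner product of `ℝ⁵`. -/
def inner5 (X Y : R5) : ℝ := X.1 * Y.1 + inner ℝ X.2 Y.2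

/-- The Euclidean inner product of `ℍ² = ℝ⁸`. -/
def innerS (ξ ζ : Spinor) : ℝ := inner ℝ ξ.1 ζ.1 + inner ℝ ξ.2 ζ.2

/-- The symmetric action `X̂` of `X = (h, q) ∈ ℝ⁵` on spinors by the quaternionic Hermitian matrix
with rows `(h, q)` and `(q̄, -h)`. It satisfies `X̂ X̂ = |X|²`; in the convention in which unit
vectors square to `-1`, the Clifford product `X · Y` of two vectors acts as `-X̂ Ŷ`. -/
def cliff (X : R5) (ψ : Spinor) : Spinor :=
  (X.1 • ψ.1 + X.2 * ψ.2, star X.2 * ψ.1 - X.1 • ψ.2)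

/-- The total space of the negative spinor bundle of the unit sphere `S⁴ ⊂ ℝ⁵`: pairs `(p, ψ)` with
`|p| = 1` and `p̂ ψ = -ψ`. The last condition says that `e₀ · e₁ · e₂ · e₃` acts as the identity
on `ψ` for every orthonormal basis `e₀, …, e₃` of `T_p S⁴` for which `(p, e₀, e₁, e₂, e₃)` is
a positive basis of `ℝ³ ⊕ ℝ²`. -/
def negSpinorBundle : Set Amb :=
  {x | inner5 x.1 x.1 = 1 ∧ cliff x.1 x.2 = -x.2}

/-!
### The Bryant--Salamon structures

A tangent vector `v = (X, ψ')` at `x = (p, ψ)` has horizontal part `X ∈ T_p S⁴`. The spin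
connection is the orthogonal projection to the eigenbundle of the flat derivative, so the vertical
part of `v` is the projection of `ψ'` to the fibre.
-/

/-- The vertical part `ξ = (ξ₀, ξ₁, ξ₂, ξ₃)` of a tangent vector, that is, the covariant
derivative of the spinor, an element of the fibre. -/
def vert (x v : Amb) : Spinor := (1 / 2 : ℝ) • (v.2 - cliff x.1 v.2)

/-- `c + r²`, with `r` the norm on the fibres. -/
def cr (c : ℝ) (x : Amb) : ℝ := c + innerS x.2 x.2

/-- The metric
`g_c = 4 (c + r²)^(-2/5) (ξ₀² + ⋯ + ξ₃²) + 5 (c + r²)^(3/5) (b₀² + ⋯ + b₃²)`. -/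
def metric (c : ℝ) (x v w : Amb) : ℝ :=
  4 * cr c x ^ (-(2 / 5) : ℝ) * innerS (vert x v) (vert x w)
    + 5 * cr c x ^ (3 / 5 : ℝ) * inner5 v.1 w.1

/-- The coordinates `(x₁, x₂, x₃, y₁, y₂)` of a vector of `ℝ⁵ = ℝ³ ⊕ ℝ²`. -/
def coords5 (X : R5) : Fin 5 → ℝ := ![X.2.imI, X.2.imJ, X.2.imK, X.1, X.2.re]

/-- The horizontal volume form `b₀ ∧ b₁ ∧ b₂ ∧ b₃`: the volume form of `S⁴`, oriented by the
outward normal. -/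
def volHor (x : Amb) (v : Fin 4 → Amb) : ℝ :=
  Matrix.det (Matrix.of
    ![coords5 x.1, coords5 (v 0).1, coords5 (v 1).1, coords5 (v 2).1, coords5 (v 3).1])

/-- The 2-form `⟨ξ i, ζ⟩` on spinors, for the right quaternionic structure (which preserves the
fibres and is orthogonal). -/
def rightForm (ξ ζ : Spinor) : ℝ :=
  innerS (ξ.1 * ⟨0, 1, 0, 0⟩, ξ.2 * ⟨0, 1, 0, 0⟩) ζ

/-- The vertical volume form `ξ₀ ∧ ξ₁ ∧ ξ₂ ∧ ξ₃`. The form `B = ⟨ξ i, ζ⟩` is, on the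
four-dimensional fibre, a Hermitian form compatible with the orientation, so that the volume form is
`B ∧ B / 2`. -/
def volVert (x : Amb) (v : Fin 4 → Amb) : ℝ :=
  let B : Fin 4 → Fin 4 → ℝ := fun a b => rightForm (vert x (v a)) (vert x (v b))
  B 0 1 * B 2 3 - B 0 2 * B 1 3 + B 0 3 * B 1 2

/-- `∑ᵢ Ωᵢ(X, Y) Aᵢ(ξ, ζ)`, where `Ωᵢ = b₀ ∧ bᵢ - bⱼ ∧ bₖ`, `Aᵢ = ξ₀ ∧ ξᵢ - ξⱼ ∧ ξₖ`.
On the fibre `Aᵢ(ξ, ζ) = ⟨e₀ · eᵢ · ξ, ζ⟩ = -⟨eⱼ · eₖ · ξ, ζ⟩`, hence the sum is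
`∑_{a < b} (b_a ∧ b_b)(X, Y) ⟨e_a · e_b · ξ, ζ⟩ = -⟨(X̂ Ŷ - Ŷ X̂) ξ, ζ⟩ / 2`. -/
def mixed (X Y : R5) (ξ ζ : Spinor) : ℝ :=
  (1 / 2) * (innerS (cliff X ξ) (cliff Y ζ) - innerS (cliff Y ξ) (cliff X ζ))

/-- The 4-form `A₁ ∧ Ω₁ + A₂ ∧ Ω₂ + A₃ ∧ Ω₃`, written out as a sum over shuffles. -/
def sumAOmega (x : Amb) (v : Fin 4 → Amb) : ℝ :=
  let T : Fin 4 → Fin 4 → Fin 4 → Fin 4 → ℝ := fun a b d e =>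
    mixed (v a).1 (v b).1 (vert x (v d)) (vert x (v e))
  T 0 1 2 3 - T 0 2 1 3 + T 0 3 1 2 + T 1 2 0 3 - T 1 3 0 2 + T 2 3 0 1

/-- The Bryant--Salamon Cayley form
`Φ_c = 16 (c + r²)^(-4/5) ξ₀ ∧ ξ₁ ∧ ξ₂ ∧ ξ₃ + 25 (c + r²)^(6/5) b₀ ∧ b₁ ∧ b₂ ∧ b₃
  + 20 (c + r²)^(1/5) (A₁ ∧ Ω₁ + A₂ ∧ Ω₂ + A₃ ∧ Ω₃)`. -/
def cayleyForm (c : ℝ) (x : Amb) (v : Fin 4 → Amb) : ℝ :=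
  16 * cr c x ^ (-(4 / 5) : ℝ) * volVert x v + 25 * cr c x ^ (6 / 5 : ℝ) * volHor x v
    + 20 * cr c x ^ (1 / 5 : ℝ) * sumAOmega x v

/-!
### Cayley planes and Cayley submanifolds
-/

/-- `T`, a subspace of the tangent space at `x`, is a Cayley 4-plane (for one of its two
orientations): it has a `g_c`-orthonormal basis of four vectors on which `Φ_c` takes the value
`1`. -/
def IsCayleyPlane (c : ℝ) (x : Amb) (T : Submodule ℝ Amb) : Prop :=
  ∃ e : Fin 4 → Amb, Submodule.span ℝ (Set.range e) = T ∧
    (∀ a b, metric c x (e a) (e b) = if a = b then 1 else 0) ∧ cayleyForm c x e = 1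

/-- `N` is a (smooth, embedded, 4-dimensional) Cayley submanifold of the negative spinor bundle:
near each of its points it is the image of a smooth immersion of an open subset of `ℝ⁴` which is
a homeomorphism onto its image, and the tangent spaces are Cayley 4-planes. The orientation, being
the one for which `Φ_c` is positive on the tangent spaces, is determined by `N` and varies
continuously. -/
def IsCayleySubmanifold (c : ℝ) (N : Set Amb) : Prop :=
  N ⊆ negSpinorBundle ∧
  ∀ x ∈ N, ∃ (W : Set Amb) (D : Set (EuclideanSpace ℝ (Fin 4)))
      (φ : EuclideanSpace ℝ (Fin 4) → Amb),
    IsOpen W ∧ x ∈ W ∧ IsOpen D ∧ ContDiffOn ℝ ∞ φ D ∧ φ '' D = N ∩ W ∧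
    Topology.IsEmbedding (D.domRestrict φ) ∧
    ∀ u ∈ D, Function.Injective (fderiv ℝ φ u) ∧
      IsCayleyPlane c (φ u) (LinearMap.range (fderiv ℝ φ u).toLinearMap)

/-!
### The action of `SU(2)`
-/

/-- `SU(2) = Spin(3) = Sp(1)`, the unit quaternions. -/
abbrev SU2 : Type := unitary ℍ[ℝ]

/-- The lift to the spinor bundle of the action of `SO(3) × Id₂` on `S⁴ ⊂ ℝ³ ⊕ ℝ²`: a unit
quaternion acts on `ℝ³ = Im ℍ` by conjugation, trivially on `ℝ²`, and on spinors through the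
diagonal embedding `Sp(1) ⊂ Sp(2)`. -/
def act (g : SU2) (x : Amb) : Amb :=
  ((x.1.1, (g : ℍ[ℝ]) * x.1.2 * star (g : ℍ[ℝ])),
    ((g : ℍ[ℝ]) * x.2.1, (g : ℍ[ℝ]) * x.2.2))

/-- The infinitesimal action at `x` of an imaginary quaternion `w`, an element of the Lie algebra
of `SU(2)`. -/
def infAct (w : ℍ[ℝ]) (x : Amb) : Amb :=
  ((0, w * x.1.2 - x.1.2 * w), (w * x.2.1, w * x.2.2))

/-!
### Adapted coordinates

Each orbit in the chart `𝒰` meets the slice over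
`p = (cos α (1, 0, 0), sin α (cos β, sin β))`, on which the remaining coordinates `s, t, δ` are
the fibre coordinates with `γ = 0`; the spherical angles of `u ∈ S² ⊂ ℝ³` and `γ`
parametrize the orbit. The element `exp (i γ / 2)` of the stabilizer of `p` takes the fibre
coordinates `(s, t, δ, 0)` to `(s, t, δ, γ)`.
-/

/-- The point `(cos α (1, 0, 0), sin α (cos β, sin β))` of `S⁴`. -/
def basePoint (α β : ℝ) : R5 :=
  (Real.sin α * Real.cos β, ⟨Real.sin α * Real.sin β, Real.cos α, 0, 0⟩)

/-- The orthonormal frame `f₀ = ∂_α`, `f₁ = ∂_β / sin α`, `f₂ = ∂_θ / cos α`,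
`f₃ = ∂_φ / (cos α sin θ)` of `S⁴` at the base point (for `φ = 0`, in the limit `θ → 0`). -/
def frame (α β : ℝ) : Fin 4 → R5 :=
  ![(Real.cos α * Real.cos β, ⟨Real.cos α * Real.sin β, -Real.sin α, 0, 0⟩),
    (-Real.sin β, ⟨Real.cos β, 0, 0, 0⟩),
    (0, ⟨0, 0, 1, 0⟩),
    (0, ⟨0, 0, 0, 1⟩)]

/-- The unit negative spinor `σ₁` corresponding to `1 ∈ ℍ` in the trivialization induced by the
frame. It satisfies `f₂ · f₃ · σ = σ i`, `f₃ · f₁ · σ = -σ k`, `f₁ · f₂ · σ = σ j`,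
so that it comes from a fixed spinor through a lift of the frame to the spin structure. -/
def spinorFrame (α β : ℝ) : Spinor :=
  (⟨Real.sin (Real.pi / 4 - α / 2) * Real.cos (β / 2),
    -(Real.cos (Real.pi / 4 - α / 2) * Real.sin (β / 2)), 0, 0⟩,
   ⟨Real.sin (Real.pi / 4 - α / 2) * Real.sin (β / 2),
    Real.cos (Real.pi / 4 - α / 2) * Real.cos (β / 2), 0, 0⟩)

/-- The spinor `a₀ σ₁ + a₁ σ_i + a₂ σ_j + a₃ σ_k`. Since `i ∈ Sp(1)` acts by `v ↦ v ī`, one has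
`σ_i = -f₂ · f₃ · σ₁`, `σ_j = -f₃ · f₁ · σ₁`, `σ_k = -f₁ · f₂ · σ₁`. -/
def fibreSpinor (α β a₀ a₁ a₂ a₃ : ℝ) : Spinor :=
  let f := frame α β
  let σ := spinorFrame α β
  a₀ • σ + a₁ • cliff (f 2) (cliff (f 3) σ) + a₂ • cliff (f 3) (cliff (f 1) σ)
    + a₃ • cliff (f 1) (cliff (f 2) σ)

/-- The point of the slice with coordinates `(α, β, s, t, δ)` (and `γ = 0`). -/
def slicePoint (α β s t δ : ℝ) : Amb :=
  (basePoint α β,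
    fibreSpinor α β (s * Real.cos (δ / 2)) (s * Real.sin (δ / 2))
      (t * Real.cos (δ / 2)) (t * Real.sin (δ / 2)))

/-- The chart `𝒰`: the union of the orbits with `α ∈ (0, π/2)` and `s, t > 0`. -/
def chartU : Set Amb :=
  {x | ∃ (g : SU2) (α β s t δ : ℝ), α ∈ Set.Ioo 0 (Real.pi / 2) ∧ 0 < s ∧ 0 < t ∧
    x = act g (slicePoint α β s t δ)}

/-- The parametrization `(g, τ) ↦ g · slicePoint (α τ) (β τ) (s τ) (t τ) (δ τ)` of
the `SU(2)`-invariant submanifold swept out by a curve of orbits. -/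
def orbitFamily (α β s t δ : ℝ → ℝ) (g : SU2) (τ : ℝ) : Amb :=
  act g (slicePoint (α τ) (β τ) (s τ) (t τ) (δ τ))

/-- The tangent space of that submanifold at the parameter `(g, τ)`, spanned by the three
directions of the orbit and the velocity in `τ`. -/
def orbitFamilyTangent (α β s t δ : ℝ → ℝ) (g : SU2) (τ : ℝ) : Submodule ℝ Amb :=
  Submodule.span ℝ
    {infAct ⟨0, 1, 0, 0⟩ (orbitFamily α β s t δ g τ),
     infAct ⟨0, 0, 1, 0⟩ (orbitFamily α β s t δ g τ),
     infAct ⟨0, 0, 0, 1⟩ (orbitFamily α β s t δ g τ),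
     deriv (orbitFamily α β s t δ g) τ}

/-- The function `F = 2 sin^{5/2} α cos^{1/2} α s t + 5 c (s t / (s² + t²)) H(α)`. -/
def integralF (c : ℝ) (H : ℝ → ℝ) (α s t : ℝ) : ℝ :=
  2 * Real.sin α ^ (5 / 2 : ℝ) * Real.cos α ^ (1 / 2 : ℝ) * (s * t)
    + 5 * c * (s * t / (s ^ 2 + t ^ 2)) * H α

/-- The domain of the coordinates `(α, β, s, t, δ)` of the orbit space. -/
def orbitDomain : Set (ℝ × ℝ × ℝ × ℝ × ℝ) :=
  {z | z.1 ∈ Set.Ioo 0 (Real.pi / 2) ∧ 0 < z.2.2.1 ∧ 0 < z.2.2.2.1}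

/-- The four quantities `β, δ, s/t, F` as functions of `(α, β, s, t, δ)`. -/
def firstIntegrals (c : ℝ) (H : ℝ → ℝ) (z : ℝ × ℝ × ℝ × ℝ × ℝ) : ℝ × ℝ × ℝ × ℝ :=
  (z.2.1, z.2.2.2.2, z.2.2.1 / z.2.2.2.1, integralF c H z.1 z.2.2.1 z.2.2.2.1)

end BryantSalamon

end

/-!
# Cayley submanifolds of the Bryant--Salamon manifold invariant under `SU(2)`

**The Cayley condition.** Left multiplication by `SU(2)`, the rotations of the `ℝ²`-part of `ℝ⁵`
with their spin lift, and right multiplication of spinors by `exp (-i δ / 2)` preserve the metric and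
the tensors out of which the Cayley form is built (`IsTensorSymmetry`; the horizontal volume form
may be ignored, since one of the generators of the action is vertical). Hence a plane tangent to a
family of orbits may be moved to the point `slice₀` with `β = δ = 0`, where everything is an
explicit polynomial. A 4-plane spanned by `X` is Cayley if and only if `Φ(X)²` equals the Gram
determinant of `X` (`sq_cayleyForm_eq_det`, `isCayleyPlane_of_sq_eq`). For the three generators of
an orbit and a velocity `a ∂_α + b ∂_β + s' ∂_s + t' ∂_t + d ∂_δ`, the Gram determinant minus
`Φ²` is a combination, with positive coefficients, of the squares of
`b`, `d s t`, `t s' - s t'` and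
`E = (5 cos² α (c + s² + t²) - sin² α (s² + t²)) a + 4 sin α cos α (s s' + t t')`
(`det_gram_sub_sq`), so that the Cayley condition is the vanishing of these four expressions
(`isCayleyPlane_orbitFamilyTangent_iff`).

**The first integrals.** The first three equations say that `β`, `δ`, `s / t` are constant. The
derivative of `F` along a curve is a positive multiple of `E`, plus a multiple of `t s' - s t'`
(`hasDerivAt_integralF`); so the last equation says that `F` is constant. The same formula
shows that the four differentials are independent, because `E` involves `s s' + t t'` with
a nonzero coefficient.

**The level sets.** The coordinates `α, β, s, t, δ` can be read off from a point by means of the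
base point, the norm of the spinor and a fibrewise Hopf map, and the group element can be recovered
from an expression linear in the spinor (`groupPart`). With `v = s / t` one has
`F = 2 v sin^{5/2} α cos^{1/2} α t² + 5 c v / (v² + 1) H(α)`, so on a level set `t` is a function
of `α`, defined where `F - 5 c v / (v² + 1) H(α) > 0` (`levelGap`, `levelT`, `mem_fibre_iff`).
A level set is therefore parametrized by `SU(2)` and `α`; the central charts of the three-sphere
give local parametrizations, and their tangent spaces are those of the family of orbits over the
curve `α ↦ (α, β, v t(α), t(α), δ)`, which satisfies the Cayley equations because `F` is constant
along it (`isCayleySubmanifold_fibre`).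

**Local triviality.** The primitive `H` extends continuously to `[0, π/2]` and is increasing there,
so the admissible `α` form an interval with left end `0`, on which
`τ = log (tan α / (F - 5 c v / (v² + 1) H(α)))` increases from `-∞` to `∞`. The inverse
`levelRoot` is jointly continuous in `(v, F, τ)`, and `(g, τ)` are the fibre coordinates of
a local trivialization over the set of values of the fibration whose angles differ from two given
ones by less than `π` (`localTrivialization`).
-/

noncomputable section

namespace BryantSalamon

/-! ### The tensors as multilinear objects -/

/-- The quaternion `a + b i + c j + d k`. -/
def quat (a b c d : ℝ) : ℍ[ℝ] := ⟨a, b, c, d⟩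

@[simp] lemma re_quat (a b c d : ℝ) : (quat a b c d).re = a := rfl
@[simp] lemma imI_quat (a b c d : ℝ) : (quat a b c d).imI = b := rfl
@[simp] lemma imJ_quat (a b c d : ℝ) : (quat a b c d).imJ = c := rfl
@[simp] lemma imK_quat (a b c d : ℝ) : (quat a b c d).imK = d := rfl

lemma cliff_add_left (X Y : R5) (ψ : Spinor) : cliff (X + Y) ψ = cliff X ψ + cliff Y ψ := by
  ext <;> simp [cliff] <;> ring

lemma cliff_smul_left (r : ℝ) (X : R5) (ψ : Spinor) : cliff (r • X) ψ = r • cliff X ψ := by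
  ext <;> simp [cliff] <;> ring

lemma cliff_add_right (X : R5) (ψ χ : Spinor) : cliff X (ψ + χ) = cliff X ψ + cliff X χ := by
  ext <;> simp [cliff] <;> ring

lemma cliff_smul_right (r : ℝ) (X : R5) (ψ : Spinor) : cliff X (r • ψ) = r • cliff X ψ := by
  ext <;> simp [cliff] <;> ring

lemma vert_add (x v w : Amb) : vert x (v + w) = vert x v + vert x w := by
  simp only [vert, Prod.snd_add, cliff_add_right]
  module

lemma vert_smul (x : Amb) (r : ℝ) (v : Amb) : vert x (r • v) = r • vert x v := by
  simp only [vert, Prod.smul_snd, cliff_smul_right]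
  module

lemma innerS_add_left (ξ η ζ : Spinor) : innerS (ξ + η) ζ = innerS ξ ζ + innerS η ζ := by
  simp only [innerS, Prod.fst_add, Prod.snd_add, inner_add_left]; ring

lemma innerS_smul_left (r : ℝ) (ξ ζ : Spinor) : innerS (r • ξ) ζ = r * innerS ξ ζ := by
  simp only [innerS, Prod.smul_fst, Prod.smul_snd, real_inner_smul_left]; ring

lemma innerS_comm (ξ ζ : Spinor) : innerS ξ ζ = innerS ζ ξ := by
  simp only [innerS, real_inner_comm]

lemma innerS_add_right (ξ η ζ : Spinor) : innerS ξ (η + ζ) = innerS ξ η + innerS ξ ζ := by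
  rw [innerS_comm, innerS_add_left, innerS_comm η, innerS_comm ζ]

lemma innerS_smul_right (r : ℝ) (ξ ζ : Spinor) : innerS ξ (r • ζ) = r * innerS ξ ζ := by
  rw [innerS_comm, innerS_smul_left, innerS_comm]

lemma inner5_add_left (X Y Z : R5) : inner5 (X + Y) Z = inner5 X Z + inner5 Y Z := by
  simp only [inner5, Prod.fst_add, Prod.snd_add, inner_add_left]; ring

lemma inner5_smul_left (r : ℝ) (X Y : R5) : inner5 (r • X) Y = r * inner5 X Y := by
  simp only [inner5, Prod.smul_fst, Prod.smul_snd, real_inner_smul_left, smul_eq_mul]; ring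

lemma inner5_comm (X Y : R5) : inner5 X Y = inner5 Y X := by
  simp only [inner5, real_inner_comm, mul_comm]

lemma metric_comm (c : ℝ) (x v w : Amb) : metric c x v w = metric c x w v := by
  simp only [metric, innerS_comm (vert x v), inner5_comm v.1]

lemma metric_add_left (c : ℝ) (x u v w : Amb) :
    metric c x (u + v) w = metric c x u w + metric c x v w := by
  simp only [metric, vert_add, innerS_add_left, Prod.fst_add, inner5_add_left]; ring

lemma metric_smul_left (c : ℝ) (x : Amb) (r : ℝ) (v w : Amb) :
    metric c x (r • v) w = r * metric c x v w := by
  simp only [metric, vert_smul, innerS_smul_left, Prod.smul_fst, inner5_smul_left]; ring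

lemma metric_add_right (c : ℝ) (x u v w : Amb) :
    metric c x u (v + w) = metric c x u v + metric c x u w := by
  rw [metric_comm, metric_add_left, metric_comm c x v, metric_comm c x w]

lemma metric_smul_right (c : ℝ) (x : Amb) (r : ℝ) (v w : Amb) :
    metric c x v (r • w) = r * metric c x v w := by
  rw [metric_comm, metric_smul_left, metric_comm]

lemma metric_sub_right (c : ℝ) (x u v w : Amb) :
    metric c x u (v - w) = metric c x u v - metric c x u w := by
  have h := metric_add_right c x u (v - w) w
  rw [sub_add_cancel] at h
  linarith

/-- The metric `g_c` as a bilinear form on the ambient vector space. -/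
def metricForm (c : ℝ) (x : Amb) : Amb →ₗ[ℝ] Amb →ₗ[ℝ] ℝ :=
  LinearMap.mk₂ ℝ (metric c x) (metric_add_left c x) (metric_smul_left c x)
    (metric_add_right c x) (fun r v w => metric_smul_right c x r v w)

lemma metricForm_apply (c : ℝ) (x v w : Amb) : metricForm c x v w = metric c x v w := rfl

lemma rightForm_eq (ξ ζ : Spinor) :
    rightForm ξ ζ = innerS (ξ.1 * quat 0 1 0 0, ξ.2 * quat 0 1 0 0) ζ := rfl

lemma rightForm_add_left (ξ η ζ : Spinor) :
    rightForm (ξ + η) ζ = rightForm ξ ζ + rightForm η ζ := by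
  simp only [rightForm_eq, Prod.fst_add, Prod.snd_add, add_mul]
  exact innerS_add_left (_, _) (_, _) ζ

lemma rightForm_smul_left (r : ℝ) (ξ ζ : Spinor) :
    rightForm (r • ξ) ζ = r * rightForm ξ ζ := by
  simp only [rightForm_eq, Prod.smul_fst, Prod.smul_snd, smul_mul_assoc]
  exact innerS_smul_left r (_, _) ζ

lemma rightForm_add_right (ξ η ζ : Spinor) :
    rightForm ξ (η + ζ) = rightForm ξ η + rightForm ξ ζ := innerS_add_right _ _ _

lemma rightForm_smul_right (r : ℝ) (ξ ζ : Spinor) :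
    rightForm ξ (r • ζ) = r * rightForm ξ ζ := innerS_smul_right _ _ _

lemma rightForm_swap (ξ ζ : Spinor) : rightForm ξ ζ = -rightForm ζ ξ := by
  simp [rightForm_eq, innerS, Quaternion.inner_def]; ring

lemma rightForm_self (ξ : Spinor) : rightForm ξ ξ = 0 := by
  linarith [rightForm_swap ξ ξ]

lemma mixed_add_first (X Y Z : R5) (ξ ζ : Spinor) :
    mixed (X + Y) Z ξ ζ = mixed X Z ξ ζ + mixed Y Z ξ ζ := by
  simp only [mixed, cliff_add_left, innerS_add_left, innerS_add_right]; ring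

lemma mixed_smul_first (r : ℝ) (X Z : R5) (ξ ζ : Spinor) :
    mixed (r • X) Z ξ ζ = r * mixed X Z ξ ζ := by
  simp only [mixed, cliff_smul_left, innerS_smul_left, innerS_smul_right]; ring

lemma mixed_swap_first (X Y : R5) (ξ ζ : Spinor) : mixed X Y ξ ζ = -mixed Y X ξ ζ := by
  simp only [mixed]; ring

lemma mixed_swap_last (X Y : R5) (ξ ζ : Spinor) : mixed X Y ξ ζ = -mixed X Y ζ ξ := by
  simp only [mixed, innerS_comm (cliff X ξ), innerS_comm (cliff Y ξ)]; ring

lemma mixed_add_second (X Y Z : R5) (ξ ζ : Spinor) :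
    mixed X (Y + Z) ξ ζ = mixed X Y ξ ζ + mixed X Z ξ ζ := by
  rw [mixed_swap_first, mixed_add_first, mixed_swap_first X Y, mixed_swap_first X Z]; ring

lemma mixed_smul_second (r : ℝ) (X Z : R5) (ξ ζ : Spinor) :
    mixed X (r • Z) ξ ζ = r * mixed X Z ξ ζ := by
  rw [mixed_swap_first, mixed_smul_first, mixed_swap_first X Z]; ring

lemma mixed_add_third (X Y : R5) (ξ η ζ : Spinor) :
    mixed X Y (ξ + η) ζ = mixed X Y ξ ζ + mixed X Y η ζ := by
  simp only [mixed, cliff_add_right, innerS_add_left]; ring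

lemma mixed_smul_third (r : ℝ) (X Y : R5) (ξ ζ : Spinor) :
    mixed X Y (r • ξ) ζ = r * mixed X Y ξ ζ := by
  simp only [mixed, cliff_smul_right, innerS_smul_left]; ring

lemma mixed_add_last (X Y : R5) (ξ η ζ : Spinor) :
    mixed X Y ξ (η + ζ) = mixed X Y ξ η + mixed X Y ξ ζ := by
  simp only [mixed, cliff_add_right, innerS_add_right]; ring

lemma mixed_smul_last (r : ℝ) (X Y : R5) (ξ ζ : Spinor) :
    mixed X Y ξ (r • ζ) = r * mixed X Y ξ ζ := by
  simp only [mixed, cliff_smul_right, innerS_smul_right]; ring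

lemma mixed_self_first (X : R5) (ξ ζ : Spinor) : mixed X X ξ ζ = 0 := by
  linarith [mixed_swap_first X X ξ ζ]

lemma mixed_self_last (X Y : R5) (ξ : Spinor) : mixed X Y ξ ξ = 0 := by
  linarith [mixed_swap_last X Y ξ ξ]

/-- The vertical volume form as an alternating map. -/
def volVertAlt (x : Amb) : Amb [⋀^Fin 4]→ₗ[ℝ] ℝ where
  toFun := volVert x
  map_update_add' {inst} v i a b := by
    obtain rfl := Subsingleton.elim inst (instDecidableEqFin 4)
    fin_cases i <;>
      simp [volVert, vert_add, rightForm_add_left, rightForm_add_right] <;>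
      ring
  map_update_smul' {inst} v i r a := by
    obtain rfl := Subsingleton.elim inst (instDecidableEqFin 4)
    fin_cases i <;>
      simp [volVert, vert_smul, rightForm_smul_left,
        rightForm_smul_right] <;>
      ring
  map_eq_zero_of_eq' v i j h hij := by
    have key : ∀ a b : Fin 4, a < b → v a = v b → volVert x v = 0 := by
      intro a b hab h
      fin_cases a <;> fin_cases b <;> simp at hab <;> simp at h <;>
        simp only [volVert, h, rightForm_self]
      · ring
      · rw [rightForm_swap (vert x (v 2)) (vert x (v 1))]; ring
      · rw [rightForm_swap (vert x (v 3)) (vert x (v 1)),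
          rightForm_swap (vert x (v 3)) (vert x (v 2))]; ring
      · ring
      · rw [rightForm_swap (vert x (v 2)) (vert x (v 3))]; ring
      · ring
    rcases lt_or_gt_of_ne hij with h' | h'
    · exact key i j h' h
    · exact key j i h' h.symm

/-- The mixed term of the Cayley form as an alternating map. -/
def sumAOmegaAlt (x : Amb) : Amb [⋀^Fin 4]→ₗ[ℝ] ℝ where
  toFun := sumAOmega x
  map_update_add' {inst} v i a b := by
    obtain rfl := Subsingleton.elim inst (instDecidableEqFin 4)
    fin_cases i <;>
      simp [sumAOmega, vert_add, mixed_add_first, mixed_add_second,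
        mixed_add_third, mixed_add_last] <;>
      ring
  map_update_smul' {inst} v i r a := by
    obtain rfl := Subsingleton.elim inst (instDecidableEqFin 4)
    fin_cases i <;>
      simp [sumAOmega, vert_smul, mixed_smul_first, mixed_smul_second,
        mixed_smul_third, mixed_smul_last] <;>
      ring
  map_eq_zero_of_eq' v i j h hij := by
    have key : ∀ a b : Fin 4, a < b → v a = v b → sumAOmega x v = 0 := by
      intro a b hab h
      fin_cases a <;> fin_cases b <;> simp at hab <;> simp at h <;>
        simp only [sumAOmega, h, mixed_self_first, mixed_self_last]
      · ring
      · rw [mixed_swap_first (v 2).1 (v 1).1, mixed_swap_last _ _ (vert x (v 2)) (vert x (v 1))]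
        ring
      · rw [mixed_swap_first (v 3).1 (v 1).1, mixed_swap_last _ _ (vert x (v 1)) (vert x (v 3)),
          mixed_swap_first (v 3).1 (v 2).1, mixed_swap_last _ _ (vert x (v 2)) (vert x (v 3))]
        ring
      · ring
      · rw [mixed_swap_first (v 3).1 (v 2).1, mixed_swap_last _ _ (vert x (v 3)) (vert x (v 2))]
        ring
      · ring
    rcases lt_or_gt_of_ne hij with h' | h'
    · exact key i j h' h
    · exact key j i h' h.symm

/-- The Euclidean coordinates of the horizontal part, as a linear map. -/
def horCoords : Amb →ₗ[ℝ] Fin 5 → ℝ where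
  toFun v := coords5 v.1
  map_add' v w := by ext i; fin_cases i <;> simp [coords5]
  map_smul' r v := by ext i; fin_cases i <;> simp [coords5]

/-- The horizontal volume form as an alternating map. -/
def volHorAlt (x : Amb) : Amb [⋀^Fin 4]→ₗ[ℝ] ℝ :=
  ((Matrix.detRowAlternating (n := Fin 5) (R := ℝ)).curryLeft (coords5 x.1)).compLinearMap
    horCoords

lemma volHorAlt_apply (x : Amb) (v : Fin 4 → Amb) : volHorAlt x v = volHor x v := by
  simp only [volHorAlt, volHor, AlternatingMap.compLinearMap_apply,
    AlternatingMap.curryLeft_apply_apply]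
  change Matrix.det _ = _
  congr 1
  ext i j
  fin_cases i <;> rfl

/-- The Cayley form as an alternating map. -/
def cayleyAlt (c : ℝ) (x : Amb) : Amb [⋀^Fin 4]→ₗ[ℝ] ℝ :=
  (16 * cr c x ^ (-(4 / 5) : ℝ)) • volVertAlt x + (25 * cr c x ^ (6 / 5 : ℝ)) • volHorAlt x
    + (20 * cr c x ^ (1 / 5 : ℝ)) • sumAOmegaAlt x

lemma cayleyAlt_apply (c : ℝ) (x : Amb) (v : Fin 4 → Amb) :
    cayleyAlt c x v = cayleyForm c x v := by
  simp only [cayleyAlt, cayleyForm, AlternatingMap.add_apply, AlternatingMap.smul_apply,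
    volHorAlt_apply, smul_eq_mul]
  rfl

lemma cayleyForm_smul_univ (c : ℝ) (x : Amb) (k : Fin 4 → ℝ) (v : Fin 4 → Amb) :
    cayleyForm c x (fun a => k a • v a) = (∏ a, k a) * cayleyForm c x v := by
  have h := (cayleyAlt c x).toMultilinearMap.map_smul_univ k v
  rwa [AlternatingMap.coe_multilinearMap, cayleyAlt_apply, cayleyAlt_apply, smul_eq_mul] at h

/-! ### A numerical criterion for Cayley planes -/

/-- If the span of four vectors is a Cayley plane, the value of the Cayley form on them is, up to
sign, their volume. -/
theorem sq_cayleyForm_eq_det {c : ℝ} {x : Amb} {X : Fin 4 → Amb}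
    (h : IsCayleyPlane c x (Submodule.span ℝ (Set.range X))) :
    cayleyForm c x X ^ 2 = (Matrix.of fun a b => metric c x (X a) (X b)).det := by
  obtain ⟨e, hspan, hon, hΦ⟩ := h
  have hX : ∀ a, ∃ m : Fin 4 → ℝ, ∑ b, m b • e b = X a := fun a =>
    (Submodule.mem_span_range_iff_exists_fun ℝ).1
      (hspan ▸ Submodule.subset_span (Set.mem_range_self a))
  -- `M` is the matrix of the vectors `X` in the orthonormal basis `e` with `Φ(e) = 1`
  choose M hM using hX
  have h1 : cayleyForm c x X = (Matrix.of M).det := by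
    set f := (cayleyAlt c x).compLinearMap (Fintype.linearCombination ℝ e) with hf
    have h2 := congrArg (fun k => k M) (f.eq_smul_basis_det (Pi.basisFun ℝ (Fin 4)))
    simp only [AlternatingMap.smul_apply, Pi.basisFun_det_apply] at h2
    have h3 : f M = cayleyForm c x X := by
      rw [← cayleyAlt_apply, hf, AlternatingMap.compLinearMap_apply]
      congr 1
      ext1 a
      simpa [Fintype.linearCombination_apply] using hM a
    have h4 : f (Pi.basisFun ℝ (Fin 4)) = 1 := by
      rw [← hΦ, ← cayleyAlt_apply, hf, AlternatingMap.compLinearMap_apply]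
      congr 1
      ext1 a
      simp [Fintype.linearCombination_apply, Pi.single_apply]
    rw [← h3, h2, h4, smul_eq_mul, one_mul]
  have h5 : (Matrix.of fun a b => metric c x (X a) (X b))
      = Matrix.of M * (Matrix.of M).transpose := by
    ext a b
    rw [Matrix.of_apply, ← hM a, ← hM b, ← metricForm_apply]
    simp [metricForm_apply, hon, Matrix.mul_apply, mul_comm]
  rw [h5, Matrix.det_mul, Matrix.det_transpose, h1, sq]

/-- Conversely, four vectors, the first three of them orthogonal, span a Cayley plane as soon as
the square of the Cayley form is their Gram determinant and does not vanish. -/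
theorem isCayleyPlane_of_sq_eq {c : ℝ} {x : Amb} {X : Fin 4 → Amb} {g₀ g₁ g₂ m₀ m₁ m₂ n : ℝ}
    (h₀ : metric c x (X 0) (X 0) = g₀) (h₁ : metric c x (X 1) (X 1) = g₁)
    (h₂ : metric c x (X 2) (X 2) = g₂) (h₀₁ : metric c x (X 0) (X 1) = 0)
    (h₀₂ : metric c x (X 0) (X 2) = 0) (h₁₂ : metric c x (X 1) (X 2) = 0)
    (hm₀ : metric c x (X 0) (X 3) = g₀ * m₀) (hm₁ : metric c x (X 1) (X 3) = g₁ * m₁)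
    (hm₂ : metric c x (X 2) (X 3) = g₂ * m₂)
    (hn : metric c x (X 3) (X 3) = n + g₀ * m₀ ^ 2 + g₁ * m₁ ^ 2 + g₂ * m₂ ^ 2)
    (hg₀ : 0 < g₀) (hg₁ : 0 < g₁) (hg₂ : 0 < g₂) (hn_pos : 0 < n)
    (hΦ : cayleyForm c x X ^ 2 = g₀ * g₁ * g₂ * n) :
    IsCayleyPlane c x (Submodule.span ℝ (Set.range X)) := by
  -- Gram--Schmidt: `N` is the component of the last vector orthogonal to the others
  set N : Amb := X 3 - m₀ • X 0 - m₁ • X 1 - m₂ • X 2 with hN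
  have hX3 : X 3 = N + m₀ • X 0 + m₁ • X 1 + m₂ • X 2 := by rw [hN]; module
  have h0N : metric c x (X 0) N = 0 := by
    rw [hN]
    simp only [metric_sub_right, metric_smul_right, hm₀, h₀, h₀₁, h₀₂]; ring
  have h1N : metric c x (X 1) N = 0 := by
    rw [hN]
    simp only [metric_sub_right, metric_smul_right, hm₁, h₁, metric_comm c x (X 1) (X 0), h₀₁,
      h₁₂]; ring
  have h2N : metric c x (X 2) N = 0 := by
    rw [hN]
    simp only [metric_sub_right, metric_smul_right, hm₂, h₂, metric_comm c x (X 2) (X 0),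
      metric_comm c x (X 2) (X 1), h₀₂, h₁₂]; ring
  have hNN : metric c x N N = n := by
    have : metric c x (X 3) N = metric c x N N := by
      conv_lhs => rw [hX3]
      simp only [metric_add_left, metric_smul_left, h0N, h1N, h2N]; ring
    rw [← this, hN]
    simp only [metric_sub_right, metric_smul_right, hn, metric_comm c x (X 3) (X 0),
      metric_comm c x (X 3) (X 1), metric_comm c x (X 3) (X 2), hm₀, hm₁, hm₂]; ring
  set d := Real.sqrt (g₀ * g₁ * g₂ * n) with hd
  have hdpos : 0 < d := Real.sqrt_pos.2 (by positivity)
  have hdsq : d ^ 2 = g₀ * g₁ * g₂ * n := Real.sq_sqrt (by positivity)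
  -- the sign `σ` of the Cayley form selects the orientation
  obtain ⟨σ, hσ, hσΦ⟩ : ∃ σ : ℝ, σ * σ = 1 ∧ σ * cayleyForm c x X = d := by
    rcases sq_eq_sq_iff_eq_or_eq_neg.1 (hΦ.trans hdsq.symm) with h | h
    · exact ⟨1, by ring, by rw [h]; ring⟩
    · exact ⟨-1, by ring, by rw [h]; ring⟩
  set Y : Fin 4 → Amb := ![X 0, X 1, X 2, N] with hY
  set k : Fin 4 → ℝ := ![(Real.sqrt g₀)⁻¹, (Real.sqrt g₁)⁻¹, (Real.sqrt g₂)⁻¹,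
    σ * (Real.sqrt n)⁻¹] with hk
  have hσ0 : σ ≠ 0 := by rintro rfl; simp at hσ
  have hkne : ∀ a, k a ≠ 0 := by
    have := Real.sqrt_pos.2 hg₀
    have := Real.sqrt_pos.2 hg₁
    have := Real.sqrt_pos.2 hg₂
    have := Real.sqrt_pos.2 hn_pos
    intro a; fin_cases a <;> simp [hk] <;> first | positivity | exact ⟨hσ0, by positivity⟩
  have hprod : ∏ a, k a = σ * d⁻¹ := by
    rw [Fin.prod_univ_four, hd, Real.sqrt_mul (by positivity), Real.sqrt_mul (by positivity),
      Real.sqrt_mul (by positivity)]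
    simp [hk]; ring
  have hYX : cayleyForm c x Y = cayleyForm c x X := by
    have e1 : Y = Function.update X 3 N := by
      ext1 a; fin_cases a <;> simp [hY]
    have e2 : ∀ a : Fin 4, a ≠ 3 → cayleyAlt c x (Function.update X 3 (X a)) = 0 := fun a ha =>
      (cayleyAlt c x).map_eq_zero_of_eq _ (i := a) (j := 3) (by simp [ha]) ha
    rw [← cayleyAlt_apply, ← cayleyAlt_apply, e1, hN]
    simp [e2, AlternatingMap.map_update_sub, AlternatingMap.map_update_smul]
  refine ⟨fun a => k a • Y a, ?_, ?_, ?_⟩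
  · apply le_antisymm
    · rw [Submodule.span_le]
      rintro _ ⟨a, rfl⟩
      have hmem : ∀ b, X b ∈ Submodule.span ℝ (Set.range X) := fun b =>
        Submodule.subset_span (Set.mem_range_self b)
      refine Submodule.smul_mem _ _ ?_
      fin_cases a
      · exact hmem 0
      · exact hmem 1
      · exact hmem 2
      · exact Submodule.sub_mem _ (Submodule.sub_mem _ (Submodule.sub_mem _ (hmem 3)
          (Submodule.smul_mem _ _ (hmem 0))) (Submodule.smul_mem _ _ (hmem 1)))
          (Submodule.smul_mem _ _ (hmem 2))
    · rw [Submodule.span_le]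
      have hmem : ∀ b, Y b ∈ Submodule.span ℝ (Set.range fun a => k a • Y a) := fun b => by
        have : Y b = (k b)⁻¹ • k b • Y b := by rw [smul_smul, inv_mul_cancel₀ (hkne b), one_smul]
        rw [this]
        exact Submodule.smul_mem _ _ (Submodule.subset_span (Set.mem_range_self b))
      rintro _ ⟨a, rfl⟩
      fin_cases a
      · exact hmem 0
      · exact hmem 1
      · exact hmem 2
      · change X 3 ∈ _
        rw [hX3]
        exact Submodule.add_mem _ (Submodule.add_mem _ (Submodule.add_mem _ (hmem 3)
          (Submodule.smul_mem _ _ (hmem 0))) (Submodule.smul_mem _ _ (hmem 1)))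
          (Submodule.smul_mem _ _ (hmem 2))
  · intro a b
    have s₀ := Real.mul_self_sqrt hg₀.le
    have s₁ := Real.mul_self_sqrt hg₁.le
    have s₂ := Real.mul_self_sqrt hg₂.le
    have s₃ := Real.mul_self_sqrt hn_pos.le
    have e : metric c x (k a • Y a) (k b • Y b) = k a * k b * metric c x (Y a) (Y b) := by
      rw [metric_smul_left, metric_smul_right]; ring
    have i₀ : (Real.sqrt g₀)⁻¹ * (Real.sqrt g₀)⁻¹ * g₀ = 1 := by
      rw [← mul_inv, s₀, inv_mul_cancel₀ hg₀.ne']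
    have i₁ : (Real.sqrt g₁)⁻¹ * (Real.sqrt g₁)⁻¹ * g₁ = 1 := by
      rw [← mul_inv, s₁, inv_mul_cancel₀ hg₁.ne']
    have i₂ : (Real.sqrt g₂)⁻¹ * (Real.sqrt g₂)⁻¹ * g₂ = 1 := by
      rw [← mul_inv, s₂, inv_mul_cancel₀ hg₂.ne']
    have i₃ : σ * (Real.sqrt n)⁻¹ * (σ * (Real.sqrt n)⁻¹) * n = 1 := by
      rw [mul_mul_mul_comm, hσ, one_mul, ← mul_inv, s₃, inv_mul_cancel₀ hn_pos.ne']
    have hYY : metric c x (Y a) (Y b) = if a = b then ![g₀, g₁, g₂, n] a else 0 := by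
      have c₀ := metric_comm c x N (X 0)
      have c₁ := metric_comm c x N (X 1)
      have c₂ := metric_comm c x N (X 2)
      rw [h0N] at c₀
      rw [h1N] at c₁
      rw [h2N] at c₂
      have c₃ := (metric_comm c x (X 1) (X 0)).trans h₀₁
      have c₄ := (metric_comm c x (X 2) (X 0)).trans h₀₂
      have c₅ := (metric_comm c x (X 2) (X 1)).trans h₁₂
      clear_value N
      fin_cases a <;> fin_cases b <;> assumption
    have hkk : k a * k a * ![g₀, g₁, g₂, n] a = 1 := by
      fin_cases a <;> assumption
    rw [e, hYY]
    split_ifs with hab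
    · rw [← hab, hkk]
    · rw [mul_zero]
  · rw [cayleyForm_smul_univ, hprod, hYX, mul_assoc, mul_left_comm, hσΦ, inv_mul_cancel₀ hdpos.ne']

/-! ### The tensors at a point of the slice -/

/-- The point of the slice over `β = δ = 0` in terms of `A = sin (π/4 - α/2)` and
`B = cos (π/4 - α/2)`, for which `sin α = B² - A²` and `cos α = 2 A B`. -/
def slice₀ (A B s t : ℝ) : Amb :=
  ((B ^ 2 - A ^ 2, quat 0 (2 * A * B) 0 0), (quat (A * s) 0 0 (A * t), quat 0 (B * s) (-(B * t)) 0))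

/-- The tangent vector `a ∂_α + b ∂_β + s' ∂_s + t' ∂_t + d ∂_δ` at `slice₀ A B s t`. -/
def velocity₀ (A B s t a b s' t' d : ℝ) : Amb :=
  ((a * (2 * A * B), quat (b * (B ^ 2 - A ^ 2)) (-(a * (B ^ 2 - A ^ 2))) 0 0),
    (quat (A * s' - a * B * s / 2) (-(b * B * s + d * A * s) / 2) ((b * B * t - d * A * t) / 2)
      (A * t' - a * B * t / 2),
     quat ((b * A * s + d * B * s) / 2) (B * s' + a * A * s / 2) (-(B * t' + a * A * t / 2))
      ((b * A * t - d * B * t) / 2)))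

/-- The three generators of the orbit followed by a transverse vector. -/
def orbitBasis₀ (A B s t a b s' t' d : ℝ) : Fin 4 → Amb :=
  ![infAct (quat 0 1 0 0) (slice₀ A B s t), infAct (quat 0 0 1 0) (slice₀ A B s t),
    infAct (quat 0 0 0 1) (slice₀ A B s t), velocity₀ A B s t a b s' t' d]

/-- The element `σ₁ q` of the fibre over `slice₀ A B s t`, where `σ₁ = (A, B i)` is the unit
spinor of the frame. -/
def fibre₀ (A B : ℝ) (q : ℍ[ℝ]) : Spinor :=
  (quat (A * q.re) (A * q.imI) (A * q.imJ) (A * q.imK),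
   quat (-(B * q.imI)) (B * q.re) (-(B * q.imK)) (B * q.imJ))

lemma innerS_fibre₀ (A B : ℝ) (q q' : ℍ[ℝ]) : innerS (fibre₀ A B q) (fibre₀ A B q') =
    (A ^ 2 + B ^ 2) * (q.re * q'.re + q.imI * q'.imI + q.imJ * q'.imJ + q.imK * q'.imK) := by
  simp [innerS, fibre₀, Quaternion.inner_def]; ring

lemma rightForm_fibre₀ (A B : ℝ) (q q' : ℍ[ℝ]) : rightForm (fibre₀ A B q) (fibre₀ A B q') =
    (A ^ 2 + B ^ 2) * (-q.imI * q'.re + q.re * q'.imI + q.imK * q'.imJ - q.imJ * q'.imK) := by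
  simp [rightForm_eq, innerS, fibre₀, Quaternion.inner_def]; ring

lemma mixed_fibre₀_normal (A B x y z w : ℝ) (q q' : ℍ[ℝ]) :
    mixed (0, quat 0 0 x y) (0, quat 0 0 z w) (fibre₀ A B q) (fibre₀ A B q') =
      (A ^ 2 + B ^ 2) * (x * w - y * z) *
        (q.re * q'.imI - q.imI * q'.re + q.imJ * q'.imK - q.imK * q'.imJ) := by
  simp [mixed, cliff, innerS, fibre₀, Quaternion.inner_def]; ring

lemma mixed_fibre₀ (A B x y a b : ℝ) (q q' : ℍ[ℝ]) :
    mixed (0, quat 0 0 x y)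
      (a * (2 * A * B), quat (b * (B ^ 2 - A ^ 2)) (-(a * (B ^ 2 - A ^ 2))) 0 0)
      (fibre₀ A B q) (fibre₀ A B q') =
      (A ^ 2 + B ^ 2) ^ 2 * a *
          (y * (q.re * q'.imJ - q.imI * q'.imK - q.imJ * q'.re + q.imK * q'.imI)
            - x * (q.re * q'.imK + q.imI * q'.imJ - q.imJ * q'.imI - q.imK * q'.re))
        - (A ^ 2 + B ^ 2) * (b * (B ^ 2 - A ^ 2)) *
          (x * (q.re * q'.imJ - q.imI * q'.imK - q.imJ * q'.re + q.imK * q'.imI)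
            + y * (q.re * q'.imK + q.imI * q'.imJ - q.imJ * q'.imI - q.imK * q'.re)) := by
  simp [mixed, cliff, innerS, fibre₀, Quaternion.inner_def]; ring

variable {A B : ℝ}

/-- The projection to the fibre `{σ₁ q}` over the point of the slice, in terms of the coordinate
`q ∈ ℍ`. -/
lemma vert_slice₀ (h : A ^ 2 + B ^ 2 = 1) (s t : ℝ) (v : Amb) : vert (slice₀ A B s t) v =
    fibre₀ A B (quat (A * v.2.1.re + B * v.2.2.imI) (A * v.2.1.imI - B * v.2.2.re)
      (A * v.2.1.imJ + B * v.2.2.imK) (A * v.2.1.imK - B * v.2.2.imJ)) := by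
  ext <;> simp [vert, slice₀, fibre₀, cliff]
  · linear_combination (-v.2.1.re / 2) * h
  · linear_combination (-v.2.1.imI / 2) * h
  · linear_combination (-v.2.1.imJ / 2) * h
  · linear_combination (-v.2.1.imK / 2) * h
  · linear_combination (-v.2.2.re / 2) * h
  · linear_combination (-v.2.2.imI / 2) * h
  · linear_combination (-v.2.2.imJ / 2) * h
  · linear_combination (-v.2.2.imK / 2) * h

lemma vert_infAct_i (h : A ^ 2 + B ^ 2 = 1) (s t : ℝ) :
    vert (slice₀ A B s t) (infAct (quat 0 1 0 0) (slice₀ A B s t)) =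
      fibre₀ A B (quat 0 s (-t) 0) := by
  rw [vert_slice₀ h]
  congr 1
  ext <;> simp [slice₀, infAct]
  · linear_combination s * h
  · linear_combination -t * h

lemma vert_infAct_j (h : A ^ 2 + B ^ 2 = 1) (s t : ℝ) :
    vert (slice₀ A B s t) (infAct (quat 0 0 1 0) (slice₀ A B s t)) =
      fibre₀ A B (quat 0 (-((B ^ 2 - A ^ 2) * t)) (-((B ^ 2 - A ^ 2) * s)) 0) := by
  rw [vert_slice₀ h]
  congr 1
  ext <;> simp [slice₀, infAct] <;> ring

lemma vert_infAct_k (h : A ^ 2 + B ^ 2 = 1) (s t : ℝ) :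
    vert (slice₀ A B s t) (infAct (quat 0 0 0 1) (slice₀ A B s t)) =
      fibre₀ A B (quat ((B ^ 2 - A ^ 2) * t) 0 0 (-((B ^ 2 - A ^ 2) * s))) := by
  rw [vert_slice₀ h]
  congr 1
  ext <;> simp [slice₀, infAct] <;> ring

lemma vert_velocity₀ (h : A ^ 2 + B ^ 2 = 1) (s t a b s' t' d : ℝ) :
    vert (slice₀ A B s t) (velocity₀ A B s t a b s' t' d) =
      fibre₀ A B (quat s' (-((d + b * (2 * A * B)) * s) / 2) (-((d - b * (2 * A * B)) * t) / 2)
        t') := by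
  rw [vert_slice₀ h]
  congr 1
  ext <;> simp [velocity₀]
  · linear_combination s' * h
  · linear_combination -(d * s / 2) * h
  · linear_combination -(d * t / 2) * h
  · linear_combination t' * h

lemma infAct_i_fst (s t : ℝ) : (infAct (quat 0 1 0 0) (slice₀ A B s t)).1 = (0, quat 0 0 0 0) := by
  ext <;> simp [infAct, slice₀]

lemma infAct_j_fst (s t : ℝ) :
    (infAct (quat 0 0 1 0) (slice₀ A B s t)).1 = (0, quat 0 0 0 (-(2 * (2 * A * B)))) := by
  ext <;> simp [infAct, slice₀]; ring

lemma infAct_k_fst (s t : ℝ) :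
    (infAct (quat 0 0 0 1) (slice₀ A B s t)).1 = (0, quat 0 0 (2 * (2 * A * B)) 0) := by
  ext <;> simp [infAct, slice₀]; ring

lemma inner5_quat (x y z w u x' y' z' w' u' : ℝ) :
    inner5 (x, quat y z w u) (x', quat y' z' w' u') =
      x * x' + y * y' + z * z' + w * w' + u * u' := by
  simp [inner5, Quaternion.inner_def]; ring

lemma innerS_slice₀ (h : A ^ 2 + B ^ 2 = 1) (s t : ℝ) :
    innerS (slice₀ A B s t).2 (slice₀ A B s t).2 = s ^ 2 + t ^ 2 := by
  simp only [innerS, slice₀, Quaternion.inner_def]; simp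
  linear_combination (s ^ 2 + t ^ 2) * h

lemma volVert_orbitBasis₀ (h : A ^ 2 + B ^ 2 = 1) (s t a b s' t' d : ℝ) :
    volVert (slice₀ A B s t) (orbitBasis₀ A B s t a b s' t' d) =
      (B ^ 2 - A ^ 2) ^ 2 * (s ^ 2 + t ^ 2) * (s * s' + t * t') := by
  simp only [volVert, orbitBasis₀, Matrix.cons_val, vert_infAct_i h, vert_infAct_j h,
    vert_infAct_k h, vert_velocity₀ h, rightForm_fibre₀, h, re_quat, imI_quat, imJ_quat, imK_quat]
  ring

lemma sumAOmega_orbitBasis₀ (h : A ^ 2 + B ^ 2 = 1) (s t a b s' t' d : ℝ) :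
    sumAOmega (slice₀ A B s t) (orbitBasis₀ A B s t a b s' t' d) =
      4 * (2 * A * B) * (B ^ 2 - A ^ 2) * (s ^ 2 + t ^ 2) * a
        - 4 * (2 * A * B) ^ 2 * (s * s' + t * t') := by
  have hv : (velocity₀ A B s t a b s' t' d).1 =
    (a * (2 * A * B), quat (b * (B ^ 2 - A ^ 2)) (-(a * (B ^ 2 - A ^ 2))) 0 0) := rfl
  simp only [sumAOmega, orbitBasis₀, Matrix.cons_val, vert_infAct_i h, vert_infAct_j h,
    vert_infAct_k h, vert_velocity₀ h, infAct_i_fst, infAct_j_fst, infAct_k_fst, hv,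
    mixed_fibre₀_normal, mixed_fibre₀, h, re_quat, imI_quat, imJ_quat, imK_quat]
  ring

/-! ### The Cayley condition for the orbit of a curve -/

/-- The horizontal part `L₁` and the spinor part `L₂` of an ambient linear map which is orthogonal
and compatible with Clifford multiplication and with the right multiplication by `i`. It then
preserves `vert`, `metric`, `volVert` and `sumAOmega`. No condition on the orientation is imposed,
so that `volHor` is only preserved up to sign. -/
structure IsTensorSymmetry (L₁ : R5 →ₗ[ℝ] R5) (L₂ : Spinor →ₗ[ℝ] Spinor) : Prop where
  inner5 : ∀ X Y, inner5 (L₁ X) (L₁ Y) = inner5 X Y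
  innerS : ∀ ξ ζ, innerS (L₂ ξ) (L₂ ζ) = innerS ξ ζ
  cliff : ∀ X ξ, cliff (L₁ X) (L₂ ξ) = L₂ (cliff X ξ)
  right : ∀ ξ : Spinor, ((L₂ ξ).1 * quat 0 1 0 0, (L₂ ξ).2 * quat 0 1 0 0) =
    L₂ (ξ.1 * quat 0 1 0 0, ξ.2 * quat 0 1 0 0)

namespace IsTensorSymmetry

variable {L₁ M₁ : R5 →ₗ[ℝ] R5} {L₂ M₂ : Spinor →ₗ[ℝ] Spinor}

lemma comp (hL : IsTensorSymmetry L₁ L₂) (hM : IsTensorSymmetry M₁ M₂) :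
    IsTensorSymmetry (L₁ ∘ₗ M₁) (L₂ ∘ₗ M₂) where
  inner5 X Y := by simp [hL.inner5, hM.inner5]
  innerS X Y := by simp [hL.innerS, hM.innerS]
  cliff X ξ := by simp [hL.cliff, hM.cliff]
  right ξ := by
    have := hL.right (M₂ ξ)
    rw [hM.right] at this
    exact this

variable (hL : IsTensorSymmetry L₁ L₂)
include hL

lemma vert_map (x v : Amb) : vert (L₁.prodMap L₂ x) (L₁.prodMap L₂ v) = L₂ (vert x v) := by
  simp [vert, hL.cliff]

lemma cr_map (c : ℝ) (x : Amb) : cr c (L₁.prodMap L₂ x) = cr c x := by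
  simp [cr, hL.innerS]

lemma metric_map (c : ℝ) (x v w : Amb) :
    metric c (L₁.prodMap L₂ x) (L₁.prodMap L₂ v) (L₁.prodMap L₂ w) = metric c x v w := by
  simp only [metric, hL.vert_map, hL.cr_map, hL.innerS]
  simp [hL.inner5]

lemma rightForm_map (ξ ζ : Spinor) : rightForm (L₂ ξ) (L₂ ζ) = rightForm ξ ζ := by
  rw [rightForm_eq, rightForm_eq, hL.right, hL.innerS]

lemma mixed_map (X Y : R5) (ξ ζ : Spinor) :
    mixed (L₁ X) (L₁ Y) (L₂ ξ) (L₂ ζ) = mixed X Y ξ ζ := by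
  simp [mixed, hL.cliff, hL.innerS]

lemma volVert_map (x : Amb) (v : Fin 4 → Amb) :
    volVert (L₁.prodMap L₂ x) (fun a => L₁.prodMap L₂ (v a)) = volVert x v := by
  simp only [volVert, hL.vert_map, hL.rightForm_map]

lemma sumAOmega_map (x : Amb) (v : Fin 4 → Amb) :
    sumAOmega (L₁.prodMap L₂ x) (fun a => L₁.prodMap L₂ (v a)) = sumAOmega x v := by
  simp only [sumAOmega, hL.vert_map]
  simp only [LinearMap.prodMap_apply, hL.mixed_map]

end IsTensorSymmetry

/-- The horizontal volume form vanishes if one of the vectors is vertical. On an orbit this applies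
to the generator of the stabilizer of the base point. -/
lemma volHor_eq_zero {x : Amb} {v : Fin 4 → Amb} (h : (v 0).1 = 0) : volHor x v = 0 := by
  refine Matrix.det_eq_zero_of_row_eq_zero 1 fun j => ?_
  fin_cases j <;> simp [h, coords5]

/-- A Gram determinant in which the first three vectors are orthogonal. -/
lemma det_gram (g₀ g₁ g₂ m₀ m₁ m₂ n : ℝ) :
    !![g₀, 0, 0, m₀; 0, g₁, 0, m₁; 0, 0, g₂, m₂; m₀, m₁, m₂, n].det =
      g₀ * g₁ * g₂ * n - m₀ ^ 2 * g₁ * g₂ - m₁ ^ 2 * g₀ * g₂ - m₂ ^ 2 * g₀ * g₁ := by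
  simp [Matrix.det_succ_row_zero, Fin.sum_univ_succ, Fin.succAbove]
  ring

/-- The algebraic core of the Cayley condition. The left hand side is the Gram determinant of the
generators of an orbit and a velocity minus the square of the Cayley form on them, and the right
hand side is a sum of squares with positive coefficients. Here `S = sin α`, `C = cos α`,
`ρ = c + s² + t²` and `p = ρ ^ (-2/5)`; the relation `S² + C² = 1` is not needed. -/
lemma det_gram_sub_sq (p ρ S C s t a b s' t' d : ℝ) :
    let r := s ^ 2 + t ^ 2
    let D := 4 * C ^ 2 * (5 * p * ρ) + S ^ 2 * (4 * p) * r
    4 * p * r * D * D * (5 * p * ρ * (a ^ 2 + S ^ 2 * b ^ 2)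
          + 4 * p * (s' ^ 2 + t' ^ 2 + ((d + b * C) * s / 2) ^ 2 + ((d - b * C) * t / 2) ^ 2))
        - (4 * p * (-(b * C * r + d * (s ^ 2 - t ^ 2)) / 2)) ^ 2 * D * D
        - (4 * p * S * (d * s * t)) ^ 2 * (4 * p * r) * D
        - (4 * p * S * (t * s' - s * t')) ^ 2 * (4 * p * r) * D
        - (16 * p ^ 2 * (S ^ 2 * r * (s * s' + t * t'))
            + 20 * (p ^ 2 * ρ) * (4 * C * S * r * a - 4 * C ^ 2 * (s * s' + t * t'))) ^ 2 =
      4 * p * r * D ^ 2 * (5 * p * ρ) * S ^ 2 * b ^ 2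
        + 4 * C ^ 2 * (4 * p) ^ 2 * (5 * p * ρ) * D * ((t * s' - s * t') ^ 2 + (d * s * t) ^ 2)
        + 4 * p * (5 * p * ρ) * r * (4 * p) ^ 2 *
          ((5 * C ^ 2 * ρ - S ^ 2 * r) * a + 4 * S * C * (s * s' + t * t')) ^ 2 := by
  intro r D
  simp only [r, D]
  ring

/-- The powers of `ρ = c + r²` in the metric and in the Cayley form are monomials in
`p = ρ ^ (-2/5)` and `ρ`. -/
lemma rpow_weights {ρ : ℝ} (hρ : 0 < ρ) : ∃ p : ℝ, 0 < p ∧ ρ ^ (-(2 / 5) : ℝ) = p ∧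
    ρ ^ (3 / 5 : ℝ) = p * ρ ∧ ρ ^ (-(4 / 5) : ℝ) = p ^ 2 ∧ ρ ^ (1 / 5 : ℝ) = p ^ 2 * ρ := by
  refine ⟨ρ ^ (-(2 / 5) : ℝ), Real.rpow_pos_of_pos hρ _, rfl, ?_, ?_, ?_⟩
  · rw [← Real.rpow_add_one hρ.ne']; norm_num
  · rw [← Real.rpow_natCast, ← Real.rpow_mul hρ.le]; norm_num
  · rw [← Real.rpow_natCast, ← Real.rpow_mul hρ.le, ← Real.rpow_add_one hρ.ne']; norm_num

section

variable {A B s t p ρ c : ℝ}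

lemma metric_slice₀ (h : A ^ 2 + B ^ 2 = 1) (hρ : c + s ^ 2 + t ^ 2 = ρ)
    (hp : ρ ^ (-(2 / 5) : ℝ) = p) (hp' : ρ ^ (3 / 5 : ℝ) = p * ρ) (v w : Amb) :
    metric c (slice₀ A B s t) v w = 4 * p * innerS (vert (slice₀ A B s t) v)
      (vert (slice₀ A B s t) w) + 5 * p * ρ * inner5 v.1 w.1 := by
  have : cr c (slice₀ A B s t) = ρ := by rw [cr, innerS_slice₀ h, ← hρ]; ring
  rw [metric, this, hp, hp']; ring

/-- The Gram matrix of the generators of an orbit and a transverse vector. -/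
lemma gram_orbitBasis₀ (h : A ^ 2 + B ^ 2 = 1) {S C r D : ℝ} (hS : B ^ 2 - A ^ 2 = S)
    (hC : 2 * A * B = C) (hr : s ^ 2 + t ^ 2 = r)
    (hD : 4 * C ^ 2 * (5 * p * ρ) + S ^ 2 * (4 * p) * r = D) (hρ : c + s ^ 2 + t ^ 2 = ρ)
    (hp : ρ ^ (-(2 / 5) : ℝ) = p) (hp' : ρ ^ (3 / 5 : ℝ) = p * ρ) (a b s' t' d : ℝ) :
    (Matrix.of fun i j => metric c (slice₀ A B s t) (orbitBasis₀ A B s t a b s' t' d i)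
        (orbitBasis₀ A B s t a b s' t' d j)) =
      !![4 * p * r, 0, 0, 4 * p * (-(b * C * r + d * (s ^ 2 - t ^ 2)) / 2);
        0, D, 0, 4 * p * S * (d * s * t); 0, 0, D, 4 * p * S * (t * s' - s * t');
        4 * p * (-(b * C * r + d * (s ^ 2 - t ^ 2)) / 2), 4 * p * S * (d * s * t),
        4 * p * S * (t * s' - s * t'),
        5 * p * ρ * (a ^ 2 + S ^ 2 * b ^ 2) + 4 * p * (s' ^ 2 + t' ^ 2
          + ((d + b * C) * s / 2) ^ 2 + ((d - b * C) * t / 2) ^ 2)] := by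
  have hSC : S ^ 2 + C ^ 2 = 1 := by
    rw [← hS, ← hC]
    linear_combination (A ^ 2 + B ^ 2 + 1) * h
  have hv : (velocity₀ A B s t a b s' t' d).1 = (a * C, quat (b * S) (-(a * S)) 0 0) := by
    rw [← hS, ← hC]; rfl
  ext i j
  rw [Matrix.of_apply, metric_slice₀ h hρ hp hp']
  fin_cases i <;> fin_cases j <;>
    simp [-mul_eq_zero, -mul_eq_mul_left_iff, orbitBasis₀, vert_infAct_i h, vert_infAct_j h,
      vert_infAct_k h, vert_velocity₀ h,
      infAct_i_fst, infAct_j_fst, infAct_k_fst, hv, innerS_fibre₀, inner5_quat, h, hS, hC, ← hD,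
      ← hr] <;> try ring1
  linear_combination 5 * p * ρ * a ^ 2 * hSC

lemma cayleyForm_orbitBasis₀ {L₁ : R5 →ₗ[ℝ] R5} {L₂ : Spinor →ₗ[ℝ] Spinor}
    (hL : IsTensorSymmetry L₁ L₂) (h : A ^ 2 + B ^ 2 = 1) (hρ : c + s ^ 2 + t ^ 2 = ρ)
    (hp : ρ ^ (-(4 / 5) : ℝ) = p ^ 2) (hp' : ρ ^ (1 / 5 : ℝ) = p ^ 2 * ρ) (a b s' t' d : ℝ) :
    cayleyForm c (L₁.prodMap L₂ (slice₀ A B s t))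
        (fun i => L₁.prodMap L₂ (orbitBasis₀ A B s t a b s' t' d i)) =
      16 * p ^ 2 * ((B ^ 2 - A ^ 2) ^ 2 * (s ^ 2 + t ^ 2) * (s * s' + t * t'))
        + 20 * (p ^ 2 * ρ) * (4 * (2 * A * B) * (B ^ 2 - A ^ 2) * (s ^ 2 + t ^ 2) * a
          - 4 * (2 * A * B) ^ 2 * (s * s' + t * t')) := by
  have hcr : cr c (slice₀ A B s t) = ρ := by rw [cr, innerS_slice₀ h, ← hρ]; ring
  rw [cayleyForm, hL.volVert_map, hL.sumAOmega_map, hL.cr_map, hcr, hp, hp',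
    volVert_orbitBasis₀ h, sumAOmega_orbitBasis₀ h, volHor_eq_zero]
  · ring
  · have : (orbitBasis₀ A B s t a b s' t' d 0).1 = 0 := by
      change (infAct (quat 0 1 0 0) (slice₀ A B s t)).1 = 0
      rw [infAct_i_fst]; rfl
    simp [this]

/-- The Cayley condition for the submanifold swept out by a curve of orbits with velocity
`a ∂_α + b ∂_β + s' ∂_s + t' ∂_t + d ∂_δ`: the excess of the Gram determinant over the square
of the Cayley form is a sum of four squares, and their vanishing is the system of ODEs. -/
theorem isCayleyPlane_orbitBasis₀_iff {L₁ : R5 →ₗ[ℝ] R5} {L₂ : Spinor →ₗ[ℝ] Spinor}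
    (hL : IsTensorSymmetry L₁ L₂) (h : A ^ 2 + B ^ 2 = 1) (hc : 0 ≤ c) (hA : 0 < A)
    (hAB : A < B) (hs : 0 < s) (ht : 0 < t) {a b s' t' d : ℝ}
    (hne : ¬(a = 0 ∧ b = 0 ∧ s' = 0 ∧ t' = 0 ∧ d = 0)) :
    IsCayleyPlane c (L₁.prodMap L₂ (slice₀ A B s t)) (Submodule.span ℝ (Set.range
        fun i => L₁.prodMap L₂ (orbitBasis₀ A B s t a b s' t' d i))) ↔
      b = 0 ∧ d = 0 ∧ t * s' - s * t' = 0 ∧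
        (5 * (2 * A * B) ^ 2 * (c + s ^ 2 + t ^ 2) - (B ^ 2 - A ^ 2) ^ 2 * (s ^ 2 + t ^ 2)) * a
          + 4 * (B ^ 2 - A ^ 2) * (2 * A * B) * (s * s' + t * t') = 0 := by
  obtain ⟨ρ, hρ⟩ : ∃ ρ, c + s ^ 2 + t ^ 2 = ρ := ⟨_, rfl⟩
  have hρ_pos : 0 < ρ := by rw [← hρ]; positivity
  obtain ⟨p, hp, hp₁, hp₂, hp₃, hp₄⟩ := rpow_weights hρ_pos
  obtain ⟨S, hS⟩ : ∃ S, B ^ 2 - A ^ 2 = S := ⟨_, rfl⟩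
  obtain ⟨C, hC⟩ : ∃ C, 2 * A * B = C := ⟨_, rfl⟩
  obtain ⟨r, hr⟩ : ∃ r, s ^ 2 + t ^ 2 = r := ⟨_, rfl⟩
  obtain ⟨D, hD⟩ : ∃ D, 4 * C ^ 2 * (5 * p * ρ) + S ^ 2 * (4 * p) * r = D := ⟨_, rfl⟩
  have hS_pos : 0 < S := by rw [← hS]; nlinarith
  have hC_pos : 0 < C := by have := hA.trans hAB; rw [← hC]; positivity
  have hr_pos : 0 < r := by rw [← hr]; positivity
  have hD_pos : 0 < D := by rw [← hD]; positivity
  have hG := gram_orbitBasis₀ h hS hC hr hD hρ hp₁ hp₂ a b s' t' d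
  have hΦ := cayleyForm_orbitBasis₀ hL h hρ hp₃ hp₄ a b s' t' d
  have hid := det_gram_sub_sq p ρ S C s t a b s' t' d
  simp only [hr, hD] at hid
  rw [hS, hC, hr] at hΦ
  rw [hρ, hS, hC, hr]
  constructor
  · intro hcay
    have h1 := sq_cayleyForm_eq_det hcay
    simp only [hL.metric_map] at h1
    rw [hG, det_gram, hΦ] at h1
    have h2 : 4 * p * r * D ^ 2 * (5 * p * ρ) * S ^ 2 * b ^ 2
        + 4 * C ^ 2 * (4 * p) ^ 2 * (5 * p * ρ) * D * ((t * s' - s * t') ^ 2 + (d * s * t) ^ 2)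
        + 4 * p * (5 * p * ρ) * r * (4 * p) ^ 2 *
          ((5 * C ^ 2 * ρ - S ^ 2 * r) * a + 4 * S * C * (s * s' + t * t')) ^ 2 = 0 := by
      rw [← hid]
      linear_combination -h1
    have k₁ : 0 < 4 * p * r * D ^ 2 * (5 * p * ρ) * S ^ 2 := by positivity
    have k₂ : 0 < 4 * C ^ 2 * (4 * p) ^ 2 * (5 * p * ρ) * D := by positivity
    have k₃ : 0 < 4 * p * (5 * p * ρ) * r * (4 * p) ^ 2 := by positivity
    clear hid h1 hΦ hG
    generalize (5 * C ^ 2 * ρ - S ^ 2 * r) * a + 4 * S * C * (s * s' + t * t') = E at h2 ⊢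
    generalize 4 * p * r * D ^ 2 * (5 * p * ρ) * S ^ 2 = u₁ at h2 k₁
    generalize 4 * C ^ 2 * (4 * p) ^ 2 * (5 * p * ρ) * D = u₂ at h2 k₂
    generalize 4 * p * (5 * p * ρ) * r * (4 * p) ^ 2 = u₃ at h2 k₃
    have n₁ : 0 ≤ u₁ * b ^ 2 := by positivity
    have n₂ : 0 ≤ u₂ * (t * s' - s * t') ^ 2 := by positivity
    have n₃ : 0 ≤ u₂ * (d * s * t) ^ 2 := by positivity
    have n₄ : 0 ≤ u₃ * E ^ 2 := by positivity
    have z₁ : u₁ * b ^ 2 = 0 := by linarith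
    have z₂ : u₂ * (t * s' - s * t') ^ 2 = 0 := by linarith
    have z₃ : u₂ * (d * s * t) ^ 2 = 0 := by linarith
    have z₄ : u₃ * E ^ 2 = 0 := by linarith
    simp only [mul_eq_zero, k₁.ne', k₂.ne', k₃.ne', false_or, ne_eq, OfNat.ofNat_ne_zero,
      not_false_eq_true, pow_eq_zero_iff, hs.ne', ht.ne', or_false] at z₁ z₂ z₃ z₄
    exact ⟨z₁, z₃, z₂, z₄⟩
  · rintro ⟨rfl, rfl, hK, hE⟩
    have hGe : ∀ i j, metric c (L₁.prodMap L₂ (slice₀ A B s t))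
        (L₁.prodMap L₂ (orbitBasis₀ A B s t a 0 s' t' 0 i))
        (L₁.prodMap L₂ (orbitBasis₀ A B s t a 0 s' t' 0 j)) = _ := fun i j =>
      (hL.metric_map c _ _ _).trans (congrFun (congrFun hG i) j)
    have hn_pos : 0 < 5 * p * ρ * a ^ 2 + 4 * p * (s' ^ 2 + t' ^ 2) := by
      by_cases ha : a = 0
      · by_cases hs' : s' = 0
        · have ht' : t' ≠ 0 := fun ht' => hne ⟨ha, rfl, hs', ht', rfl⟩
          positivity
        · positivity
      · positivity
    refine isCayleyPlane_of_sq_eq (g₀ := 4 * p * r) (g₁ := D) (g₂ := D) (m₀ := 0) (m₁ := 0)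
      (m₂ := 0) (n := 5 * p * ρ * a ^ 2 + 4 * p * (s' ^ 2 + t' ^ 2)) ((hGe 0 0).trans ?_)
      ((hGe 1 1).trans ?_) ((hGe 2 2).trans ?_) ((hGe 0 1).trans ?_) ((hGe 0 2).trans ?_)
      ((hGe 1 2).trans ?_) ((hGe 0 3).trans ?_) ((hGe 1 3).trans ?_) ((hGe 2 3).trans ?_)
      ((hGe 3 3).trans ?_) (by positivity) hD_pos hD_pos hn_pos ?_
    · simp
    · simp
    · simp
    · simp
    · simp
    · simp
    · simp
    · simp
    · simp [hK]
    · simp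
    · rw [hΦ]
      rw [hE, hK] at hid
      linear_combination -hid

end

/-! ### The symmetries, and the tangent spaces of the swept-out submanifolds -/

/-- Conjugation of the `ℝ³`-part of `ℝ⁵` by a quaternion. -/
def conjMap (g : ℍ[ℝ]) : R5 →ₗ[ℝ] R5 where
  toFun X := (X.1, g * X.2 * star g)
  map_add' X Y := by simp [mul_add, add_mul]
  map_smul' r X := by simp

/-- Left multiplication of spinors by a quaternion. -/
def leftMap (g : ℍ[ℝ]) : Spinor →ₗ[ℝ] Spinor where
  toFun ξ := (g * ξ.1, g * ξ.2)
  map_add' X Y := by simp [mul_add]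
  map_smul' r X := by simp

/-- The rotation by `β` of the `ℝ²`-part of `ℝ⁵`. -/
def rotMap (β : ℝ) : R5 →ₗ[ℝ] R5 where
  toFun X := (Real.cos β * X.1 - Real.sin β * X.2.re,
    quat (Real.sin β * X.1 + Real.cos β * X.2.re) X.2.imI X.2.imJ X.2.imK)
  map_add' X Y := by ext <;> simp <;> ring
  map_smul' r X := by ext <;> simp <;> ring

/-- The lift of `rotMap β` to spinors. -/
def rotSpinMap (β : ℝ) : Spinor →ₗ[ℝ] Spinor where
  toFun ξ := (Real.cos (β / 2) • ξ.1 - Real.sin (β / 2) • ξ.2,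
    Real.sin (β / 2) • ξ.1 + Real.cos (β / 2) • ξ.2)
  map_add' X Y := by ext <;> simp <;> ring
  map_smul' r X := by ext <;> simp <;> ring

/-- Right multiplication of spinors by `exp (-i δ / 2)`. -/
def rightMap (δ : ℝ) : Spinor →ₗ[ℝ] Spinor where
  toFun ξ := (ξ.1 * quat (Real.cos (δ / 2)) (-Real.sin (δ / 2)) 0 0,
    ξ.2 * quat (Real.cos (δ / 2)) (-Real.sin (δ / 2)) 0 0)
  map_add' X Y := by simp [add_mul]
  map_smul' r X := by simp

lemma isTensorSymmetry_left (g : SU2) : IsTensorSymmetry (conjMap g) (leftMap g) := by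
  have hg : star (g : ℍ[ℝ]) * g = 1 := Unitary.coe_star_mul_self g
  have hn : ‖(g : ℍ[ℝ])‖ = 1 := CStarRing.norm_coe_unitary g
  have key : ∀ x y : ℍ[ℝ], inner ℝ ((g : ℍ[ℝ]) * x) ((g : ℍ[ℝ]) * y) = inner ℝ x y := by
    intro x y
    rw [real_inner_eq_norm_add_mul_self_sub_norm_mul_self_sub_norm_mul_self_div_two,
      real_inner_eq_norm_add_mul_self_sub_norm_mul_self_sub_norm_mul_self_div_two, ← mul_add]
    simp [hn]
  have key' : ∀ x y : ℍ[ℝ], inner ℝ (x * star (g : ℍ[ℝ])) (y * star (g : ℍ[ℝ])) =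
      inner ℝ x y := by
    intro x y
    rw [real_inner_eq_norm_add_mul_self_sub_norm_mul_self_sub_norm_mul_self_div_two,
      real_inner_eq_norm_add_mul_self_sub_norm_mul_self_sub_norm_mul_self_div_two, ← add_mul]
    simp [hn]
  refine ⟨fun X Y => ?_, fun X Y => ?_, fun X ξ => ?_, fun ξ => ?_⟩
  · simp [inner5, conjMap, key, key', mul_assoc]
  · simp [innerS, leftMap, key]
  · have e : ∀ x y : ℍ[ℝ], (g : ℍ[ℝ]) * x * star (g : ℍ[ℝ]) * ((g : ℍ[ℝ]) * y) = g * (x * y) := by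
      intro x y
      rw [mul_assoc ((g : ℍ[ℝ]) * x), ← mul_assoc (star (g : ℍ[ℝ])), hg, one_mul, mul_assoc]
    simp only [cliff, conjMap, leftMap, LinearMap.coe_mk, AddHom.coe_mk, star_mul, star_star, e,
      mul_add, mul_sub, mul_smul_comm]
    rw [← mul_assoc (g : ℍ[ℝ]) (star X.2), e]
  · simp [leftMap, mul_assoc]

lemma isTensorSymmetry_rot (β : ℝ) : IsTensorSymmetry (rotMap β) (rotSpinMap β) := by
  have h := Real.cos_sq_add_sin_sq β
  have h' := Real.cos_sq_add_sin_sq (β / 2)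
  have hc : Real.cos β * Real.cos (β / 2) + Real.sin β * Real.sin (β / 2) = Real.cos (β / 2) := by
    rw [← Real.cos_sub]; ring_nf
  have hs : Real.sin β * Real.cos (β / 2) - Real.cos β * Real.sin (β / 2) = Real.sin (β / 2) := by
    rw [← Real.sin_sub]; ring_nf
  refine ⟨fun X Y => ?_, fun X Y => ?_, fun X ξ => ?_, fun ξ => ?_⟩
  · simp only [inner5, rotMap, LinearMap.coe_mk, AddHom.coe_mk, Quaternion.inner_def]
    simp
    linear_combination (X.1 * Y.1 + X.2.re * Y.2.re) * h
  · simp only [innerS, rotSpinMap, LinearMap.coe_mk, AddHom.coe_mk, Quaternion.inner_def]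
    simp
    linear_combination (X.1.re * Y.1.re + X.1.imI * Y.1.imI + X.1.imJ * Y.1.imJ + X.1.imK * Y.1.imK
      + X.2.re * Y.2.re + X.2.imI * Y.2.imI + X.2.imJ * Y.2.imJ + X.2.imK * Y.2.imK) * h'
  · ext <;> simp [cliff, rotMap, rotSpinMap]
    · linear_combination (X.1 * ξ.1.re + X.2.re * ξ.2.re) * hc
        + (X.1 * ξ.2.re - X.2.re * ξ.1.re) * hs
    · linear_combination (X.1 * ξ.1.imI + X.2.re * ξ.2.imI) * hc
        + (X.1 * ξ.2.imI - X.2.re * ξ.1.imI) * hs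
    · linear_combination (X.1 * ξ.1.imJ + X.2.re * ξ.2.imJ) * hc
        + (X.1 * ξ.2.imJ - X.2.re * ξ.1.imJ) * hs
    · linear_combination (X.1 * ξ.1.imK + X.2.re * ξ.2.imK) * hc
        + (X.1 * ξ.2.imK - X.2.re * ξ.1.imK) * hs
    · linear_combination (X.1 * ξ.1.re + X.2.re * ξ.2.re) * hs
        + (X.2.re * ξ.1.re - X.1 * ξ.2.re) * hc
    · linear_combination (X.1 * ξ.1.imI + X.2.re * ξ.2.imI) * hs
        + (X.2.re * ξ.1.imI - X.1 * ξ.2.imI) * hc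
    · linear_combination (X.1 * ξ.1.imJ + X.2.re * ξ.2.imJ) * hs
        + (X.2.re * ξ.1.imJ - X.1 * ξ.2.imJ) * hc
    · linear_combination (X.1 * ξ.1.imK + X.2.re * ξ.2.imK) * hs
        + (X.2.re * ξ.1.imK - X.1 * ξ.2.imK) * hc
  · simp [rotSpinMap, sub_mul, add_mul]

lemma isTensorSymmetry_right (δ : ℝ) : IsTensorSymmetry LinearMap.id (rightMap δ) := by
  have h' := Real.cos_sq_add_sin_sq (δ / 2)
  refine ⟨fun X Y => rfl, fun X Y => ?_, fun X ξ => ?_, fun ξ => ?_⟩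
  · simp only [innerS, rightMap, LinearMap.coe_mk, AddHom.coe_mk, Quaternion.inner_def]
    simp
    linear_combination (X.1.re * Y.1.re + X.1.imI * Y.1.imI + X.1.imJ * Y.1.imJ + X.1.imK * Y.1.imK
      + X.2.re * Y.2.re + X.2.imI * Y.2.imI + X.2.imJ * Y.2.imJ + X.2.imK * Y.2.imK) * h'
  · simp [cliff, rightMap, mul_assoc, add_mul, sub_mul]
  · ext <;> simp [rightMap] <;> ring

/-- The horizontal part of the symmetry taking `slice₀` to the point of the orbit. -/
def symHor (g : ℍ[ℝ]) (β : ℝ) : R5 →ₗ[ℝ] R5 := conjMap g ∘ₗ rotMap β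

/-- The spinor part of the symmetry taking `slice₀` to the point of the orbit. -/
def symSpin (g : ℍ[ℝ]) (β δ : ℝ) : Spinor →ₗ[ℝ] Spinor := leftMap g ∘ₗ rotSpinMap β ∘ₗ rightMap δ

lemma isTensorSymmetry_sym (g : SU2) (β δ : ℝ) :
    IsTensorSymmetry (symHor g β) (symSpin g β δ) :=
  (isTensorSymmetry_left g).comp ((isTensorSymmetry_rot β).comp (isTensorSymmetry_right δ))

/-- The map `act g`, which is linear on the ambient space. -/
def actMap (g : ℍ[ℝ]) : Amb →ₗ[ℝ] Amb := (conjMap g).prodMap (leftMap g)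

lemma actMap_apply (g : SU2) (x : Amb) : actMap g x = act g x := rfl

/-- The rotations in `β` and `δ` which take `slice₀` to the point of the slice. -/
def sliceMap (β δ : ℝ) : Amb →ₗ[ℝ] Amb :=
  (rotMap β).prodMap (rotSpinMap β ∘ₗ rightMap δ)

lemma sym_eq (g : ℍ[ℝ]) (β δ : ℝ) (x : Amb) :
    (symHor g β).prodMap (symSpin g β δ) x = actMap g (sliceMap β δ x) := rfl

/-- `A = sin (π/4 - α/2)`, the size of the first component of the unit spinor `σ₁`. -/
def sinHalf (α : ℝ) : ℝ := Real.sin (Real.pi / 4 - α / 2)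

/-- `B = cos (π/4 - α/2)`, the size of the second component of the unit spinor `σ₁`. -/
def cosHalf (α : ℝ) : ℝ := Real.cos (Real.pi / 4 - α / 2)

lemma half_sq_add_sq (α : ℝ) : sinHalf α ^ 2 + cosHalf α ^ 2 = 1 := Real.sin_sq_add_cos_sq _

lemma sin_eq_half (α : ℝ) : Real.sin α = cosHalf α ^ 2 - sinHalf α ^ 2 := by
  have : Real.sin α = Real.cos (2 * (Real.pi / 4 - α / 2)) := by
    rw [← Real.cos_pi_div_two_sub]; ring_nf
  rw [this, Real.cos_two_mul', cosHalf, sinHalf]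

lemma cos_eq_half (α : ℝ) : Real.cos α = 2 * sinHalf α * cosHalf α := by
  have : Real.cos α = Real.sin (2 * (Real.pi / 4 - α / 2)) := by
    rw [← Real.sin_pi_div_two_sub]; ring_nf
  rw [this, Real.sin_two_mul, cosHalf, sinHalf]

lemma sinHalf_pos {α : ℝ} (h : α ∈ Set.Ioo 0 (Real.pi / 2)) : 0 < sinHalf α :=
  Real.sin_pos_of_pos_of_lt_pi (by linarith [h.2]) (by linarith [h.1, Real.pi_pos])

lemma cosHalf_pos {α : ℝ} (h : α ∈ Set.Ioo 0 (Real.pi / 2)) : 0 < cosHalf α :=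
  Real.cos_pos_of_mem_Ioo ⟨by linarith [h.2, Real.pi_pos], by linarith [h.1, Real.pi_pos]⟩

lemma sin_pos_of_mem {α : ℝ} (h : α ∈ Set.Ioo 0 (Real.pi / 2)) : 0 < Real.sin α :=
  Real.sin_pos_of_pos_of_lt_pi h.1 (by linarith [h.2, Real.pi_pos])

lemma cos_pos_of_mem {α : ℝ} (h : α ∈ Set.Ioo 0 (Real.pi / 2)) : 0 < Real.cos α :=
  Real.cos_pos_of_mem_Ioo ⟨by linarith [h.1, Real.pi_pos], h.2⟩

lemma sinHalf_lt_cosHalf {α : ℝ} (h : α ∈ Set.Ioo 0 (Real.pi / 2)) : sinHalf α < cosHalf α := by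
  have h1 := sin_pos_of_mem h
  rw [sin_eq_half] at h1
  nlinarith [sinHalf_pos h, cosHalf_pos h]

lemma basePoint_eq (α β : ℝ) : basePoint α β =
    (Real.sin α * Real.cos β, quat (Real.sin α * Real.sin β) (Real.cos α) 0 0) := rfl

lemma frame_eq (α β : ℝ) : frame α β =
    ![(Real.cos α * Real.cos β, quat (Real.cos α * Real.sin β) (-Real.sin α) 0 0),
      (-Real.sin β, quat (Real.cos β) 0 0 0), (0, quat 0 0 1 0), (0, quat 0 0 0 1)] := rfl

lemma spinorFrame_eq (α β : ℝ) : spinorFrame α β =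
    (quat (sinHalf α * Real.cos (β / 2)) (-(cosHalf α * Real.sin (β / 2))) 0 0,
      quat (sinHalf α * Real.sin (β / 2)) (cosHalf α * Real.cos (β / 2)) 0 0) := rfl

/-- The rotations in `β` and `δ` take the point with `β = δ = 0` to a general point of the
slice. The change from `α` to the angle `π/4 - α/2` makes the spinor polynomial. -/
lemma slicePoint_eq (α β s t δ : ℝ) :
    slicePoint α β s t δ = sliceMap β δ (slice₀ (sinHalf α) (cosHalf α) s t) := by
  have hc : Real.cos β * Real.cos (β / 2) + Real.sin β * Real.sin (β / 2) = Real.cos (β / 2) := by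
    rw [← Real.cos_sub]; ring_nf
  have hs : Real.sin β * Real.cos (β / 2) - Real.cos β * Real.sin (β / 2) = Real.sin (β / 2) := by
    rw [← Real.sin_sub]; ring_nf
  ext <;> simp [slicePoint, fibreSpinor, frame_eq, spinorFrame_eq, cliff, basePoint_eq, sliceMap,
    rotMap, rotSpinMap, rightMap, slice₀, sin_eq_half α, cos_eq_half α] <;>
    generalize Real.cos (δ / 2) = u, Real.sin (δ / 2) = v
  · ring
  · ring
  · ring
  · ring
  · linear_combination t * u * cosHalf α * hs - t * v * sinHalf α * hc
  · linear_combination t * u * sinHalf α * hc + t * v * cosHalf α * hs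
  · ring
  · ring
  · linear_combination -t * u * cosHalf α * hc - t * v * sinHalf α * hs
  · linear_combination t * u * sinHalf α * hs - t * v * cosHalf α * hc

lemma orbitFamily_eq (α β s t δ : ℝ → ℝ) (g : SU2) (τ : ℝ) :
    orbitFamily α β s t δ g τ = (symHor g (β τ)).prodMap (symSpin g (β τ) (δ τ))
      (slice₀ (sinHalf (α τ)) (cosHalf (α τ)) (s τ) (t τ)) := by
  rw [sym_eq, ← slicePoint_eq]; rfl

lemma hasDerivAt_quat {f₀ f₁ f₂ f₃ : ℝ → ℝ} {d₀ d₁ d₂ d₃ τ : ℝ} (h₀ : HasDerivAt f₀ d₀ τ)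
    (h₁ : HasDerivAt f₁ d₁ τ) (h₂ : HasDerivAt f₂ d₂ τ) (h₃ : HasDerivAt f₃ d₃ τ) :
    HasDerivAt (fun τ => quat (f₀ τ) (f₁ τ) (f₂ τ) (f₃ τ)) (quat d₀ d₁ d₂ d₃) τ := by
  have e : ∀ a b c d : ℝ, quat a b c d =
      a • quat 1 0 0 0 + b • quat 0 1 0 0 + c • quat 0 0 1 0 + d • quat 0 0 0 1 := by
    intro a b c d
    ext <;> simp
  simp only [e (f₀ _), e d₀]
  exact (((h₀.smul_const _).add (h₁.smul_const _)).add (h₂.smul_const _)).add (h₃.smul_const _)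

/-- The infinitesimal action is equivariant for the adjoint action of `SU(2)`. -/
lemma infAct_actMap (g : SU2) (w : ℍ[ℝ]) (x : Amb) :
    infAct (g * w * star (g : ℍ[ℝ])) (actMap g x) = actMap g (infAct w x) := by
  have hg : star (g : ℍ[ℝ]) * g = 1 := Unitary.coe_star_mul_self g
  have e : ∀ x y : ℍ[ℝ], (g : ℍ[ℝ]) * x * star (g : ℍ[ℝ]) * ((g : ℍ[ℝ]) * y) = g * (x * y) := by
    intro x y
    rw [mul_assoc ((g : ℍ[ℝ]) * x), ← mul_assoc (star (g : ℍ[ℝ])), hg, one_mul, mul_assoc]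
  simp only [actMap, conjMap, leftMap, infAct, LinearMap.prodMap_apply, LinearMap.coe_mk,
    AddHom.coe_mk, e, mul_sub, sub_mul]
  rw [← mul_assoc _ (_ * x.1.2), e, ← mul_assoc _ (_ * w), e]

/-- The rotations in `β` and `δ` commute with the action of `SU(2)`. -/
lemma infAct_sliceMap (β δ : ℝ) (w : ℍ[ℝ]) (x : Amb) (hw : w.re = 0) :
    infAct w (sliceMap β δ x) = sliceMap β δ (infAct w x) := by
  ext <;> simp [-mul_eq_zero, infAct, sliceMap, rotMap, rotSpinMap, rightMap, hw] <;> ring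

lemma hasDerivAt_cos_div_two {f : ℝ → ℝ} {f' τ : ℝ} (h : HasDerivAt f f' τ) :
    HasDerivAt (fun τ => Real.cos (f τ / 2)) (-(f' / 2) * Real.sin (f τ / 2)) τ := by
  convert (h.div_const 2).cos using 1; ring

lemma hasDerivAt_sin_div_two {f : ℝ → ℝ} {f' τ : ℝ} (h : HasDerivAt f f' τ) :
    HasDerivAt (fun τ => Real.sin (f τ / 2)) (f' / 2 * Real.cos (f τ / 2)) τ := by
  convert (h.div_const 2).sin using 1; ring

lemma hasDerivAt_sinHalf {f : ℝ → ℝ} {f' τ : ℝ} (h : HasDerivAt f f' τ) :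
    HasDerivAt (fun τ => sinHalf (f τ)) (-(f' / 2) * cosHalf (f τ)) τ := by
  exact ((h.div_const 2).const_sub (Real.pi / 4)).sin.congr_deriv (by simp only [cosHalf]; ring)

lemma hasDerivAt_cosHalf {f : ℝ → ℝ} {f' τ : ℝ} (h : HasDerivAt f f' τ) :
    HasDerivAt (fun τ => cosHalf (f τ)) (f' / 2 * sinHalf (f τ)) τ := by
  exact ((h.div_const 2).const_sub (Real.pi / 4)).cos.congr_deriv (by simp only [sinHalf]; ring)

/-- The chain rule in the adapted coordinates. -/
lemma hasDerivAt_slicePoint {α β s t δ : ℝ → ℝ} {a b s' t' d τ : ℝ} (hα : HasDerivAt α a τ)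
    (hβ : HasDerivAt β b τ) (hs : HasDerivAt s s' τ) (ht : HasDerivAt t t' τ)
    (hδ : HasDerivAt δ d τ) :
    HasDerivAt (fun τ => slicePoint (α τ) (β τ) (s τ) (t τ) (δ τ))
      (sliceMap (β τ) (δ τ)
        (velocity₀ (sinHalf (α τ)) (cosHalf (α τ)) (s τ) (t τ) a b s' t' d)) τ := by
  have e : (fun τ => slicePoint (α τ) (β τ) (s τ) (t τ) (δ τ)) = fun τ =>
      ((Real.sin (α τ) * Real.cos (β τ),
        quat (Real.sin (α τ) * Real.sin (β τ)) (Real.cos (α τ)) 0 0),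
      (quat
        (Real.cos (β τ / 2) * sinHalf (α τ) * (s τ * Real.cos (δ τ / 2))
          - Real.sin (β τ / 2) * cosHalf (α τ) * (s τ * Real.sin (δ τ / 2)))
        (-(Real.cos (β τ / 2) * sinHalf (α τ) * (s τ * Real.sin (δ τ / 2)))
          - Real.sin (β τ / 2) * cosHalf (α τ) * (s τ * Real.cos (δ τ / 2)))
        (-(Real.cos (β τ / 2) * sinHalf (α τ) * (t τ * Real.sin (δ τ / 2)))
          + Real.sin (β τ / 2) * cosHalf (α τ) * (t τ * Real.cos (δ τ / 2)))
        (Real.cos (β τ / 2) * sinHalf (α τ) * (t τ * Real.cos (δ τ / 2))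
          + Real.sin (β τ / 2) * cosHalf (α τ) * (t τ * Real.sin (δ τ / 2))),
      quat
        (Real.sin (β τ / 2) * sinHalf (α τ) * (s τ * Real.cos (δ τ / 2))
          + Real.cos (β τ / 2) * cosHalf (α τ) * (s τ * Real.sin (δ τ / 2)))
        (-(Real.sin (β τ / 2) * sinHalf (α τ) * (s τ * Real.sin (δ τ / 2)))
          + Real.cos (β τ / 2) * cosHalf (α τ) * (s τ * Real.cos (δ τ / 2)))
        (-(Real.sin (β τ / 2) * sinHalf (α τ) * (t τ * Real.sin (δ τ / 2)))
          - Real.cos (β τ / 2) * cosHalf (α τ) * (t τ * Real.cos (δ τ / 2)))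
        (Real.sin (β τ / 2) * sinHalf (α τ) * (t τ * Real.cos (δ τ / 2))
          - Real.cos (β τ / 2) * cosHalf (α τ) * (t τ * Real.sin (δ τ / 2))))) := by
    funext τ
    rw [slicePoint_eq]
    ext <;> simp [sliceMap, rotMap, rotSpinMap, rightMap, slice₀, sin_eq_half (α τ),
      cos_eq_half (α τ)] <;> ring
  have cb := hasDerivAt_cos_div_two hβ
  have sb := hasDerivAt_sin_div_two hβ
  have cd := hasDerivAt_cos_div_two hδ
  have sd := hasDerivAt_sin_div_two hδ
  have A := hasDerivAt_sinHalf hα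
  have B := hasDerivAt_cosHalf hα
  have z : HasDerivAt (fun _ : ℝ => (0 : ℝ)) 0 τ := hasDerivAt_const τ 0
  have cA := cb.fun_mul A
  have sB := sb.fun_mul B
  have sA := sb.fun_mul A
  have cB := cb.fun_mul B
  have sc := hs.fun_mul cd
  have ss := hs.fun_mul sd
  have tc := ht.fun_mul cd
  have ts := ht.fun_mul sd
  rw [e]
  convert ((hα.sin.fun_mul hβ.cos).prodMk
      (hasDerivAt_quat (hα.sin.fun_mul hβ.sin) hα.cos z z)).prodMk
    ((hasDerivAt_quat
      ((cA.fun_mul sc).fun_sub (sB.fun_mul ss))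
      ((cA.fun_mul ss).fun_neg.fun_sub (sB.fun_mul sc))
      ((cA.fun_mul ts).fun_neg.fun_add (sB.fun_mul tc))
      ((cA.fun_mul tc).fun_add (sB.fun_mul ts))).prodMk
    (hasDerivAt_quat
      ((sA.fun_mul sc).fun_add (cB.fun_mul ss))
      ((sA.fun_mul ss).fun_neg.fun_add (cB.fun_mul sc))
      ((sA.fun_mul ts).fun_neg.fun_sub (cB.fun_mul tc))
      ((sA.fun_mul tc).fun_sub (cB.fun_mul ts)))) using 1
  ext <;> simp [sliceMap, rotMap, rotSpinMap, rightMap, velocity₀, sin_eq_half (α τ),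
      cos_eq_half (α τ)] <;> ring

lemma infAct_add (v w : ℍ[ℝ]) (x : Amb) : infAct (v + w) x = infAct v x + infAct w x := by
  ext <;> simp [infAct] <;> ring

lemma infAct_smul (r : ℝ) (w : ℍ[ℝ]) (x : Amb) : infAct (r • w) x = r • infAct w x := by
  ext <;> simp [infAct] <;> ring

lemma infAct_of_re_eq_zero {w : ℍ[ℝ]} (hw : w.re = 0) (x : Amb) :
    infAct w x = w.imI • infAct (quat 0 1 0 0) x + w.imJ • infAct (quat 0 0 1 0) x
      + w.imK • infAct (quat 0 0 0 1) x := by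
  rw [← infAct_smul, ← infAct_smul, ← infAct_smul, ← infAct_add, ← infAct_add]
  congr 1
  ext <;> simp [hw]

lemma re_conj (g : SU2) (w : ℍ[ℝ]) : ((g : ℍ[ℝ]) * w * star (g : ℍ[ℝ])).re = w.re := by
  have hg : star (g : ℍ[ℝ]) * g = 1 := Unitary.coe_star_mul_self g
  have : ∀ x y : ℍ[ℝ], (x * y).re = (y * x).re := by intro x y; simp; ring
  rw [this, ← mul_assoc, hg, one_mul]

lemma coe_star_SU2 (g : SU2) : ((star g : SU2) : ℍ[ℝ]) = star (g : ℍ[ℝ]) := rfl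

/-- The tangent space at a point of an orbit is the image of the tangent space at the point of the
slice: the adjoint action of `g` only changes the basis of the Lie algebra. -/
lemma span_orbit_eq (g : SU2) (β δ : ℝ) (x v : Amb) :
    Submodule.span ℝ {infAct ⟨0, 1, 0, 0⟩ (actMap g (sliceMap β δ x)),
      infAct ⟨0, 0, 1, 0⟩ (actMap g (sliceMap β δ x)),
      infAct ⟨0, 0, 0, 1⟩ (actMap g (sliceMap β δ x)), actMap g (sliceMap β δ v)} =
    Submodule.span ℝ (Set.range fun i => actMap g (sliceMap β δ
      ((![infAct (quat 0 1 0 0) x, infAct (quat 0 0 1 0) x, infAct (quat 0 0 0 1) x, v] :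
        Fin 4 → Amb) i))) := by
  set y := sliceMap β δ x with hy
  have hg : star (g : ℍ[ℝ]) * g = 1 := Unitary.coe_star_mul_self g
  have hg' : (g : ℍ[ℝ]) * star (g : ℍ[ℝ]) = 1 := Unitary.coe_mul_star_self g
  have e : ∀ w : ℍ[ℝ], w.re = 0 → actMap g (sliceMap β δ (infAct w x)) =
      infAct (g * w * star (g : ℍ[ℝ])) (actMap g y) := fun w hw => by
    rw [infAct_actMap, hy, infAct_sliceMap β δ w x hw]
  apply le_antisymm
  · have hmem : ∀ i, actMap g (sliceMap β δ
      ((![infAct (quat 0 1 0 0) x, infAct (quat 0 0 1 0) x, infAct (quat 0 0 0 1) x, v] :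
        Fin 4 → Amb) i)) ∈ Submodule.span ℝ (Set.range fun i => actMap g (sliceMap β δ
      ((![infAct (quat 0 1 0 0) x, infAct (quat 0 0 1 0) x, infAct (quat 0 0 0 1) x, v] :
        Fin 4 → Amb) i))) := fun i => Submodule.subset_span (Set.mem_range_self i)
    have key : ∀ w : ℍ[ℝ], w.re = 0 → infAct w (actMap g y) ∈
        Submodule.span ℝ (Set.range fun i => actMap g (sliceMap β δ
      ((![infAct (quat 0 1 0 0) x, infAct (quat 0 0 1 0) x, infAct (quat 0 0 0 1) x, v] :
        Fin 4 → Amb) i))) := by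
      intro w hw
      have hw' : (star (g : ℍ[ℝ]) * w * g).re = 0 := by
        have := re_conj (star g) w
        rw [coe_star_SU2, star_star] at this
        rw [this, hw]
      have e1 : w = g * (star (g : ℍ[ℝ]) * w * g) * star (g : ℍ[ℝ]) := by
        rw [mul_assoc (star (g : ℍ[ℝ])), ← mul_assoc (g : ℍ[ℝ]), hg', one_mul, mul_assoc, hg',
          mul_one]
      rw [e1, ← e _ hw', infAct_of_re_eq_zero hw']
      simp only [map_add, map_smul]
      exact add_mem (add_mem (Submodule.smul_mem _ _ (hmem 0)) (Submodule.smul_mem _ _ (hmem 1)))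
        (Submodule.smul_mem _ _ (hmem 2))
    rw [Submodule.span_le]
    rintro _ (rfl | rfl | rfl | rfl)
    · exact key (quat 0 1 0 0) rfl
    · exact key (quat 0 0 1 0) rfl
    · exact key (quat 0 0 0 1) rfl
    · exact hmem 3
  · rw [Submodule.span_le]
    have key : ∀ w : ℍ[ℝ], w.re = 0 → actMap g (sliceMap β δ (infAct w x)) ∈
        Submodule.span ℝ {infAct (quat 0 1 0 0) (actMap g y), infAct (quat 0 0 1 0) (actMap g y),
          infAct (quat 0 0 0 1) (actMap g y), actMap g (sliceMap β δ v)} := by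
      intro w hw
      rw [e w hw, infAct_of_re_eq_zero ((re_conj g w).trans hw)]
      exact add_mem (add_mem (Submodule.smul_mem _ _ (Submodule.subset_span (by simp)))
        (Submodule.smul_mem _ _ (Submodule.subset_span (by simp))))
        (Submodule.smul_mem _ _ (Submodule.subset_span (by simp)))
    rintro _ ⟨i, rfl⟩
    fin_cases i
    · exact key (quat 0 1 0 0) rfl
    · exact key (quat 0 0 1 0) rfl
    · exact key (quat 0 0 0 1) rfl
    · exact Submodule.subset_span (by simp)

lemma hasDerivAt_orbitFamily {α β s t δ : ℝ → ℝ} {a b s' t' d τ : ℝ} (hα : HasDerivAt α a τ)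
    (hβ : HasDerivAt β b τ) (hs : HasDerivAt s s' τ) (ht : HasDerivAt t t' τ)
    (hδ : HasDerivAt δ d τ) (g : SU2) :
    HasDerivAt (orbitFamily α β s t δ g) (actMap g (sliceMap (β τ) (δ τ)
        (velocity₀ (sinHalf (α τ)) (cosHalf (α τ)) (s τ) (t τ) a b s' t' d))) τ :=
  (actMap (g : ℍ[ℝ])).toContinuousLinearMap.hasFDerivAt.comp_hasDerivAt τ
    (hasDerivAt_slicePoint hα hβ hs ht hδ)

/-- The system of ODEs expressing the Cayley condition. -/
theorem isCayleyPlane_orbitFamilyTangent_iff {c : ℝ} (hc : 0 ≤ c) {α β s t δ : ℝ → ℝ}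
    {a b s' t' d τ : ℝ} (hα : HasDerivAt α a τ) (hβ : HasDerivAt β b τ) (hs : HasDerivAt s s' τ)
    (ht : HasDerivAt t t' τ) (hδ : HasDerivAt δ d τ) (hα₀ : α τ ∈ Set.Ioo 0 (Real.pi / 2))
    (hs₀ : 0 < s τ) (ht₀ : 0 < t τ) (hne : ¬(a = 0 ∧ b = 0 ∧ s' = 0 ∧ t' = 0 ∧ d = 0))
    (g : SU2) :
    IsCayleyPlane c (orbitFamily α β s t δ g τ) (orbitFamilyTangent α β s t δ g τ) ↔
      b = 0 ∧ d = 0 ∧ t τ * s' - s τ * t' = 0 ∧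
        (5 * Real.cos (α τ) ^ 2 * (c + s τ ^ 2 + t τ ^ 2)
          - Real.sin (α τ) ^ 2 * (s τ ^ 2 + t τ ^ 2)) * a
          + 4 * Real.sin (α τ) * Real.cos (α τ) * (s τ * s' + t τ * t') = 0 := by
  have h := isCayleyPlane_orbitBasis₀_iff (isTensorSymmetry_sym g (β τ) (δ τ))
    (half_sq_add_sq (α τ)) hc (sinHalf_pos hα₀) (sinHalf_lt_cosHalf hα₀) hs₀ ht₀ hne
  simp only [sym_eq, orbitBasis₀] at h
  rw [orbitFamilyTangent, (hasDerivAt_orbitFamily hα hβ hs ht hδ g).deriv, orbitFamily_eq, sym_eq,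
    span_orbit_eq, h, sin_eq_half, cos_eq_half]

/-! ### The first integrals -/

lemma rpow_five_halves {x : ℝ} (hx : 0 < x) : x ^ (5 / 2 : ℝ) = Real.sqrt x ^ 5 := by
  rw [Real.sqrt_eq_rpow, ← Real.rpow_natCast, ← Real.rpow_mul hx.le]; norm_num

lemma rpow_three_halves {x : ℝ} (hx : 0 < x) : x ^ (3 / 2 : ℝ) = Real.sqrt x ^ 3 := by
  rw [Real.sqrt_eq_rpow, ← Real.rpow_natCast, ← Real.rpow_mul hx.le]; norm_num

/-- The derivative of `F` along a curve, up to a positive factor, is the last expression of the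
system of ODEs, modulo the derivative of `s / t`. -/
lemma hasDerivAt_integralF {c : ℝ} {H : ℝ → ℝ}
    (hH : ∀ a ∈ Set.Ioo 0 (Real.pi / 2), HasDerivAt H ((Real.cos a * Real.sin a) ^ (3 / 2 : ℝ)) a)
    {α₀ s₀ t₀ : ℝ} (hα₀ : α₀ ∈ Set.Ioo 0 (Real.pi / 2)) (hs₀ : 0 < s₀) (ht₀ : 0 < t₀) :
    ∃ u v w : ℝ, 0 < u ∧ 0 < v ∧ ∀ {α s t : ℝ → ℝ} {a s' t' τ : ℝ}, HasDerivAt α a τ →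
      HasDerivAt s s' τ → HasDerivAt t t' τ → α τ = α₀ → s τ = s₀ → t τ = t₀ →
      ∃ F', HasDerivAt (fun τ => integralF c H (α τ) (s τ) (t τ)) F' τ ∧
        u * F' = v * ((5 * Real.cos α₀ ^ 2 * (c + s₀ ^ 2 + t₀ ^ 2)
          - Real.sin α₀ ^ 2 * (s₀ ^ 2 + t₀ ^ 2)) * a
          + 4 * Real.sin α₀ * Real.cos α₀ * (s₀ * s' + t₀ * t')) + w * (t₀ * s' - s₀ * t') := by
  have hS := sin_pos_of_mem hα₀
  have hC := cos_pos_of_mem hα₀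
  obtain ⟨x, hx⟩ : ∃ x, Real.sqrt (Real.sin α₀) = x := ⟨_, rfl⟩
  obtain ⟨y, hy⟩ : ∃ y, Real.sqrt (Real.cos α₀) = y := ⟨_, rfl⟩
  have hx0 : 0 < x := hx ▸ Real.sqrt_pos.2 hS
  have hy0 : 0 < y := hy ▸ Real.sqrt_pos.2 hC
  have hxS : Real.sin α₀ = x ^ 2 := by rw [← hx, Real.sq_sqrt hS.le]
  have hyC : Real.cos α₀ = y ^ 2 := by rw [← hy, Real.sq_sqrt hC.le]
  have hr : 0 < s₀ ^ 2 + t₀ ^ 2 := by positivity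
  refine ⟨y * (s₀ ^ 2 + t₀ ^ 2), x ^ 3 * s₀ * t₀,
    2 * x ^ 5 * y ^ 2 * (t₀ ^ 2 - s₀ ^ 2)
      + 5 * c * H α₀ * y * (t₀ ^ 2 - s₀ ^ 2) / (s₀ ^ 2 + t₀ ^ 2),
    by positivity, by positivity, ?_⟩
  rintro α s t a s' t' τ hα hs ht rfl rfl rfl
  have h1 : HasDerivAt (fun τ => Real.sin (α τ) ^ (5 / 2 : ℝ)) (5 / 2 * x ^ 3 * y ^ 2 * a) τ := by
    convert hα.sin.rpow_const (p := 5 / 2) (Or.inl hS.ne') using 1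
    rw [show (5 / 2 - 1 : ℝ) = 3 / 2 by norm_num, rpow_three_halves hS, hx, hyC]; ring
  have h2 : HasDerivAt (fun τ => Real.cos (α τ) ^ (1 / 2 : ℝ)) (-(1 / 2) * x ^ 2 / y * a) τ := by
    convert hα.cos.rpow_const (p := 1 / 2) (Or.inl hC.ne') using 1
    rw [show (1 / 2 - 1 : ℝ) = -(1 / 2) by norm_num, Real.rpow_neg hC.le, ← Real.sqrt_eq_rpow, hy,
      hxS]
    ring
  have h3 : HasDerivAt (fun τ => H (α τ)) (x ^ 3 * y ^ 3 * a) τ := by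
    refine ((hH _ hα₀).comp τ hα).congr_deriv ?_
    rw [Real.mul_rpow hC.le hS.le, rpow_three_halves hS, rpow_three_halves hC, hx, hy]; ring
  have h4 := ((h1.const_mul 2).fun_mul h2).fun_mul (hs.fun_mul ht)
  have h5 := (((hs.fun_mul ht).fun_div ((hs.fun_pow 2).fun_add (ht.fun_pow 2)) hr.ne').const_mul
    (5 * c)).fun_mul h3
  refine ⟨_, h4.fun_add h5, ?_⟩
  rw [rpow_five_halves hS, ← Real.sqrt_eq_rpow, hx, hy, hxS, hyC]
  field_simp
  ring

lemma eq_zero_of_hasDerivAt_of_const {f : ℝ → ℝ} {f' k τ : ℝ} {U : Set ℝ} (hU : IsOpen U)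
    (hf : ∀ τ ∈ U, f τ = k) (hτ : τ ∈ U) (h : HasDerivAt f f' τ) : f' = 0 :=
  h.unique ((hasDerivAt_const τ k).congr_of_eventuallyEq
    (Filter.eventuallyEq_of_mem (hU.mem_nhds hτ) hf))

lemma eq_of_hasDerivAt_zero {f : ℝ → ℝ} {ε τ : ℝ} (hε : 0 < ε)
    (hf : ∀ τ ∈ Set.Ioo (-ε) ε, HasDerivAt f 0 τ) (hτ : τ ∈ Set.Ioo (-ε) ε) : f τ = f 0 :=
  isOpen_Ioo.is_const_of_deriv_eq_zero isPreconnected_Ioo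
    (fun x hx => (hf x hx).differentiableAt.differentiableWithinAt)
    (fun x hx => (hf x hx).deriv) hτ ⟨by linarith, hε⟩

/-- The submanifold swept out by a curve of orbits is Cayley iff the four quantities are constant
along the curve. -/
theorem cayley_iff_first_integrals_const {c : ℝ} (hc : 0 ≤ c) {H : ℝ → ℝ}
    (hH : ∀ a ∈ Set.Ioo 0 (Real.pi / 2), HasDerivAt H ((Real.cos a * Real.sin a) ^ (3 / 2 : ℝ)) a)
    {ε : ℝ} (hε : 0 < ε) {α β s t δ : ℝ → ℝ}
    (hα : ContDiffOn ℝ 1 α (Set.Ioo (-ε) ε)) (hβ : ContDiffOn ℝ 1 β (Set.Ioo (-ε) ε))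
    (hs : ContDiffOn ℝ 1 s (Set.Ioo (-ε) ε)) (ht : ContDiffOn ℝ 1 t (Set.Ioo (-ε) ε))
    (hδ : ContDiffOn ℝ 1 δ (Set.Ioo (-ε) ε))
    (hpos : ∀ τ ∈ Set.Ioo (-ε) ε, α τ ∈ Set.Ioo 0 (Real.pi / 2) ∧ 0 < s τ ∧ 0 < t τ)
    (hreg : ∀ τ ∈ Set.Ioo (-ε) ε, ¬ (deriv α τ = 0 ∧ deriv β τ = 0 ∧ deriv s τ = 0 ∧
        deriv t τ = 0 ∧ deriv δ τ = 0)) :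
    (∀ (g : SU2), ∀ τ ∈ Set.Ioo (-ε) ε,
        IsCayleyPlane c (orbitFamily α β s t δ g τ) (orbitFamilyTangent α β s t δ g τ)) ↔
      ∃ β₀ δ₀ v₀ F₀ : ℝ, ∀ τ ∈ Set.Ioo (-ε) ε,
        β τ = β₀ ∧ δ τ = δ₀ ∧ s τ / t τ = v₀ ∧ integralF c H (α τ) (s τ) (t τ) = F₀ := by
  have hd : ∀ {f : ℝ → ℝ}, ContDiffOn ℝ 1 f (Set.Ioo (-ε) ε) → ∀ τ ∈ Set.Ioo (-ε) ε,
      HasDerivAt f (deriv f τ) τ := fun hf τ hτ =>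
    ((hf.differentiableOn one_ne_zero).differentiableAt (isOpen_Ioo.mem_nhds hτ)).hasDerivAt
  have hode := fun g τ hτ => isCayleyPlane_orbitFamilyTangent_iff hc (hd hα τ hτ) (hd hβ τ hτ)
    (hd hs τ hτ) (hd ht τ hτ) (hd hδ τ hτ) (hpos τ hτ).1 (hpos τ hτ).2.1 (hpos τ hτ).2.2
    (hreg τ hτ) g
  have hv : ∀ τ ∈ Set.Ioo (-ε) ε, HasDerivAt (fun τ => s τ / t τ)
      ((t τ * deriv s τ - s τ * deriv t τ) / t τ ^ 2) τ := fun τ hτ =>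
    ((hd hs τ hτ).fun_div (hd ht τ hτ) (hpos τ hτ).2.2.ne').congr_deriv (by ring)
  constructor
  · intro h
    have h' := fun τ hτ => (hode 1 τ hτ).1 (h 1 τ hτ)
    refine ⟨β 0, δ 0, s 0 / t 0, integralF c H (α 0) (s 0) (t 0), fun τ hτ => ⟨?_, ?_, ?_, ?_⟩⟩
    · exact eq_of_hasDerivAt_zero hε (fun τ hτ => (h' τ hτ).1 ▸ hd hβ τ hτ) hτ
    · exact eq_of_hasDerivAt_zero hε (fun τ hτ => (h' τ hτ).2.1 ▸ hd hδ τ hτ) hτ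
    · refine eq_of_hasDerivAt_zero (f := fun τ => s τ / t τ) hε (fun τ hτ => ?_) hτ
      have := hv τ hτ
      rwa [(h' τ hτ).2.2.1, zero_div] at this
    · refine eq_of_hasDerivAt_zero (f := fun τ => integralF c H (α τ) (s τ) (t τ)) hε
        (fun τ hτ => ?_) hτ
      obtain ⟨u, v, w, hu, -, hF⟩ := hasDerivAt_integralF (c := c) hH (hpos τ hτ).1
        (hpos τ hτ).2.1 (hpos τ hτ).2.2
      obtain ⟨F', hF', huF⟩ := hF (hd hα τ hτ) (hd hs τ hτ) (hd ht τ hτ) rfl rfl rfl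
      rw [(h' τ hτ).2.2.1, (h' τ hτ).2.2.2, mul_zero, mul_zero, add_zero] at huF
      rwa [(mul_eq_zero.1 huF).resolve_left hu.ne'] at hF'
  · rintro ⟨β₀, δ₀, v₀, F₀, h⟩ g τ hτ
    have hb := eq_zero_of_hasDerivAt_of_const isOpen_Ioo (fun τ hτ => (h τ hτ).1) hτ (hd hβ τ hτ)
    have hδ' := eq_zero_of_hasDerivAt_of_const isOpen_Ioo (fun τ hτ => (h τ hτ).2.1) hτ
      (hd hδ τ hτ)
    have hK := eq_zero_of_hasDerivAt_of_const isOpen_Ioo (fun τ hτ => (h τ hτ).2.2.1) hτ (hv τ hτ)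
    have ht₀ := (hpos τ hτ).2.2
    rw [div_eq_zero_iff, or_iff_left (by positivity)] at hK
    obtain ⟨u, v, w, -, hv, hF⟩ := hasDerivAt_integralF (c := c) hH (hpos τ hτ).1
      (hpos τ hτ).2.1 (hpos τ hτ).2.2
    obtain ⟨F', hF', huF⟩ := hF (hd hα τ hτ) (hd hs τ hτ) (hd ht τ hτ) rfl rfl rfl
    rw [eq_zero_of_hasDerivAt_of_const isOpen_Ioo (fun τ hτ => (h τ hτ).2.2.2) hτ hF', hK,
      mul_zero, mul_zero, add_zero] at huF
    exact (hode g τ hτ).2 ⟨hb, hδ', hK, (mul_eq_zero.1 huF.symm).resolve_left hv.ne'⟩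

lemma contDiffOn_primitive {H : ℝ → ℝ}
    (hH : ∀ a ∈ Set.Ioo 0 (Real.pi / 2),
      HasDerivAt H ((Real.cos a * Real.sin a) ^ (3 / 2 : ℝ)) a) :
    ContDiffOn ℝ ∞ H (Set.Ioo 0 (Real.pi / 2)) := by
  rw [contDiffOn_infty_iff_deriv_of_isOpen isOpen_Ioo]
  refine ⟨fun a ha => (hH a ha).differentiableAt.differentiableWithinAt, ?_⟩
  refine ContDiffOn.congr (f := fun a => (Real.cos a * Real.sin a) ^ (3 / 2 : ℝ)) ?_
    fun a ha => (hH a ha).deriv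
  exact (Real.contDiff_cos.mul Real.contDiff_sin).contDiffOn.rpow_const_of_ne fun a ha =>
    (mul_pos (cos_pos_of_mem ha) (sin_pos_of_mem ha)).ne'

lemma isOpen_orbitDomain : IsOpen orbitDomain := by
  have hs : Continuous (fun z : ℝ × ℝ × ℝ × ℝ × ℝ => z.2.2.1) := by fun_prop
  have ht : Continuous (fun z : ℝ × ℝ × ℝ × ℝ × ℝ => z.2.2.2.1) := by fun_prop
  exact (isOpen_Ioo.preimage continuous_fst).inter
    ((isOpen_Ioi.preimage hs).inter (isOpen_Ioi.preimage ht))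

lemma contDiffOn_firstIntegrals {c : ℝ} {H : ℝ → ℝ}
    (hH : ContDiffOn ℝ ∞ H (Set.Ioo 0 (Real.pi / 2))) :
    ContDiffOn ℝ ∞ (firstIntegrals c H) orbitDomain := by
  have hα : ContDiff ℝ ∞ (fun z : ℝ × ℝ × ℝ × ℝ × ℝ => z.1) := contDiff_fst
  have hβ : ContDiff ℝ ∞ (fun z : ℝ × ℝ × ℝ × ℝ × ℝ => z.2.1) := by fun_prop
  have hs : ContDiff ℝ ∞ (fun z : ℝ × ℝ × ℝ × ℝ × ℝ => z.2.2.1) := by fun_prop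
  have ht : ContDiff ℝ ∞ (fun z : ℝ × ℝ × ℝ × ℝ × ℝ => z.2.2.2.1) := by fun_prop
  have hδ : ContDiff ℝ ∞ (fun z : ℝ × ℝ × ℝ × ℝ × ℝ => z.2.2.2.2) := by fun_prop
  refine hβ.contDiffOn.prodMk (hδ.contDiffOn.prodMk
    ((hs.contDiffOn.div ht.contDiffOn fun z hz => hz.2.2.ne').prodMk ?_))
  refine ContDiffOn.add (((contDiffOn_const.mul ?_).mul ?_).mul (hs.mul ht).contDiffOn)
    ((contDiffOn_const.mul ((hs.mul ht).contDiffOn.div ((hs.pow 2).add (ht.pow 2)).contDiffOn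
      fun z hz => ?_)).mul ?_)
  · exact hα.sin.contDiffOn.rpow_const_of_ne fun z hz => (sin_pos_of_mem hz.1).ne'
  · exact hα.cos.contDiffOn.rpow_const_of_ne fun z hz => (cos_pos_of_mem hz.1).ne'
  · have := hz.2.1
    have : 0 < z.2.2.1 ^ 2 + z.2.2.2.1 ^ 2 := by positivity
    exact this.ne'
  · exact hH.comp hα.contDiffOn fun z hz => hz.1

/-- The four differentials are independent, already on the subspace on which `α` is fixed: there the
derivative of `F` prescribes `s s' + t t'` and that of `s / t` prescribes `t s' - s t'`. -/
lemma surjective_fderiv_firstIntegrals {c : ℝ} {H : ℝ → ℝ}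
    (hH : ∀ a ∈ Set.Ioo 0 (Real.pi / 2), HasDerivAt H ((Real.cos a * Real.sin a) ^ (3 / 2 : ℝ)) a)
    {z : ℝ × ℝ × ℝ × ℝ × ℝ} (hz : z ∈ orbitDomain) :
    Function.Surjective (fderiv ℝ (firstIntegrals c H) z) := by
  rintro ⟨b, d, k, f⟩
  obtain ⟨α₀, β₀, s₀, t₀, δ₀⟩ := z
  obtain ⟨hα₀, hs₀, ht₀⟩ : α₀ ∈ Set.Ioo 0 (Real.pi / 2) ∧ 0 < s₀ ∧ 0 < t₀ := id hz
  obtain ⟨u, v, w, hu, hv, hF⟩ := hasDerivAt_integralF (c := c) hH hα₀ hs₀ ht₀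
  have hS := sin_pos_of_mem hα₀
  have hC := cos_pos_of_mem hα₀
  have hr : 0 < s₀ ^ 2 + t₀ ^ 2 := by positivity
  -- the variation of `(s, t)` with prescribed radial part `R` and prescribed angular part
  obtain ⟨R, hR⟩ : ∃ R, R = (u * f - w * (k * t₀ ^ 2)) /
    (4 * Real.sin α₀ * Real.cos α₀ * v) := ⟨_, rfl⟩
  obtain ⟨s', hs'⟩ : ∃ s', s' = (s₀ * R + t₀ * (k * t₀ ^ 2)) / (s₀ ^ 2 + t₀ ^ 2) := ⟨_, rfl⟩
  obtain ⟨t', ht'⟩ : ∃ t', t' = (t₀ * R - s₀ * (k * t₀ ^ 2)) / (s₀ ^ 2 + t₀ ^ 2) := ⟨_, rfl⟩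
  have hrad : s₀ * s' + t₀ * t' = R := by rw [hs', ht']; field_simp; ring
  have hang : t₀ * s' - s₀ * t' = k * t₀ ^ 2 := by rw [hs', ht']; field_simp; ring
  have hβ : HasDerivAt (fun τ : ℝ => β₀ + τ * b) b 0 := by
    simpa using ((hasDerivAt_id (0 : ℝ)).mul_const b).const_add β₀
  have hδ : HasDerivAt (fun τ : ℝ => δ₀ + τ * d) d 0 := by
    simpa using ((hasDerivAt_id (0 : ℝ)).mul_const d).const_add δ₀
  have hs : HasDerivAt (fun τ : ℝ => s₀ + τ * s') s' 0 := by
    simpa using ((hasDerivAt_id (0 : ℝ)).mul_const s').const_add s₀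
  have ht : HasDerivAt (fun τ : ℝ => t₀ + τ * t') t' 0 := by
    simpa using ((hasDerivAt_id (0 : ℝ)).mul_const t').const_add t₀
  have hα : HasDerivAt (fun _ : ℝ => α₀) 0 0 := hasDerivAt_const 0 α₀
  obtain ⟨F', hF', huF⟩ := hF hα hs ht rfl (by simp) (by simp)
  have hFf : F' = f := by
    rw [hrad, hang, hR] at huF
    have : u * F' = u * f := by rw [huF]; field_simp; ring
    exact mul_left_cancel₀ hu.ne' this
  refine ⟨(0, b, s', t', d), ?_⟩
  have hdiff : DifferentiableAt ℝ (firstIntegrals c H) (α₀, β₀, s₀, t₀, δ₀) :=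
    ((contDiffOn_firstIntegrals (contDiffOn_primitive hH)).differentiableOn
      (by simp)).differentiableAt (isOpen_orbitDomain.mem_nhds hz)
  have hline : HasDerivAt (fun τ : ℝ => (α₀, β₀ + τ * b, s₀ + τ * s', t₀ + τ * t', δ₀ + τ * d))
      (0, b, s', t', d) 0 := hα.prodMk (hβ.prodMk (hs.prodMk (ht.prodMk hδ)))
  have hcomp := HasFDerivAt.comp_hasDerivAt_of_eq (0 : ℝ) hdiff.hasFDerivAt hline (by simp)
  have hquot : HasDerivAt (fun τ : ℝ => (s₀ + τ * s') / (t₀ + τ * t')) k 0 := by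
    refine (hs.fun_div ht (by simpa using ht₀.ne')).congr_deriv ?_
    have : s' * t₀ - s₀ * t' = k * t₀ ^ 2 := by rw [← hang]; ring
    simp only [zero_mul, add_zero]
    rw [this]; field_simp
  exact hcomp.unique (hβ.prodMk (hδ.prodMk (hquot.prodMk (hFf ▸ hF'))))

/-! ### Recovering the adapted coordinates from a point of the chart

The following functions are defined on the whole ambient space; outside the chart their values have
no meaning.
-/

/-- The coordinate `α` of a point of the chart: `sin α` is the length of the `ℝ²`-part of the base
point. -/
def alphaOf (x : Amb) : ℝ := Real.arcsin (Real.sqrt (x.1.1 ^ 2 + x.1.2.re ^ 2))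

/-- The coordinate `β`, modulo `2π`, of a point of the chart. -/
def betaOf (x : Amb) : Real.Angle := (Complex.arg ⟨x.1.1, x.1.2.re⟩ : ℝ)

/-- The imaginary quaternion `ψ₁* u ψ₁ + ψ₂* u ψ₂`, where `u` is the `ℝ³`-part of the base point:
the fibrewise Hopf map, an `SU(2)`-invariant which determines the orbit of the spinor. -/
def hopf (x : Amb) : ℍ[ℝ] :=
  star x.2.1 * (x.1.2 - (x.1.2.re : ℍ[ℝ])) * x.2.1
    + star x.2.2 * (x.1.2 - (x.1.2.re : ℍ[ℝ])) * x.2.2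

/-- The coordinate `s` of a point of the chart. -/
def sOf (x : Amb) : ℝ :=
  Real.sqrt ((innerS x.2 x.2 + (hopf x).imI / Real.cos (alphaOf x)) / 2)

/-- The coordinate `t` of a point of the chart. -/
def tOf (x : Amb) : ℝ :=
  Real.sqrt ((innerS x.2 x.2 - (hopf x).imI / Real.cos (alphaOf x)) / 2)

/-- The coordinate `δ`, modulo `2π`, of a point of the chart. -/
def deltaOf (x : Amb) : Real.Angle := (Complex.arg ⟨-(hopf x).imJ, -(hopf x).imK⟩ : ℝ)

/-- A multiple of the group element which takes the slice to a point of the chart. The angles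
`β, δ` and the quotient `v = s / t` are given, and the multiple is then linear in the point. -/
def groupPart (β δ v : ℝ) (x : Amb) : ℍ[ℝ] :=
  (Real.cos (β / 2) • x.2.1 + Real.sin (β / 2) • x.2.2) *
    quat (v * Real.cos (δ / 2)) (v * Real.sin (δ / 2)) (Real.sin (δ / 2)) (-Real.cos (δ / 2))

section
variable (g : SU2) (α β s t δ : ℝ)

lemma act_slicePoint_fst_fst : (act g (slicePoint α β s t δ)).1.1 = Real.sin α * Real.cos β := rfl

lemma act_slicePoint_fst_snd_re :
    (act g (slicePoint α β s t δ)).1.2.re = Real.sin α * Real.sin β :=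
  re_conj g _

lemma innerS_act_slicePoint : innerS (act g (slicePoint α β s t δ)).2
    (act g (slicePoint α β s t δ)).2 = s ^ 2 + t ^ 2 := by
  rw [slicePoint_eq, ← actMap_apply, ← sym_eq]
  exact ((isTensorSymmetry_sym g β δ).innerS _ _).trans (innerS_slice₀ (half_sq_add_sq α) s t)

lemma act_slicePoint_mem : act g (slicePoint α β s t δ) ∈ negSpinorBundle := by
  have hL := isTensorSymmetry_sym g β δ
  have h := half_sq_add_sq α
  rw [slicePoint_eq, ← actMap_apply, ← sym_eq]
  constructor
  · refine (hL.inner5 _ _).trans ?_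
    change inner5 (slice₀ _ _ s t).1 (slice₀ _ _ s t).1 = 1
    simp only [slice₀]
    rw [inner5_quat]
    linear_combination (sinHalf α ^ 2 + cosHalf α ^ 2 + 1) * h
  · refine (hL.cliff _ _).trans ?_
    change symSpin g β δ _ = -symSpin g β δ _
    rw [← map_neg]
    congr 1
    ext <;> simp [slice₀, cliff]
    · linear_combination -(sinHalf α * s) * h
    · linear_combination -(sinHalf α * t) * h
    · linear_combination -(cosHalf α * s) * h
    · linear_combination (cosHalf α * t) * h

lemma hopf_act (x : Amb) : hopf (act g x) = hopf x := by
  have hg : star (g : ℍ[ℝ]) * g = 1 := Unitary.coe_star_mul_self g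
  have hg' : (g : ℍ[ℝ]) * star (g : ℍ[ℝ]) = 1 := Unitary.coe_mul_star_self g
  have hre : (((g : ℍ[ℝ]) * x.1.2 * star (g : ℍ[ℝ])).re : ℍ[ℝ]) =
      g * (x.1.2.re : ℍ[ℝ]) * star (g : ℍ[ℝ]) := by
    rw [re_conj, ← Quaternion.coe_commutes, mul_assoc, hg', mul_one]
  have e : ∀ a b : ℍ[ℝ], star ((g : ℍ[ℝ]) * a) * (g * b * star (g : ℍ[ℝ])) * (g * a) =
      star a * b * a := fun a b => by
    rw [star_mul]
    calc star a * star (g : ℍ[ℝ]) * (g * b * star (g : ℍ[ℝ])) * (g * a)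
        = star a * (star (g : ℍ[ℝ]) * g) * b * (star (g : ℍ[ℝ]) * g) * a := by noncomm_ring
      _ = _ := by rw [hg, mul_one, mul_one]
  simp only [hopf, act, hre]
  rw [← sub_mul, ← mul_sub, e, e]

/-- The Hopf map determines `s² - t²` and `2 s t exp (i δ)`. -/
lemma hopf_act_slicePoint : hopf (act g (slicePoint α β s t δ)) =
    quat 0 (Real.cos α * (s ^ 2 - t ^ 2)) (-(Real.cos α * (2 * s * t) * Real.cos δ))
      (-(Real.cos α * (2 * s * t) * Real.sin δ)) := by
  have hb := Real.cos_sq_add_sin_sq (β / 2)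
  have hd := Real.cos_sq_add_sin_sq (δ / 2)
  have h := half_sq_add_sq α
  have hc : Real.cos δ = Real.cos (δ / 2) ^ 2 - Real.sin (δ / 2) ^ 2 := by
    rw [← Real.cos_two_mul']; ring_nf
  have hs : Real.sin δ = 2 * Real.sin (δ / 2) * Real.cos (δ / 2) := by
    rw [← Real.sin_two_mul]; ring_nf
  rw [hopf_act, slicePoint_eq]
  obtain ⟨k, hk⟩ : ∃ k, (Real.cos (β / 2) ^ 2 + Real.sin (β / 2) ^ 2) *
    (sinHalf α ^ 2 + cosHalf α ^ 2) = k := ⟨_, rfl⟩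
  have hk1 : k = 1 := by rw [← hk, hb, h, one_mul]
  ext
  · simp [-Quaternion.coe_mul, -Quaternion.coe_sub, -Quaternion.coe_pow, hopf, sliceMap, rotMap,
      rotSpinMap, rightMap, slice₀]
    ring
  · trans k * (Real.cos (δ / 2) ^ 2 + Real.sin (δ / 2) ^ 2) *
      (2 * sinHalf α * cosHalf α * (s ^ 2 - t ^ 2))
    · rw [← hk]
      simp [-Quaternion.coe_mul, -Quaternion.coe_sub, -Quaternion.coe_pow,
        -Real.cos_sq_add_sin_sq, hopf, sliceMap, rotMap, rotSpinMap, rightMap, slice₀]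
      ring
    · rw [hk1, hd, cos_eq_half α]; simp
  · trans k * -(Real.cos α * (2 * s * t) * Real.cos δ)
    · rw [← hk, hc, cos_eq_half α]
      simp [-Quaternion.coe_mul, -Quaternion.coe_sub, -Quaternion.coe_pow,
        -Real.cos_sq_add_sin_sq, hopf, sliceMap, rotMap, rotSpinMap, rightMap, slice₀]
      ring
    · rw [hk1, one_mul]; rfl
  · trans k * -(Real.cos α * (2 * s * t) * Real.sin δ)
    · rw [← hk, hs, cos_eq_half α]
      simp [-Quaternion.coe_mul, -Quaternion.coe_sub, -Quaternion.coe_pow,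
        -Real.cos_sq_add_sin_sq, hopf, sliceMap, rotMap, rotSpinMap, rightMap, slice₀]
      ring
    · rw [hk1, one_mul]; rfl

/-- The factor `cos (β/2) ψ₁ + sin (β/2) ψ₂` undoes the rotation by `β` in the first component of
the spinor and gives `sin (π/4 - α/2) g (s + t k) exp (-i δ/2)`. -/
lemma groupPart_act_slicePoint (v : ℝ) : groupPart β δ v (act g (slicePoint α β (v * t) t δ)) =
    (sinHalf α * t * (v ^ 2 + 1)) • (g : ℍ[ℝ]) := by
  have hb := Real.cos_sq_add_sin_sq (β / 2)
  have hd := Real.cos_sq_add_sin_sq (δ / 2)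
  have e : groupPart β δ v (slicePoint α β (v * t) t δ) =
      quat ((Real.cos (β / 2) ^ 2 + Real.sin (β / 2) ^ 2) *
        (Real.cos (δ / 2) ^ 2 + Real.sin (δ / 2) ^ 2) * (sinHalf α * t * (v ^ 2 + 1))) 0 0 0 := by
    rw [slicePoint_eq]
    ext <;> simp [-Real.cos_sq_add_sin_sq, groupPart, sliceMap, rotMap, rotSpinMap, rightMap,
      slice₀] <;> ring
  rw [hb, hd, one_mul, one_mul] at e
  have e' : groupPart β δ v (act g (slicePoint α β (v * t) t δ)) =
      g * groupPart β δ v (slicePoint α β (v * t) t δ) := by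
    simp only [groupPart, act, ← mul_smul_comm, ← mul_add, mul_assoc]
  rw [e', e]
  ext <;> simp <;> ring

variable {α β s t δ}

lemma alphaOf_act_slicePoint (hα : α ∈ Set.Ioo 0 (Real.pi / 2)) :
    alphaOf (act g (slicePoint α β s t δ)) = α := by
  rw [alphaOf, act_slicePoint_fst_fst, act_slicePoint_fst_snd_re, mul_pow, mul_pow, ← mul_add,
    Real.cos_sq_add_sin_sq, mul_one, Real.sqrt_sq (sin_pos_of_mem hα).le,
    Real.arcsin_sin (by linarith [hα.1, Real.pi_pos]) hα.2.le]

lemma coe_arg_angle {r : ℝ} (hr : 0 < r) (θ : ℝ) :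
    ((Complex.arg ⟨r * Real.cos θ, r * Real.sin θ⟩ : ℝ) : Real.Angle) = θ := by
  have := Complex.arg_mul_cos_add_sin_mul_I_coe_angle hr (θ : Real.Angle)
  convert this using 3
  apply Complex.ext
  · simp [-Complex.ofReal_cos]
  · simp [-Complex.ofReal_sin]

lemma betaOf_act_slicePoint (hα : α ∈ Set.Ioo 0 (Real.pi / 2)) :
    betaOf (act g (slicePoint α β s t δ)) = β := by
  rw [betaOf, act_slicePoint_fst_fst, act_slicePoint_fst_snd_re, coe_arg_angle (sin_pos_of_mem hα)]

lemma deltaOf_act_slicePoint (hα : α ∈ Set.Ioo 0 (Real.pi / 2)) (hs : 0 < s) (ht : 0 < t) :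
    deltaOf (act g (slicePoint α β s t δ)) = δ := by
  have := cos_pos_of_mem hα
  rw [deltaOf, hopf_act_slicePoint, imJ_quat, imK_quat, neg_neg, neg_neg,
    coe_arg_angle (by positivity)]

lemma sOf_act_slicePoint (hα : α ∈ Set.Ioo 0 (Real.pi / 2)) (hs : 0 < s) :
    sOf (act g (slicePoint α β s t δ)) = s := by
  rw [sOf, alphaOf_act_slicePoint g hα, innerS_act_slicePoint, hopf_act_slicePoint, imI_quat,
    mul_div_cancel_left₀ _ (cos_pos_of_mem hα).ne', ← Real.sqrt_sq hs.le]
  congr 1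
  rw [Real.sqrt_sq hs.le]; ring

lemma tOf_act_slicePoint (hα : α ∈ Set.Ioo 0 (Real.pi / 2)) (ht : 0 < t) :
    tOf (act g (slicePoint α β s t δ)) = t := by
  rw [tOf, alphaOf_act_slicePoint g hα, innerS_act_slicePoint, hopf_act_slicePoint, imI_quat,
    mul_div_cancel_left₀ _ (cos_pos_of_mem hα).ne', ← Real.sqrt_sq ht.le]
  congr 1
  rw [Real.sqrt_sq ht.le]; ring

end

/-- The half angles of two representatives of an angle agree up to a common sign. -/
lemma exists_sign_of_coe_eq {θ θ' : ℝ} (h : (θ : Real.Angle) = θ') : ∃ ε : ℝ, (ε = 1 ∨ ε = -1) ∧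
    Real.cos (θ / 2) = ε * Real.cos (θ' / 2) ∧ Real.sin (θ / 2) = ε * Real.sin (θ' / 2) := by
  obtain ⟨k, hk⟩ := Real.Angle.angle_eq_iff_two_pi_dvd_sub.1 h
  have e : θ / 2 = θ' / 2 + k * Real.pi := by linarith
  refine ⟨(-1) ^ k, ?_, ?_, ?_⟩
  · rcases Int.even_or_odd k with hk | hk
    · exact Or.inl hk.neg_one_zpow
    · exact Or.inr hk.neg_one_zpow
  · rw [e, Real.cos_add_int_mul_pi]
  · rw [e, Real.sin_add_int_mul_pi]

/-- The orbits depend on `β` and `δ` modulo `2π` only: the change of sign of the spinor is the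
action of `-1 ∈ SU(2)`. -/
lemma exists_act_slicePoint_eq (g : SU2) (α s t : ℝ) {β β' δ δ' : ℝ}
    (hβ : (β : Real.Angle) = β') (hδ : (δ : Real.Angle) = δ') :
    ∃ g' : SU2, act g (slicePoint α β s t δ) = act g' (slicePoint α β' s t δ') := by
  obtain ⟨ε, hε, hc, hs⟩ := exists_sign_of_coe_eq hβ
  obtain ⟨η, hη, hc', hs'⟩ := exists_sign_of_coe_eq hδ
  have hcβ : Real.cos β = Real.cos β' := by
    rw [← Real.Angle.cos_coe, hβ, Real.Angle.cos_coe]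
  have hsβ : Real.sin β = Real.sin β' := by
    rw [← Real.Angle.sin_coe, hβ, Real.Angle.sin_coe]
  have key : slicePoint α β s t δ =
      ((slicePoint α β' s t δ').1, (ε * η) • (slicePoint α β' s t δ').2) := by
    rw [slicePoint_eq, slicePoint_eq]
    ext <;> simp [sliceMap, rotMap, rotSpinMap, rightMap, hcβ, hsβ, hc, hs, hc', hs'] <;> ring
  have hεη : ε * η = 1 ∨ ε * η = -1 := by
    rcases hε with rfl | rfl <;> rcases hη with rfl | rfl <;> simp
  rw [key]
  rcases hεη with h | h
  · exact ⟨g, by rw [h, one_smul]⟩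
  · have hneg : ((-g : SU2) : ℍ[ℝ]) = -g := rfl
    exact ⟨-g, by rw [h]; simp [act, hneg]⟩

/-! ### The level sets -/

/-- The coefficient of `H(α)` in `F`, as a function of `v = s / t`. -/
def levelConst (c v : ℝ) : ℝ := 5 * c * (v / (v ^ 2 + 1))

/-- `F - 5 c v / (v² + 1) H(α)`. Where it is positive, the level set of `(v, F)` has exactly one
point over `α`. -/
def levelGap (c : ℝ) (H : ℝ → ℝ) (v F α : ℝ) : ℝ := F - levelConst c v * H α

/-- The coordinate `t` on the level set of `(v, F)`, as a function of `α`. -/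
def levelT (c : ℝ) (H : ℝ → ℝ) (v F α : ℝ) : ℝ :=
  Real.sqrt (levelGap c H v F α / (2 * v * (Real.sin α ^ (5 / 2 : ℝ) * Real.cos α ^ (1 / 2 : ℝ))))

/-- The fibration `Q = (β, δ, s / t, F)`. -/
def fibrationMap (c : ℝ) (H : ℝ → ℝ) (x : chartU) : Real.Angle × Real.Angle × ℝ × ℝ :=
  (betaOf x, deltaOf x, sOf x / tOf x, integralF c H (alphaOf x) (sOf x) (tOf x))

variable {c : ℝ} {H : ℝ → ℝ}

lemma fibrationMap_eq {x : chartU} {g : SU2} {α β s t δ : ℝ} (hα : α ∈ Set.Ioo 0 (Real.pi / 2))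
    (hs : 0 < s) (ht : 0 < t) (hx : (x : Amb) = act g (slicePoint α β s t δ)) :
    fibrationMap c H x = ((β : Real.Angle), (δ : Real.Angle), s / t, integralF c H α s t) := by
  rw [fibrationMap, hx, betaOf_act_slicePoint g hα, deltaOf_act_slicePoint g hα hs ht,
    sOf_act_slicePoint g hα hs, tOf_act_slicePoint g hα ht, alphaOf_act_slicePoint g hα]

lemma weight_pos {α : ℝ} (hα : α ∈ Set.Ioo 0 (Real.pi / 2)) :
    0 < Real.sin α ^ (5 / 2 : ℝ) * Real.cos α ^ (1 / 2 : ℝ) :=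
  mul_pos (Real.rpow_pos_of_pos (sin_pos_of_mem hα) _)
    (Real.rpow_pos_of_pos (cos_pos_of_mem hα) _)

lemma integralF_mul (α v : ℝ) {t : ℝ} (ht : t ≠ 0) : integralF c H α (v * t) t =
    2 * v * (Real.sin α ^ (5 / 2 : ℝ) * Real.cos α ^ (1 / 2 : ℝ)) * t ^ 2
      + levelConst c v * H α := by
  have h : (v ^ 2 + 1) ≠ 0 := by positivity
  have : v * t * t / ((v * t) ^ 2 + t ^ 2) = v / (v ^ 2 + 1) := by field_simp
  rw [integralF, levelConst, this]; ring

lemma levelT_pos {v F α : ℝ} (hα : α ∈ Set.Ioo 0 (Real.pi / 2)) (hv : 0 < v)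
    (h : 0 < levelGap c H v F α) : 0 < levelT c H v F α :=
  Real.sqrt_pos.2 (div_pos h (mul_pos (by positivity) (weight_pos hα)))

lemma integralF_levelT {v F α : ℝ} (hα : α ∈ Set.Ioo 0 (Real.pi / 2)) (hv : 0 < v)
    (h : 0 < levelGap c H v F α) :
    integralF c H α (v * levelT c H v F α) (levelT c H v F α) = F := by
  have hw : 0 < 2 * v * (Real.sin α ^ (5 / 2 : ℝ) * Real.cos α ^ (1 / 2 : ℝ)) :=
    mul_pos (by positivity) (weight_pos hα)
  rw [integralF_mul α v (levelT_pos hα hv h).ne', levelT, Real.sq_sqrt (div_pos h hw).le,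
    mul_div_cancel₀ _ hw.ne', levelGap]
  ring

lemma levelGap_integralF {α v t : ℝ} (ht : t ≠ 0) :
    levelGap c H v (integralF c H α (v * t) t) α =
      2 * v * (Real.sin α ^ (5 / 2 : ℝ) * Real.cos α ^ (1 / 2 : ℝ)) * t ^ 2 := by
  rw [levelGap, integralF_mul α v ht]; ring

lemma levelT_integralF {α v t : ℝ} (hα : α ∈ Set.Ioo 0 (Real.pi / 2)) (hv : 0 < v) (ht : 0 < t) :
    levelT c H v (integralF c H α (v * t) t) α = t := by
  have hw : 0 < 2 * v * (Real.sin α ^ (5 / 2 : ℝ) * Real.cos α ^ (1 / 2 : ℝ)) :=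
    mul_pos (by positivity) (weight_pos hα)
  rw [levelT, levelGap_integralF ht.ne', mul_div_cancel_left₀ _ hw.ne', Real.sqrt_sq ht.le]

/-- The parametrization of a level set by the group and the coordinate `α`. -/
def levelPoint (c : ℝ) (H : ℝ → ℝ) (β δ v F : ℝ) (g : SU2) (α : ℝ) : Amb :=
  act g (slicePoint α β (v * levelT c H v F α) (levelT c H v F α) δ)

/-- A level set is empty for `v ≤ 0`; otherwise it is the union of one orbit for each admissible
`α`. -/
lemma mem_fibre_iff {β δ v F : ℝ} {x : Amb} :
    x ∈ (Subtype.val '' (fibrationMap c H ⁻¹' {((β : Real.Angle), (δ : Real.Angle), v, F)})) ↔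
      0 < v ∧ ∃ (g : SU2) (α : ℝ), α ∈ Set.Ioo 0 (Real.pi / 2) ∧ 0 < levelGap c H v F α ∧
        x = levelPoint c H β δ v F g α := by
  constructor
  · rintro ⟨⟨x, g₀, α, β', s, t, δ', hα, hs, ht, hx⟩, hQ, rfl⟩
    rw [Set.mem_preimage, fibrationMap_eq hα hs ht hx] at hQ
    simp only [Set.mem_singleton_iff, Prod.mk.injEq] at hQ
    obtain ⟨hβ, hδ, hv, hF⟩ := hQ
    have hv₀ : 0 < v := by rw [← hv]; positivity
    have hst : s = v * t := by rw [← hv]; field_simp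
    obtain ⟨g, hg⟩ := exists_act_slicePoint_eq g₀ α s t hβ hδ
    subst hst hF
    refine ⟨hv₀, g, α, hα, ?_, ?_⟩
    · rw [levelGap_integralF ht.ne']
      exact mul_pos (mul_pos (by positivity) (weight_pos hα)) (by positivity)
    · rw [levelPoint, levelT_integralF hα hv₀ ht, ← hg]; exact hx
  · rintro ⟨hv, g, α, hα, hgap, rfl⟩
    have ht := levelT_pos hα hv hgap
    have hs := mul_pos hv ht
    refine ⟨⟨_, g, α, β, _, _, δ, hα, hs, ht, rfl⟩, ?_, rfl⟩
    rw [Set.mem_preimage, fibrationMap_eq hα hs ht rfl, integralF_levelT hα hv hgap,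
      mul_div_cancel_right₀ _ ht.ne']
    rfl

lemma act_mul (g h : SU2) (x : Amb) : act (g * h) x = act g (act h x) := by
  simp [act, mul_assoc]

lemma act_mem_fibre {b : Real.Angle × Real.Angle × ℝ × ℝ} (g : SU2) {x : Amb}
    (hx : x ∈ Subtype.val '' (fibrationMap c H ⁻¹' {b})) :
    act g x ∈ Subtype.val '' (fibrationMap c H ⁻¹' {b}) := by
  obtain ⟨b, d, v, F⟩ := b
  induction b using Real.Angle.induction_on with | _ β
  induction d using Real.Angle.induction_on with | _ δ
  rw [mem_fibre_iff] at hx ⊢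
  obtain ⟨hv, g', α, hα, hgap, rfl⟩ := hx
  exact ⟨hv, g * g', α, hα, hgap, (act_mul g g' _).symm⟩

/-! ### Local parametrizations of the level sets -/

/-- The unit quaternion with positive real part over a point of `ℝ³` in the central chart of the
three-sphere. -/
def centralUnit (a b c : ℝ) : ℍ[ℝ] := (Real.sqrt (1 + a ^ 2 + b ^ 2 + c ^ 2))⁻¹ • quat 1 a b c

lemma normSq_quat (a b c d : ℝ) :
    Quaternion.normSq (quat a b c d) = a ^ 2 + b ^ 2 + c ^ 2 + d ^ 2 := by
  rw [Quaternion.normSq_def']; rfl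

lemma mem_unitary_of_normSq {q : ℍ[ℝ]} (h : Quaternion.normSq q = 1) : q ∈ unitary ℍ[ℝ] := by
  rw [Unitary.mem_iff]
  constructor
  · rw [Quaternion.star_mul_self, h]; simp
  · rw [Quaternion.self_mul_star, h]; simp

lemma normSq_SU2 (g : SU2) : Quaternion.normSq (g : ℍ[ℝ]) = 1 := by
  rw [Quaternion.normSq_eq_norm_mul_self, CStarRing.norm_coe_unitary, one_mul]

lemma centralUnit_mem (a b c : ℝ) : centralUnit a b c ∈ unitary ℍ[ℝ] := by
  apply mem_unitary_of_normSq
  have h : (0 : ℝ) < 1 + a ^ 2 + b ^ 2 + c ^ 2 := by positivity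
  rw [centralUnit, Quaternion.normSq_smul, normSq_quat, inv_pow, Real.sq_sqrt h.le, one_pow,
    inv_mul_cancel₀ h.ne']

lemma centralUnit_of_re_pos {q : ℍ[ℝ]} (hq : Quaternion.normSq q = 1) (h : 0 < q.re) :
    centralUnit (q.imI / q.re) (q.imJ / q.re) (q.imK / q.re) = q := by
  have e : 1 + (q.imI / q.re) ^ 2 + (q.imJ / q.re) ^ 2 + (q.imK / q.re) ^ 2 = (q.re⁻¹) ^ 2 := by
    rw [Quaternion.normSq_def'] at hq
    field_simp
    exact hq
  rw [centralUnit, e, Real.sqrt_sq (by positivity), inv_inv]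
  ext <;> simp <;> field_simp

/-- Quaternionic conjugation as a continuous real linear map. -/
def starCLM : ℍ[ℝ] →L[ℝ] ℍ[ℝ] :=
  LinearMap.toContinuousLinearMap
    { toFun := star
      map_add' := star_add
      map_smul' := fun r x => by ext <;> simp }

lemma contDiffOn_quat {E : Type*} [NormedAddCommGroup E] [NormedSpace ℝ E] {s : Set E}
    {a b c d : E → ℝ} (ha : ContDiffOn ℝ ∞ a s) (hb : ContDiffOn ℝ ∞ b s)
    (hc : ContDiffOn ℝ ∞ c s) (hd : ContDiffOn ℝ ∞ d s) :
    ContDiffOn ℝ ∞ (fun x => quat (a x) (b x) (c x) (d x)) s := by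
  have e : (fun x => quat (a x) (b x) (c x) (d x)) = fun x =>
      a x • quat 1 0 0 0 + b x • quat 0 1 0 0 + c x • quat 0 0 1 0 + d x • quat 0 0 0 1 := by
    funext x; ext <;> simp
  rw [e]
  exact (((ha.smul contDiffOn_const).add (hb.smul contDiffOn_const)).add
    (hc.smul contDiffOn_const)).add (hd.smul contDiffOn_const)

lemma contDiffOn_act {E : Type*} [NormedAddCommGroup E] [NormedSpace ℝ E] {s : Set E}
    {q : E → SU2} {y : E → Amb} (hq : ContDiffOn ℝ ∞ (fun x => (q x : ℍ[ℝ])) s)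
    (hy : ContDiffOn ℝ ∞ y s) : ContDiffOn ℝ ∞ (fun x => act (q x) (y x)) s := by
  have hstar : ContDiffOn ℝ ∞ (fun x => star (q x : ℍ[ℝ])) s :=
    starCLM.contDiff.comp_contDiffOn hq
  exact (hy.fst.fst.prodMk ((hq.mul hy.fst.snd).mul hstar)).prodMk
    ((hq.mul hy.snd.fst).prodMk (hq.mul hy.snd.snd))

lemma contDiff_centralUnit :
    ContDiff ℝ ∞ (fun x : ℝ × ℝ × ℝ => centralUnit x.1 x.2.1 x.2.2) := by
  have h : ∀ x : ℝ × ℝ × ℝ, (0 : ℝ) < 1 + x.1 ^ 2 + x.2.1 ^ 2 + x.2.2 ^ 2 :=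
    fun x => by positivity
  rw [← contDiffOn_univ]
  refine ContDiffOn.smul (ContDiffOn.inv (ContDiffOn.sqrt (by fun_prop) fun x _ => (h x).ne')
    fun x _ => (Real.sqrt_pos.2 (h x)).ne') (contDiffOn_quat ?_ ?_ ?_ ?_) <;> fun_prop

/-- The part of `(0, π/2)` over which the level set of `(v, F)` lies. -/
def levelDomain (c : ℝ) (H : ℝ → ℝ) (v F : ℝ) : Set ℝ :=
  {α | α ∈ Set.Ioo 0 (Real.pi / 2) ∧ 0 < levelGap c H v F α}

lemma isOpen_levelDomain (v F : ℝ) (hH : ContDiffOn ℝ ∞ H (Set.Ioo 0 (Real.pi / 2))) :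
    IsOpen (levelDomain c H v F) := by
  have : ContinuousOn (levelGap c H v F) (Set.Ioo 0 (Real.pi / 2)) :=
    continuousOn_const.sub (continuousOn_const.mul hH.continuousOn)
  exact this.isOpen_inter_preimage isOpen_Ioo isOpen_Ioi

lemma contDiffOn_levelT {v : ℝ} (F : ℝ) (hv : 0 < v)
    (hH : ContDiffOn ℝ ∞ H (Set.Ioo 0 (Real.pi / 2))) :
    ContDiffOn ℝ ∞ (levelT c H v F) (levelDomain c H v F) := by
  have hw : ∀ α ∈ levelDomain c H v F,
      0 < 2 * v * (Real.sin α ^ (5 / 2 : ℝ) * Real.cos α ^ (1 / 2 : ℝ)) :=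
    fun α hα => mul_pos (by positivity) (weight_pos hα.1)
  have hs : ContDiffOn ℝ ∞ (fun α => Real.sin α ^ (5 / 2 : ℝ)) (levelDomain c H v F) :=
    Real.contDiff_sin.contDiffOn.rpow_const_of_ne fun α hα => (sin_pos_of_mem hα.1).ne'
  have hc : ContDiffOn ℝ ∞ (fun α => Real.cos α ^ (1 / 2 : ℝ)) (levelDomain c H v F) :=
    Real.contDiff_cos.contDiffOn.rpow_const_of_ne fun α hα => (cos_pos_of_mem hα.1).ne'
  have hgap : ContDiffOn ℝ ∞ (levelGap c H v F) (levelDomain c H v F) :=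
    contDiffOn_const.sub (contDiffOn_const.mul (hH.mono fun α hα => hα.1))
  exact (hgap.div (contDiffOn_const.mul (hs.mul hc)) fun α hα => (hw α hα).ne').sqrt
    fun α hα => (div_pos hα.2 (hw α hα)).ne'

lemma contDiffOn_levelSlice (β δ : ℝ) {v : ℝ} (F : ℝ) (hv : 0 < v)
    (hH : ContDiffOn ℝ ∞ H (Set.Ioo 0 (Real.pi / 2))) :
    ContDiffOn ℝ ∞ (fun α => slicePoint α β (v * levelT c H v F α) (levelT c H v F α) δ)
      (levelDomain c H v F) := by
  have hT := contDiffOn_levelT (c := c) F hv hH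
  have h0 : ContDiffOn ℝ ∞ (fun _ : ℝ => (0 : ℝ)) (levelDomain c H v F) := contDiffOn_const
  have hA : ContDiffOn ℝ ∞ (fun α => sinHalf α) (levelDomain c H v F) := by
    unfold sinHalf; fun_prop
  have hB : ContDiffOn ℝ ∞ (fun α => cosHalf α) (levelDomain c H v F) := by
    unfold cosHalf; fun_prop
  have hS := contDiffOn_const (c := v).mul hT
  simp only [slicePoint_eq]
  refine (sliceMap β δ).toContinuousLinearMap.contDiff.comp_contDiffOn ?_
  exact (((hB.pow 2).sub (hA.pow 2)).prodMk (contDiffOn_quat h0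
    ((contDiffOn_const.mul hA).mul hB) h0 h0)).prodMk
    ((contDiffOn_quat (hA.mul hS) h0 h0 (hA.mul hT)).prodMk
      (contDiffOn_quat h0 (hB.mul hS) (hB.mul hT).neg h0))

/-- The product rule for `act`: the derivative of the group element contributes the infinitesimal
action of the imaginary quaternion `q' q⁻¹`. -/
lemma hasDerivAt_act {q : ℝ → SU2} {y : ℝ → Amb} {q' : ℍ[ℝ]} {y' : Amb} {τ : ℝ}
    (hq : HasDerivAt (fun ε => (q ε : ℍ[ℝ])) q' τ) (hy : HasDerivAt y y' τ) :
    (q' * star (q τ : ℍ[ℝ])).re = 0 ∧ HasDerivAt (fun ε => act (q ε) (y ε))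
      (infAct (q' * star (q τ : ℍ[ℝ])) (act (q τ) (y τ)) + actMap (q τ) y') τ := by
  have hs : HasDerivAt (fun ε => star (q ε : ℍ[ℝ])) (star q') τ :=
    starCLM.hasFDerivAt.comp_hasDerivAt τ hq
  have h1 : star (q τ : ℍ[ℝ]) * q τ = 1 := Unitary.coe_star_mul_self _
  have hw : q' * star (q τ : ℍ[ℝ]) + q τ * star q' = 0 := by
    refine (hq.mul hs).unique ((hasDerivAt_const τ (1 : ℍ[ℝ])).congr_of_eventuallyEq ?_)
    exact Filter.Eventually.of_forall fun ε => Unitary.coe_mul_star_self (q ε)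
  have hq' : q' = q' * star (q τ : ℍ[ℝ]) * q τ := by rw [mul_assoc, h1, mul_one]
  have hs' : star q' = -(star (q τ : ℍ[ℝ]) * (q' * star (q τ : ℍ[ℝ]))) := by
    rw [eq_neg_of_add_eq_zero_left hw, mul_neg, neg_neg, ← mul_assoc, h1, one_mul]
  refine ⟨?_, ?_⟩
  · have := congrArg QuaternionAlgebra.re hw
    simp at this ⊢
    linarith
  · have hy1 := hasFDerivAt_fst.comp_hasDerivAt τ hy
    have hy2 := hasFDerivAt_snd.comp_hasDerivAt τ hy
    have hy11 := hasFDerivAt_fst.comp_hasDerivAt τ hy1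
    have hy12 := hasFDerivAt_snd.comp_hasDerivAt τ hy1
    have hy21 := hasFDerivAt_fst.comp_hasDerivAt τ hy2
    have hy22 := hasFDerivAt_snd.comp_hasDerivAt τ hy2
    refine ((hy11.prodMk ((hq.mul hy12).mul hs)).prodMk
      ((hq.mul hy21).prodMk (hq.mul hy22))).congr_deriv ?_
    generalize hw' : q' * star (q τ : ℍ[ℝ]) = w at hq' hs'
    rw [hs', hq']
    refine Prod.ext (Prod.ext ?_ ?_) (Prod.ext ?_ ?_)
    · simp [actMap, conjMap, infAct]
    · simp [actMap, conjMap, infAct, act]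
      noncomm_ring
    · simp [actMap, leftMap, infAct, act]
      noncomm_ring
    · simp [actMap, leftMap, infAct, act]
      noncomm_ring

/-- The parametrization of a level set over the translate by `g₀` of the central chart of the
three-sphere; the last coordinate is `α`. -/
def levelParam (c : ℝ) (H : ℝ → ℝ) (β δ v F : ℝ) (g₀ : SU2) (u : EuclideanSpace ℝ (Fin 4)) : Amb :=
  levelPoint c H β δ v F (g₀ * ⟨centralUnit (u 0) (u 1) (u 2), centralUnit_mem _ _ _⟩) (u 3)

/-- The inverse of `levelParam`, as a function on the ambient space. -/
def levelInv (β δ v : ℝ) (g₀ : SU2) (x : Amb) : EuclideanSpace ℝ (Fin 4) :=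
  let m := star (g₀ : ℍ[ℝ]) * groupPart β δ v x
  !₂[m.imI / m.re, m.imJ / m.re, m.imK / m.re, alphaOf x]

lemma groupPart_levelPoint (β δ v F : ℝ) (g : SU2) (α : ℝ) :
    groupPart β δ v (levelPoint c H β δ v F g α) =
      (sinHalf α * levelT c H v F α * (v ^ 2 + 1)) • (g : ℍ[ℝ]) :=
  groupPart_act_slicePoint _ _ _ _ _ _

lemma groupFactor_pos {v F α : ℝ} (hv : 0 < v) (hα : α ∈ levelDomain c H v F) :
    0 < sinHalf α * levelT c H v F α * (v ^ 2 + 1) :=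
  mul_pos (mul_pos (sinHalf_pos hα.1) (levelT_pos hα.1 hv hα.2)) (by positivity)

lemma alphaOf_levelPoint {β δ v F : ℝ} (g : SU2) {α : ℝ} (hα : α ∈ Set.Ioo 0 (Real.pi / 2)) :
    alphaOf (levelPoint c H β δ v F g α) = α :=
  alphaOf_act_slicePoint g hα

lemma levelInv_levelParam {β δ v F : ℝ} {g₀ : SU2} {u : EuclideanSpace ℝ (Fin 4)} (hv : 0 < v)
    (hu : u 3 ∈ levelDomain c H v F) :
    0 < (star (g₀ : ℍ[ℝ]) * groupPart β δ v (levelParam c H β δ v F g₀ u)).re ∧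
      levelInv β δ v g₀ (levelParam c H β δ v F g₀ u) = u := by
  have hg : star (g₀ : ℍ[ℝ]) * g₀ = 1 := Unitary.coe_star_mul_self g₀
  have hk := groupFactor_pos hv hu
  obtain ⟨k, hk'⟩ : ∃ k, sinHalf (u 3) * levelT c H v F (u 3) * (v ^ 2 + 1) = k := ⟨_, rfl⟩
  have h1 : (0 : ℝ) < Real.sqrt (1 + u 0 ^ 2 + u 1 ^ 2 + u 2 ^ 2) :=
    Real.sqrt_pos.2 (by positivity)
  have hm : star (g₀ : ℍ[ℝ]) * groupPart β δ v (levelParam c H β δ v F g₀ u) =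
      k • centralUnit (u 0) (u 1) (u 2) := by
    rw [levelParam, groupPart_levelPoint, hk', mul_smul_comm, Submonoid.coe_mul, ← mul_assoc, hg,
      one_mul]
  rw [hk'] at hk
  have hre : (k • centralUnit (u 0) (u 1) (u 2)).re =
      k * (Real.sqrt (1 + u 0 ^ 2 + u 1 ^ 2 + u 2 ^ 2))⁻¹ := by simp [centralUnit]
  refine ⟨?_, ?_⟩
  · rw [hm, hre]; positivity
  · ext i
    fin_cases i
    · simp [levelInv, hm, centralUnit]; field_simp
    · simp [levelInv, hm, centralUnit]; field_simp
    · simp [levelInv, hm, centralUnit]; field_simp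
    · exact alphaOf_levelPoint _ hu.1

lemma levelParam_eq {β δ v F : ℝ} {g₀ q : SU2} {u : EuclideanSpace ℝ (Fin 4)}
    (h : centralUnit (u 0) (u 1) (u 2) = q) :
    levelParam c H β δ v F g₀ u = levelPoint c H β δ v F (g₀ * q) (u 3) := by
  have : (⟨centralUnit (u 0) (u 1) (u 2), centralUnit_mem _ _ _⟩ : SU2) = q := Subtype.ext h
  rw [levelParam, this]

lemma levelParam_levelInv {β δ v F : ℝ} {g₀ g : SU2} {α : ℝ} (hv : 0 < v)
    (hα : α ∈ levelDomain c H v F)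
    (hre : 0 < (star (g₀ : ℍ[ℝ]) * groupPart β δ v (levelPoint c H β δ v F g α)).re) :
    levelParam c H β δ v F g₀ (levelInv β δ v g₀ (levelPoint c H β δ v F g α)) =
      levelPoint c H β δ v F g α := by
  have hk := groupFactor_pos hv hα
  obtain ⟨q, hq⟩ : ∃ q : SU2, q = star g₀ * g := ⟨_, rfl⟩
  have e : g₀ * q = g := by rw [hq, ← mul_assoc, Unitary.mul_star_self, one_mul]
  obtain ⟨k, hk'⟩ : ∃ k, sinHalf α * levelT c H v F α * (v ^ 2 + 1) = k := ⟨_, rfl⟩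
  rw [hk'] at hk
  have hm : star (g₀ : ℍ[ℝ]) * groupPart β δ v (levelPoint c H β δ v F g α) =
      k • (q : ℍ[ℝ]) := by
    rw [groupPart_levelPoint, hk', mul_smul_comm, hq]; rfl
  rw [hm] at hre
  have hq0 : 0 < (q : ℍ[ℝ]).re := by
    have : (k • (q : ℍ[ℝ])).re = k * (q : ℍ[ℝ]).re := by simp
    rw [this] at hre
    exact pos_of_mul_pos_right hre hk.le
  have hr : ∀ r : ℝ, k * r / (k * (q : ℍ[ℝ]).re) = r / (q : ℍ[ℝ]).re := fun r =>
    mul_div_mul_left _ _ hk.ne'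
  rw [levelParam_eq (q := q), e]
  · change levelPoint c H β δ v F g (alphaOf _) = _
    rw [alphaOf_levelPoint _ hα.1]
  · rw [levelInv, hm]
    refine Eq.trans ?_ (centralUnit_of_re_pos (normSq_SU2 q) hq0)
    simp [hr]

lemma contDiffOn_levelParam (β δ : ℝ) {v : ℝ} (F : ℝ) (g₀ : SU2) (hv : 0 < v)
    (hH : ContDiffOn ℝ ∞ H (Set.Ioo 0 (Real.pi / 2))) :
    ContDiffOn ℝ ∞ (levelParam c H β δ v F g₀) {u | u 3 ∈ levelDomain c H v F} := by
  refine contDiffOn_act ?_ ?_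
  · exact contDiffOn_const.mul (contDiff_centralUnit.comp_contDiffOn
      (f := fun u : EuclideanSpace ℝ (Fin 4) => (u 0, u 1, u 2)) (by fun_prop))
  · exact (contDiffOn_levelSlice β δ F hv hH).comp
      (f := fun u : EuclideanSpace ℝ (Fin 4) => u 3) (by fun_prop) fun u hu => hu

lemma continuous_groupPart (β δ v : ℝ) : Continuous (groupPart β δ v) := by
  unfold groupPart; fun_prop

lemma continuous_alphaOf : Continuous alphaOf := by
  have : Continuous fun x : Amb => x.1.2.re :=
    Quaternion.continuous_re.comp (by fun_prop)
  unfold alphaOf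
  exact Real.continuous_arcsin.comp (by fun_prop)

lemma continuousOn_levelInv (β δ v : ℝ) (g₀ : SU2) : ContinuousOn (levelInv β δ v g₀)
    {x | 0 < (star (g₀ : ℍ[ℝ]) * groupPart β δ v x).re} := by
  have hm : Continuous fun x => star (g₀ : ℍ[ℝ]) * groupPart β δ v x :=
    continuous_const.mul (continuous_groupPart β δ v)
  have h0 := (Quaternion.continuous_re.comp hm).continuousOn
    (s := {x | 0 < (star (g₀ : ℍ[ℝ]) * groupPart β δ v x).re})
  have h1 := (Quaternion.continuous_imI.comp hm).continuousOn
    (s := {x | 0 < (star (g₀ : ℍ[ℝ]) * groupPart β δ v x).re})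
  have h2 := (Quaternion.continuous_imJ.comp hm).continuousOn
    (s := {x | 0 < (star (g₀ : ℍ[ℝ]) * groupPart β δ v x).re})
  have h3 := (Quaternion.continuous_imK.comp hm).continuousOn
    (s := {x | 0 < (star (g₀ : ℍ[ℝ]) * groupPart β δ v x).re})
  refine (PiLp.continuous_toLp 2 _).comp_continuousOn (continuousOn_pi.2 fun i => ?_)
  fin_cases i
  · exact h1.div h0 fun x hx => ne_of_gt hx
  · exact h2.div h0 fun x hx => ne_of_gt hx
  · exact h3.div h0 fun x hx => ne_of_gt hx
  · exact continuous_alphaOf.continuousOn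


lemma differentiableAt_components (q : ℍ[ℝ]) :
    DifferentiableAt ℝ (fun q : ℍ[ℝ] => q.re) q ∧ DifferentiableAt ℝ (fun q : ℍ[ℝ] => q.imI) q ∧
      DifferentiableAt ℝ (fun q : ℍ[ℝ] => q.imJ) q ∧
      DifferentiableAt ℝ (fun q : ℍ[ℝ] => q.imK) q :=
  have h : ∀ L : ℍ[ℝ] →ₗ[ℝ] ℝ, DifferentiableAt ℝ L q := fun L =>
    L.toContinuousLinearMap.differentiableAt
  ⟨h (QuaternionAlgebra.reₗ _ _ _), h (QuaternionAlgebra.imIₗ _ _ _),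
    h (QuaternionAlgebra.imJₗ _ _ _), h (QuaternionAlgebra.imKₗ _ _ _)⟩

lemma differentiableAt_alphaOf {x : Amb} (h0 : 0 < x.1.1 ^ 2 + x.1.2.re ^ 2)
    (h1 : x.1.1 ^ 2 + x.1.2.re ^ 2 < 1) : DifferentiableAt ℝ alphaOf x := by
  have hre : DifferentiableAt ℝ (fun x : Amb => x.1.2.re) x :=
    (differentiableAt_components _).1.comp (f := fun x : Amb => x.1.2) x (by fun_prop)
  have hs : DifferentiableAt ℝ (fun x : Amb => Real.sqrt (x.1.1 ^ 2 + x.1.2.re ^ 2)) x :=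
    DifferentiableAt.sqrt (by fun_prop) h0.ne'
  refine (Real.differentiableAt_arcsin.2 ⟨?_, ?_⟩).comp x hs
  · have := Real.sqrt_nonneg (x.1.1 ^ 2 + x.1.2.re ^ 2); linarith
  · exact ((Real.sqrt_lt' one_pos).2 (by simpa using h1)).ne

lemma differentiableAt_levelInv {β δ v : ℝ} {g₀ : SU2} {x : Amb}
    (hre : 0 < (star (g₀ : ℍ[ℝ]) * groupPart β δ v x).re) (h0 : 0 < x.1.1 ^ 2 + x.1.2.re ^ 2)
    (h1 : x.1.1 ^ 2 + x.1.2.re ^ 2 < 1) : DifferentiableAt ℝ (levelInv β δ v g₀) x := by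
  have hm : DifferentiableAt ℝ (fun x => star (g₀ : ℍ[ℝ]) * groupPart β δ v x) x := by
    unfold groupPart; fun_prop
  obtain ⟨e0, e1, e2, e3⟩ := differentiableAt_components (star (g₀ : ℍ[ℝ]) * groupPart β δ v x)
  have d0 : DifferentiableAt ℝ (fun y => (star (g₀ : ℍ[ℝ]) * groupPart β δ v y).re) x :=
    e0.comp x hm
  have d1 : DifferentiableAt ℝ (fun y => (star (g₀ : ℍ[ℝ]) * groupPart β δ v y).imI) x :=
    e1.comp x hm
  have d2 : DifferentiableAt ℝ (fun y => (star (g₀ : ℍ[ℝ]) * groupPart β δ v y).imJ) x :=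
    e2.comp x hm
  have d3 : DifferentiableAt ℝ (fun y => (star (g₀ : ℍ[ℝ]) * groupPart β δ v y).imK) x :=
    e3.comp x hm
  have hne : (fun y => (star (g₀ : ℍ[ℝ]) * groupPart β δ v y).re) x ≠ 0 := hre.ne'
  rw [differentiableAt_euclidean]
  intro i
  fin_cases i
  · exact d1.fun_mul (d0.fun_inv hne)
  · exact d2.fun_mul (d0.fun_inv hne)
  · exact d3.fun_mul (d0.fun_inv hne)
  · exact differentiableAt_alphaOf h0 h1

lemma isOpen_levelParam_domain (v F : ℝ) (hH : ContDiffOn ℝ ∞ H (Set.Ioo 0 (Real.pi / 2))) :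
    IsOpen {u : EuclideanSpace ℝ (Fin 4) | u 3 ∈ levelDomain c H v F} :=
  (isOpen_levelDomain v F hH).preimage (by fun_prop)

/-- The parametrization is an immersion, because `levelInv` is a differentiable left inverse. -/
lemma injective_fderiv_levelParam {β δ v F : ℝ} {g₀ : SU2} (hv : 0 < v)
    (hH : ContDiffOn ℝ ∞ H (Set.Ioo 0 (Real.pi / 2))) {u : EuclideanSpace ℝ (Fin 4)}
    (hu : u 3 ∈ levelDomain c H v F) :
    Function.Injective (fderiv ℝ (levelParam c H β δ v F g₀) u) := by
  have hφ : DifferentiableAt ℝ (levelParam c H β δ v F g₀) u :=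
    ((contDiffOn_levelParam β δ F g₀ hv hH).contDiffAt
      ((isOpen_levelParam_domain v F hH).mem_nhds hu)).differentiableAt (by simp)
  have hs := sin_pos_of_mem hu.1
  have hc := cos_pos_of_mem hu.1
  have hsc := Real.sin_sq_add_cos_sq (u 3)
  have e : (levelParam c H β δ v F g₀ u).1.1 ^ 2 + (levelParam c H β δ v F g₀ u).1.2.re ^ 2 =
      Real.sin (u 3) ^ 2 := by
    rw [levelParam, levelPoint, act_slicePoint_fst_fst, act_slicePoint_fst_snd_re, mul_pow,
      mul_pow, ← mul_add, Real.cos_sq_add_sin_sq, mul_one]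
  have hψ : DifferentiableAt ℝ (levelInv β δ v g₀) (levelParam c H β δ v F g₀ u) := by
    refine differentiableAt_levelInv (levelInv_levelParam hv hu).1 ?_ ?_ <;> rw [e]
    · positivity
    · nlinarith
  have hcomp := (hψ.hasFDerivAt.comp u hφ.hasFDerivAt).unique
    ((hasFDerivAt_id u).congr_of_eventuallyEq (Filter.eventuallyEq_of_mem
      ((isOpen_levelParam_domain v F hH).mem_nhds hu)
      fun w hw => (levelInv_levelParam hv hw).2))
  exact Function.LeftInverse.injective (g := fderiv ℝ (levelInv β δ v g₀)
    (levelParam c H β δ v F g₀ u)) fun w => by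
      have := congrArg (fun L => L w) hcomp
      simpa using this

/-- The tangent spaces of a level set are those of the family of orbits over the curve
`α ↦ (α, β, v t(α), t(α), δ)`. One inclusion is the product rule, and the dimensions agree. -/
lemma range_fderiv_levelParam {β δ v F : ℝ} {g₀ : SU2} (hv : 0 < v)
    (hH : ContDiffOn ℝ ∞ H (Set.Ioo 0 (Real.pi / 2))) {u : EuclideanSpace ℝ (Fin 4)}
    (hu : u 3 ∈ levelDomain c H v F) :
    LinearMap.range (fderiv ℝ (levelParam c H β δ v F g₀) u).toLinearMap =
      orbitFamilyTangent id (fun _ => β) (fun α => v * levelT c H v F α) (levelT c H v F)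
        (fun _ => δ) (g₀ * ⟨centralUnit (u 0) (u 1) (u 2), centralUnit_mem _ _ _⟩) (u 3) := by
  have hφ : DifferentiableAt ℝ (levelParam c H β δ v F g₀) u :=
    ((contDiffOn_levelParam β δ F g₀ hv hH).contDiffAt
      ((isOpen_levelParam_domain v F hH).mem_nhds hu)).differentiableAt (by simp)
  obtain ⟨g, hg⟩ : ∃ g : SU2, g = g₀ * ⟨centralUnit (u 0) (u 1) (u 2), centralUnit_mem _ _ _⟩ :=
    ⟨_, rfl⟩
  have hY : HasDerivAt (fun α => slicePoint α β (v * levelT c H v F α) (levelT c H v F α) δ)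
      (deriv (fun α => slicePoint α β (v * levelT c H v F α) (levelT c H v F α) δ) (u 3)) (u 3) :=
    (((contDiffOn_levelSlice β δ F hv hH).contDiffAt
      ((isOpen_levelDomain v F hH).mem_nhds hu)).differentiableAt (by simp)).hasDerivAt
  obtain ⟨y', hy'⟩ : ∃ y', deriv (fun α => slicePoint α β (v * levelT c H v F α)
    (levelT c H v F α) δ) (u 3) = y' := ⟨_, rfl⟩
  rw [hy'] at hY
  have hder : deriv (orbitFamily id (fun _ => β) (fun α => v * levelT c H v F α) (levelT c H v F)
      (fun _ => δ) g) (u 3) = actMap g y' :=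
    ((actMap (g : ℍ[ℝ])).toContinuousLinearMap.hasFDerivAt.comp_hasDerivAt _ hY).deriv
  rw [← hg, orbitFamilyTangent, hder]
  have hx : orbitFamily id (fun _ => β) (fun α => v * levelT c H v F α) (levelT c H v F)
      (fun _ => δ) g (u 3) = levelParam c H β δ v F g₀ u := by
    rw [hg]; rfl
  rw [hx]
  refine Submodule.eq_of_le_of_finrank_le ?_ ?_
  · rintro _ ⟨w, rfl⟩
    -- the derivative in the direction `w`, computed along the line through `u`
    have hline : ∀ i, HasDerivAt (fun ε : ℝ => (u + ε • w) i) (w i) 0 := fun i => by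
      have : HasDerivAt (fun ε : ℝ => u i + ε * w i) (1 * w i) 0 :=
        ((hasDerivAt_id (0 : ℝ)).mul_const (w i)).const_add (u i)
      simpa using this
    have hlineV : HasDerivAt (fun ε : ℝ => u + ε • w) w 0 := by
      have := ((hasDerivAt_id (0 : ℝ)).smul_const w).const_add u
      simpa using this
    have h1 : HasDerivAt (fun ε : ℝ => levelParam c H β δ v F g₀ (u + ε • w))
        (fderiv ℝ (levelParam c H β δ v F g₀) u w) 0 := by
      have hφ' : HasFDerivAt (levelParam c H β δ v F g₀) (fderiv ℝ (levelParam c H β δ v F g₀) u)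
        (u + (0 : ℝ) • w) := by simpa using hφ.hasFDerivAt
      exact hφ'.comp_hasDerivAt (0 : ℝ) hlineV
    have hq : ∃ q', HasDerivAt (fun ε : ℝ => ((g₀ * ⟨centralUnit ((u + ε • w) 0) ((u + ε • w) 1)
        ((u + ε • w) 2), centralUnit_mem _ _ _⟩ : SU2) : ℍ[ℝ])) q' 0 := by
      have hd := (contDiff_centralUnit.differentiable (by simp)
        ((u + (0 : ℝ) • w) 0, (u + (0 : ℝ) • w) 1, (u + (0 : ℝ) • w) 2)).hasFDerivAt
      have h := hd.comp_hasDerivAt (0 : ℝ) ((hline 0).prodMk ((hline 1).prodMk (hline 2)))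
      exact ⟨_, h.const_mul (g₀ : ℍ[ℝ])⟩
    obtain ⟨q', hq'⟩ := hq
    have hy : HasDerivAt (fun ε : ℝ => slicePoint ((u + ε • w) 3) β
        (v * levelT c H v F ((u + ε • w) 3)) (levelT c H v F ((u + ε • w) 3)) δ) (w 3 • y') 0 := by
      have hY' : HasDerivAt (fun α => slicePoint α β (v * levelT c H v F α) (levelT c H v F α) δ)
        y' ((u + (0 : ℝ) • w) 3) := by simpa using hY
      exact HasDerivAt.scomp (0 : ℝ) (h := fun ε : ℝ => (u + ε • w) 3) hY' (hline 3)
    have h2 := hasDerivAt_act hq' hy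
    have h3 := h1.unique h2.2
    simp only [zero_smul, add_zero, ← hg] at h2 h3
    rw [ContinuousLinearMap.coe_coe, h3, infAct_of_re_eq_zero h2.1, map_smul]
    refine add_mem (add_mem (add_mem ?_ ?_) ?_) ?_ <;>
      refine Submodule.smul_mem _ _ (Submodule.subset_span ?_)
    · left; rw [← hx]; rfl
    · right; left; rw [← hx]; rfl
    · right; right; left; rw [← hx]; rfl
    · right; right; right; rfl
  · rw [LinearMap.finrank_range_of_inj (injective_fderiv_levelParam hv hH hu),
      finrank_euclideanSpace, Fintype.card_fin]
    have : ∀ a b c d : Amb, Module.finrank ℝ (Submodule.span ℝ {a, b, c, d}) ≤ 4 := by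
      intro a b c d
      have e : ({a, b, c, d} : Set Amb) = Set.range ![a, b, c, d] := by
        rw [Matrix.range_cons, Matrix.range_cons, Matrix.range_cons, Matrix.range_cons,
          Matrix.range_empty, Set.union_empty]
        rfl
      rw [e]
      exact finrank_range_le_card (R := ℝ) ![a, b, c, d]
    exact this _ _ _ _

/-! ### The level sets are Cayley submanifolds -/

/-- The curve of orbits over a level set satisfies the Cayley equations, since `s / t` and `F` are
constant along it. -/
lemma isCayleyPlane_levelSet (hc : 0 ≤ c)
    (hH : ∀ a ∈ Set.Ioo 0 (Real.pi / 2), HasDerivAt H ((Real.cos a * Real.sin a) ^ (3 / 2 : ℝ)) a)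
    (β δ : ℝ) {v F : ℝ} (hv : 0 < v) (g : SU2) {α : ℝ} (hα : α ∈ levelDomain c H v F) :
    IsCayleyPlane c (levelPoint c H β δ v F g α)
      (orbitFamilyTangent id (fun _ => β) (fun α => v * levelT c H v F α) (levelT c H v F)
        (fun _ => δ) g α) := by
  have hH' := contDiffOn_primitive hH
  have hopen := isOpen_levelDomain (c := c) v F hH'
  have hT : HasDerivAt (levelT c H v F) (deriv (levelT c H v F) α) α :=
    (((contDiffOn_levelT F hv hH').contDiffAt (hopen.mem_nhds hα)).differentiableAt
      (by simp)).hasDerivAt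
  have ht := levelT_pos hα.1 hv hα.2
  have hs := mul_pos hv ht
  have hS : HasDerivAt (fun α => v * levelT c H v F α) (v * deriv (levelT c H v F) α) α :=
    hT.const_mul v
  refine (isCayleyPlane_orbitFamilyTangent_iff hc (hasDerivAt_id α) (hasDerivAt_const α β) hS hT
    (hasDerivAt_const α δ) hα.1 hs ht (fun h => one_ne_zero h.1) g).2 ⟨rfl, rfl, by ring, ?_⟩
  obtain ⟨u, w, k, hu, hw, h⟩ := hasDerivAt_integralF (c := c) hH hα.1 hs ht
  obtain ⟨F', hF', e⟩ := h (hasDerivAt_id α) hS hT rfl rfl rfl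
  have h0 : F' = 0 := eq_zero_of_hasDerivAt_of_const hopen (k := F)
    (fun a ha => integralF_levelT ha.1 hv ha.2) hα hF'
  have hK : levelT c H v F α * (v * deriv (levelT c H v F) α)
      - v * levelT c H v F α * deriv (levelT c H v F) α = 0 := by ring
  rw [h0, hK, mul_zero, mul_zero, add_zero] at e
  exact (mul_eq_zero.1 e.symm).resolve_left hw.ne'

/-- The level sets are Cayley submanifolds. Near a point with group element `g₀` the parametrization
over the translate by `g₀` of the central chart is used; the sign of the real part of
`g₀⁻¹ · groupPart` tells whether a point of the level set lies in its image. -/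
theorem isCayleySubmanifold_fibre (hc : 0 ≤ c)
    (hH : ∀ a ∈ Set.Ioo 0 (Real.pi / 2), HasDerivAt H ((Real.cos a * Real.sin a) ^ (3 / 2 : ℝ)) a)
    (b : Real.Angle × Real.Angle × ℝ × ℝ) :
    IsCayleySubmanifold c (Subtype.val '' (fibrationMap c H ⁻¹' {b})) := by
  obtain ⟨b, d, v, F⟩ := b
  induction b using Real.Angle.induction_on with | _ β
  induction d using Real.Angle.induction_on with | _ δ
  have hH' := contDiffOn_primitive hH
  constructor
  · intro x hx
    obtain ⟨-, g, α, -, -, rfl⟩ := mem_fibre_iff.1 hx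
    exact act_slicePoint_mem _ _ _ _ _ _
  intro x hx
  obtain ⟨hv, g₀, α₀, hα₀, hgap₀, rfl⟩ := mem_fibre_iff.1 hx
  have hmem : ∀ u : EuclideanSpace ℝ (Fin 4), u 3 ∈ levelDomain c H v F →
      0 < (star (g₀ : ℍ[ℝ]) * groupPart β δ v (levelParam c H β δ v F g₀ u)).re :=
    fun u hu => (levelInv_levelParam hv hu).1
  refine ⟨{x | 0 < (star (g₀ : ℍ[ℝ]) * groupPart β δ v x).re},
    {u | u 3 ∈ levelDomain c H v F}, levelParam c H β δ v F g₀, ?_, ?_,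
    isOpen_levelParam_domain v F hH', contDiffOn_levelParam β δ F g₀ hv hH', ?_, ?_, ?_⟩
  · exact isOpen_Ioi.preimage (Quaternion.continuous_re.comp
      (continuous_const.mul (continuous_groupPart β δ v)))
  · have hk := groupFactor_pos (c := c) (H := H) (F := F) hv ⟨hα₀, hgap₀⟩
    have hg : star (g₀ : ℍ[ℝ]) * g₀ = 1 := Unitary.coe_star_mul_self g₀
    rw [Set.mem_ofPred_eq, groupPart_levelPoint, mul_smul_comm, hg]
    simpa using hk
  · ext x
    constructor
    · rintro ⟨u, hu, rfl⟩
      exact ⟨mem_fibre_iff.2 ⟨hv, _, _, hu.1, hu.2, rfl⟩, hmem u hu⟩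
    · rintro ⟨hx, hW⟩
      obtain ⟨-, g, α, hα, hgap, rfl⟩ := mem_fibre_iff.1 hx
      refine ⟨_, ?_, levelParam_levelInv hv ⟨hα, hgap⟩ hW⟩
      change alphaOf _ ∈ levelDomain c H v F
      rw [alphaOf_levelPoint g hα]
      exact ⟨hα, hgap⟩
  · have hcont : Continuous (Set.domRestrict {u | u 3 ∈ levelDomain c H v F}
        (levelParam c H β δ v F g₀)) :=
      continuousOn_iff_continuous_domRestrict.1 (contDiffOn_levelParam β δ F g₀ hv hH').continuousOn
    have hcont' : Continuous (fun u : {u : EuclideanSpace ℝ (Fin 4) | u 3 ∈ levelDomain c H v F} =>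
        (⟨levelParam c H β δ v F g₀ u, hmem u u.2⟩ :
          {x : Amb | 0 < (star (g₀ : ℍ[ℝ]) * groupPart β δ v x).re})) :=
      hcont.subtype_mk _
    -- `levelInv` is a continuous left inverse on the open set `0 < Re (g₀⁻¹ · groupPart)` only, so the
    -- parametrization is factored through it
    refine Topology.IsEmbedding.subtypeVal.comp (Topology.IsEmbedding.of_comp hcont'
      (continuousOn_iff_continuous_domRestrict.1 (continuousOn_levelInv β δ v g₀)) ?_)
    convert Topology.IsEmbedding.subtypeVal using 1
    funext u
    exact (levelInv_levelParam hv u.2).2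
  · intro u hu
    refine ⟨injective_fderiv_levelParam hv hH' hu, ?_⟩
    rw [range_fderiv_levelParam hv hH' hu]
    exact isCayleyPlane_levelSet hc hH β δ hv _ hu

/-! ### The fibre coordinate of the level sets -/

/-- The equation `sin α = exp τ cos α (F - 5 c v / (v² + 1) H(α))`, which says that the point
over `α` has fibre coordinate `τ`. -/
def levelEquation (c : ℝ) (H : ℝ → ℝ) (v F τ α : ℝ) : ℝ :=
  Real.sin α - Real.exp τ * (Real.cos α * levelGap c H v F α)

/-- The coordinate `α` of the points of a level set with fibre coordinate `τ`: the root of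
`levelEquation` in `(0, π/2)`, an arbitrary number if there is none. -/
def levelRoot (c : ℝ) (H : ℝ → ℝ) (v F τ : ℝ) : ℝ :=
  Classical.epsilon fun α => α ∈ Set.Ioo 0 (Real.pi / 2) ∧ levelEquation c H v F τ α = 0

lemma levelConst_nonneg (hc : 0 ≤ c) {v : ℝ} (hv : 0 < v) : 0 ≤ levelConst c v := by
  unfold levelConst; positivity

lemma levelGap_anti (hc : 0 ≤ c) (hm : MonotoneOn H (Set.Icc 0 (Real.pi / 2))) {v F a b : ℝ}
    (hv : 0 < v) (ha : a ∈ Set.Icc 0 (Real.pi / 2)) (hb : b ∈ Set.Icc 0 (Real.pi / 2))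
    (h : a ≤ b) : levelGap c H v F b ≤ levelGap c H v F a :=
  sub_le_sub_left (mul_le_mul_of_nonneg_left (hm ha hb h) (levelConst_nonneg hc hv)) F

lemma levelGap_pos_of_root {v F τ α : ℝ} (hα : α ∈ Set.Ioo 0 (Real.pi / 2))
    (h : levelEquation c H v F τ α = 0) : 0 < levelGap c H v F α := by
  have h1 : 0 < Real.exp τ * (Real.cos α * levelGap c H v F α) := by
    rw [← sub_eq_zero.1 h]; exact sin_pos_of_mem hα
  exact pos_of_mul_pos_right (pos_of_mul_pos_right h1 (Real.exp_pos τ).le) (cos_pos_of_mem hα).le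

/-- To the left of a root the equation is negative. -/
lemma levelEquation_neg (hc : 0 ≤ c) (hm : MonotoneOn H (Set.Icc 0 (Real.pi / 2)))
    {v F τ α r : ℝ} (hv : 0 < v) (hr : r ∈ Set.Ioo 0 (Real.pi / 2))
    (h : levelEquation c H v F τ r = 0) (hα : 0 ≤ α) (hαr : α < r) :
    levelEquation c H v F τ α < 0 := by
  have hg := levelGap_anti (F := F) hc hm hv ⟨hα, (hαr.trans hr.2).le⟩ ⟨hr.1.le, hr.2.le⟩ hαr.le
  have hsin : Real.sin α < Real.sin r :=
    Real.sin_lt_sin_of_lt_of_le_pi_div_two (by linarith [Real.pi_pos]) hr.2.le hαr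
  have hcos : Real.cos r ≤ Real.cos α :=
    Real.cos_le_cos_of_nonneg_of_le_pi hα (by linarith [hr.2, Real.pi_pos]) hαr.le
  have := mul_le_mul hcos hg (levelGap_pos_of_root hr h).le
    ((cos_pos_of_mem hr).le.trans hcos)
  have := mul_le_mul_of_nonneg_left this (Real.exp_pos τ).le
  unfold levelEquation at h ⊢
  linarith

/-- To the right of a root the equation is positive. -/
lemma levelEquation_pos (hc : 0 ≤ c) (hm : MonotoneOn H (Set.Icc 0 (Real.pi / 2)))
    {v F τ α r : ℝ} (hv : 0 < v) (hr : r ∈ Set.Ioo 0 (Real.pi / 2))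
    (h : levelEquation c H v F τ r = 0) (hα : α ≤ Real.pi / 2) (hαr : r < α) :
    0 < levelEquation c H v F τ α := by
  have hg := levelGap_anti (F := F) hc hm hv ⟨hr.1.le, hr.2.le⟩ ⟨(hr.1.trans hαr).le, hα⟩ hαr.le
  have hsin : Real.sin r < Real.sin α :=
    Real.sin_lt_sin_of_lt_of_le_pi_div_two (by linarith [Real.pi_pos, hr.1]) hα hαr
  have hcos : Real.cos α ≤ Real.cos r :=
    Real.cos_le_cos_of_nonneg_of_le_pi hr.1.le (by linarith [Real.pi_pos]) hαr.le
  have hcos0 : 0 ≤ Real.cos α :=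
    Real.cos_nonneg_of_neg_pi_div_two_le_of_le (by linarith [hr.1, Real.pi_pos]) hα
  have h1 : Real.cos α * levelGap c H v F α ≤ Real.cos r * levelGap c H v F r :=
    (mul_le_mul_of_nonneg_left hg hcos0).trans
      (mul_le_mul_of_nonneg_right hcos (levelGap_pos_of_root hr h).le)
  have := mul_le_mul_of_nonneg_left h1 (Real.exp_pos τ).le
  unfold levelEquation at h ⊢
  linarith

lemma continuous_levelEquation (hH : Continuous H) :
    Continuous fun z : (ℝ × ℝ × ℝ) × ℝ => levelEquation c H z.1.1 z.1.2.1 z.1.2.2 z.2 := by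
  unfold levelEquation levelGap levelConst
  have h : ∀ z : (ℝ × ℝ × ℝ) × ℝ, z.1.1 ^ 2 + 1 ≠ 0 := fun z => by positivity
  fun_prop (disch := exact h _)

/-- The equation is negative at `0`, because the level set of `(v, F)` is not empty, and positive at
`π/2`. -/
lemma levelRoot_spec (hH : Continuous H) {v F : ℝ} (τ : ℝ) (h : levelConst c v * H 0 < F) :
    levelRoot c H v F τ ∈ Set.Ioo 0 (Real.pi / 2) ∧
      levelEquation c H v F τ (levelRoot c H v F τ) = 0 := by
  refine Classical.epsilon_spec
    (p := fun α => α ∈ Set.Ioo 0 (Real.pi / 2) ∧ levelEquation c H v F τ α = 0) ?_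
  have hcont : Continuous (levelEquation c H v F τ) :=
    (continuous_levelEquation hH).comp (f := fun α => ((v, F, τ), α)) (by fun_prop)
  have h0 : levelEquation c H v F τ 0 < 0 := by
    have : 0 < levelGap c H v F 0 := sub_pos.2 h
    simp only [levelEquation, Real.sin_zero, Real.cos_zero, one_mul, zero_sub]
    exact neg_neg_of_pos (mul_pos (Real.exp_pos τ) this)
  have h1 : 0 < levelEquation c H v F τ (Real.pi / 2) := by simp [levelEquation]
  exact intermediate_value_Ioo (by positivity) hcont.continuousOn ⟨h0, h1⟩

lemma levelRoot_eq (hc : 0 ≤ c) (hm : MonotoneOn H (Set.Icc 0 (Real.pi / 2)))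
    {v F τ α : ℝ} (hv : 0 < v) (hα : α ∈ Set.Ioo 0 (Real.pi / 2))
    (h : levelEquation c H v F τ α = 0) : levelRoot c H v F τ = α := by
  obtain ⟨h1, h2⟩ := Classical.epsilon_spec
    (p := fun α => α ∈ Set.Ioo 0 (Real.pi / 2) ∧ levelEquation c H v F τ α = 0) ⟨α, hα, h⟩
  change levelRoot c H v F τ ∈ _ at h1
  change levelEquation c H v F τ (levelRoot c H v F τ) = 0 at h2
  rcases lt_trichotomy (levelRoot c H v F τ) α with hlt | heq | hgt
  · exact absurd h2 (levelEquation_neg hc hm hv hα h h1.1.le hlt).ne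
  · exact heq
  · exact absurd h2 (levelEquation_pos hc hm hv hα h h1.2.le hgt).ne'

/-- The root depends continuously on the parameters, because the sign of the equation at a fixed `α`
tells on which side of `α` the root lies. -/
lemma continuousOn_levelRoot (hc : 0 ≤ c) (hH : Continuous H)
    (hm : MonotoneOn H (Set.Icc 0 (Real.pi / 2))) :
    ContinuousOn (fun z : ℝ × ℝ × ℝ => levelRoot c H z.1 z.2.1 z.2.2)
      {z | 0 < z.1 ∧ levelConst c z.1 * H 0 < z.2.1} := by
  intro z hz
  have hcont : ∀ α, Continuous fun z : ℝ × ℝ × ℝ => levelEquation c H z.1 z.2.1 z.2.2 α :=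
    fun α => (continuous_levelEquation hH).comp (f := fun z => (z, α)) (by fun_prop)
  obtain ⟨hr, he⟩ := levelRoot_spec hH z.2.2 hz.2
  have hpi : (0 : ℝ) < Real.pi / 2 := by positivity
  refine tendsto_order.2 ⟨fun a ha => ?_, fun a ha => ?_⟩
  · have hneg := levelEquation_neg hc hm hz.1 hr he (le_max_right a 0) (max_lt ha hr.1)
    filter_upwards [self_mem_nhdsWithin,
      mem_nhdsWithin_of_mem_nhds ((hcont (max a 0)).continuousAt.eventually_lt_const hneg)]
      with w hw hlt
    obtain ⟨hr', he'⟩ := levelRoot_spec hH w.2.2 hw.2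
    by_contra hle
    rcases (not_lt.1 (fun h => hle ((le_max_left a 0).trans_lt h))).lt_or_eq with h | h
    · exact hlt.not_gt (levelEquation_pos hc hm hw.1 hr' he'
        (max_le (ha.trans hr.2).le hpi.le) h)
    · rw [← h, he'] at hlt; exact lt_irrefl _ hlt
  · have hpos := levelEquation_pos hc hm hz.1 hr he (min_le_right a (Real.pi / 2)) (lt_min ha hr.2)
    filter_upwards [self_mem_nhdsWithin, mem_nhdsWithin_of_mem_nhds
      ((hcont (min a (Real.pi / 2))).continuousAt.eventually_const_lt hpos)] with w hw hlt
    obtain ⟨hr', he'⟩ := levelRoot_spec hH w.2.2 hw.2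
    by_contra hle
    rcases (not_lt.1 (fun h => hle (h.trans_le (min_le_left a (Real.pi / 2))))).lt_or_eq with h | h
    · exact hlt.not_gt (levelEquation_neg hc hm hw.1 hr' he' (le_min (hr.1.trans ha).le hpi.le) h)
    · rw [h, he'] at hlt; exact lt_irrefl _ hlt

/-- The continuous extension to `ℝ` of a primitive of `(cos α sin α)^(3/2)` on `(0, π/2)`. It is
only used on `[0, π/2]`, where the integrand is not negative. -/
def extendedPrimitive (H : ℝ → ℝ) (a : ℝ) : ℝ :=
  H (Real.pi / 4) + ∫ x in Real.pi / 4..a, (Real.cos x * Real.sin x) ^ (3 / 2 : ℝ)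

lemma hasDerivAt_extendedPrimitive (H : ℝ → ℝ) (a : ℝ) :
    HasDerivAt (extendedPrimitive H) ((Real.cos a * Real.sin a) ^ (3 / 2 : ℝ)) a := by
  have hcont : Continuous fun x => (Real.cos x * Real.sin x) ^ (3 / 2 : ℝ) :=
    (Real.continuous_cos.mul Real.continuous_sin).rpow_const fun x => Or.inr (by norm_num)
  exact (hcont.integral_hasStrictDerivAt _ a).hasDerivAt.const_add _

lemma continuous_extendedPrimitive (H : ℝ → ℝ) : Continuous (extendedPrimitive H) :=
  continuous_iff_continuousAt.2 fun a => (hasDerivAt_extendedPrimitive H a).continuousAt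

lemma monotoneOn_extendedPrimitive (H : ℝ → ℝ) :
    MonotoneOn (extendedPrimitive H) (Set.Icc 0 (Real.pi / 2)) := by
  refine monotoneOn_of_deriv_nonneg (convex_Icc _ _) (continuous_extendedPrimitive H).continuousOn
    (fun a _ => (hasDerivAt_extendedPrimitive H a).differentiableAt.differentiableWithinAt)
    fun a ha => ?_
  rw [interior_Icc] at ha
  rw [(hasDerivAt_extendedPrimitive H a).deriv]
  exact Real.rpow_nonneg (mul_pos (cos_pos_of_mem ha) (sin_pos_of_mem ha)).le _

lemma extendedPrimitive_eq
    (hH : ∀ a ∈ Set.Ioo 0 (Real.pi / 2), HasDerivAt H ((Real.cos a * Real.sin a) ^ (3 / 2 : ℝ)) a)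
    {a : ℝ} (ha : a ∈ Set.Ioo 0 (Real.pi / 2)) : extendedPrimitive H a = H a := by
  have h4 : Real.pi / 4 ∈ Set.Ioo 0 (Real.pi / 2) :=
    ⟨by positivity, by linarith [Real.pi_pos]⟩
  refine isOpen_Ioo.eqOn_of_deriv_eq isPreconnected_Ioo
    (fun x _ => (hasDerivAt_extendedPrimitive H x).differentiableAt.differentiableWithinAt)
    (fun x hx => (hH x hx).differentiableAt.differentiableWithinAt)
    (fun x hx => by rw [(hasDerivAt_extendedPrimitive H x).deriv, (hH x hx).deriv]) h4 ?_ ha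
  simp [extendedPrimitive]

/-! ### Local triviality -/

lemma continuousAt_toReal {θ : Real.Angle} (h : θ ≠ Real.pi) :
    ContinuousAt Real.Angle.toReal θ := by
  have e : Real.Angle.toReal = fun θ => Complex.arg (θ.cos + θ.sin * Complex.I) := by
    funext θ
    rw [← Complex.arg_coe_angle_toReal_eq_arg, Complex.arg_cos_add_sin_mul_I_coe_angle]
  rw [e]
  have hz : ((θ.cos : ℂ) + θ.sin * Complex.I) ∈ Complex.slitPlane := by
    rw [Complex.mem_slitPlane_iff]
    by_cases hs : θ.sin = 0
    · left
      rcases Real.Angle.sin_eq_zero_iff.1 hs with rfl | h'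
      · simp
      · exact absurd h' h
    · right; simpa using hs
  have hcont : Continuous fun θ : Real.Angle => ((θ.cos : ℂ) + θ.sin * Complex.I) :=
    (Complex.continuous_ofReal.comp Real.Angle.continuous_cos).add
      ((Complex.continuous_ofReal.comp Real.Angle.continuous_sin).mul continuous_const)
  exact (Complex.continuousAt_arg hz).comp
    (f := fun θ : Real.Angle => ((θ.cos : ℂ) + θ.sin * Complex.I)) hcont.continuousAt

/-- The representative of an angle in `(β₀ - π, β₀ + π]`. -/
def angleLift (β₀ : ℝ) (θ : Real.Angle) : ℝ := (θ - β₀).toReal + β₀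

lemma coe_angleLift (β₀ : ℝ) (θ : Real.Angle) : (angleLift β₀ θ : Real.Angle) = θ := by
  simp [angleLift]

lemma continuousAt_angleLift {β₀ : ℝ} {θ : Real.Angle} (h : θ - β₀ ≠ Real.pi) :
    ContinuousAt (angleLift β₀) θ :=
  ((continuousAt_toReal h).comp (f := fun θ : Real.Angle => θ - β₀) (by fun_prop)).add
    continuousAt_const

open Classical in
/-- The unit quaternion `q / |q|`, and `1` for `q = 0`. -/
def unitPart (q : ℍ[ℝ]) : SU2 :=
  if h : Quaternion.normSq (‖q‖⁻¹ • q) = 1 then ⟨‖q‖⁻¹ • q, mem_unitary_of_normSq h⟩ else 1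

lemma coe_unitPart {q : ℍ[ℝ]} (hq : q ≠ 0) : (unitPart q : ℍ[ℝ]) = ‖q‖⁻¹ • q := by
  have h : Quaternion.normSq (‖q‖⁻¹ • q) = 1 := by
    have : ‖q‖ ≠ 0 := norm_ne_zero_iff.2 hq
    rw [Quaternion.normSq_eq_norm_mul_self, norm_smul, norm_inv, norm_norm, inv_mul_cancel₀ this,
      one_mul]
  rw [unitPart, dif_pos h]

lemma unitPart_smul {k : ℝ} (hk : 0 < k) (g : SU2) : unitPart (k • (g : ℍ[ℝ])) = g := by
  have hg : ‖(g : ℍ[ℝ])‖ = 1 := CStarRing.norm_coe_unitary g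
  have h0 : (g : ℍ[ℝ]) ≠ 0 := by rw [← norm_ne_zero_iff, hg]; exact one_ne_zero
  apply Subtype.ext
  rw [coe_unitPart (smul_ne_zero hk.ne' h0), norm_smul, hg, mul_one, Real.norm_of_nonneg hk.le,
    smul_smul, inv_mul_cancel₀ hk.ne', one_smul]

lemma continuousOn_unitPart : ContinuousOn unitPart {q | q ≠ 0} := by
  rw [Topology.IsEmbedding.subtypeVal.continuousOn_iff]
  refine ContinuousOn.congr (f := fun q : ℍ[ℝ] => ‖q‖⁻¹ • q) ?_ fun q hq => coe_unitPart hq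
  exact (continuous_norm.continuousOn.inv₀ fun q hq => norm_ne_zero_iff.2 hq).smul continuousOn_id

lemma continuous_hopf : Continuous hopf := by
  have h1 : Continuous fun x : Amb => star x.2.1 := starCLM.continuous.comp (by fun_prop)
  have h2 : Continuous fun x : Amb => star x.2.2 := starCLM.continuous.comp (by fun_prop)
  have h3 : Continuous fun x : Amb => (x.1.2.re : ℍ[ℝ]) :=
    Quaternion.continuous_coe.comp (Quaternion.continuous_re.comp (by fun_prop))
  unfold hopf
  fun_prop

lemma alphaOf_mem {x : Amb} (hx : x ∈ chartU) : alphaOf x ∈ Set.Ioo 0 (Real.pi / 2) := by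
  obtain ⟨g, α, β, s, t, δ, hα, -, -, rfl⟩ := hx
  rwa [alphaOf_act_slicePoint g hα]

lemma continuous_fibrationMap (hH : Continuous H) : Continuous (fibrationMap c H) := by
  have hv : Continuous (Subtype.val : chartU → Amb) := continuous_subtype_val
  have hα : Continuous fun x : chartU => alphaOf x := continuous_alphaOf.comp hv
  have hI : Continuous fun x : chartU => (hopf x).imI :=
    Quaternion.continuous_imI.comp (continuous_hopf.comp hv)
  have hJ : Continuous fun x : chartU => (hopf x).imJ :=
    Quaternion.continuous_imJ.comp (continuous_hopf.comp hv)
  have hK : Continuous fun x : chartU => (hopf x).imK :=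
    Quaternion.continuous_imK.comp (continuous_hopf.comp hv)
  have hre : Continuous fun x : chartU => (x : Amb).1.2.re :=
    Quaternion.continuous_re.comp (by fun_prop)
  have hn : Continuous fun x : chartU => innerS (x : Amb).2 (x : Amb).2 := by
    unfold innerS; fun_prop
  have hq : Continuous fun x : chartU => (hopf x).imI / Real.cos (alphaOf x) :=
    hI.div (Real.continuous_cos.comp hα) fun x => (cos_pos_of_mem (alphaOf_mem x.2)).ne'
  have hs : Continuous fun x : chartU => sOf x := by unfold sOf; fun_prop
  have ht : Continuous fun x : chartU => tOf x := by unfold tOf; fun_prop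
  have ht0 : ∀ x : chartU, tOf x ≠ 0 := by
    rintro ⟨_, g, α, β, s, t, δ, hα, -, ht, rfl⟩
    rw [tOf_act_slicePoint g hα ht]; exact ht.ne'
  have harg : ∀ {f : chartU → ℂ}, Continuous f → (∀ x, f x ≠ 0) →
      Continuous fun x => ((Complex.arg (f x) : ℝ) : Real.Angle) := fun hf h0 =>
    continuous_iff_continuousAt.2 fun x =>
      (Complex.continuousAt_arg_coe_angle (h0 x)).comp hf.continuousAt
  have hmk : ∀ {a b : chartU → ℝ}, Continuous a → Continuous b →
      Continuous fun x => (⟨a x, b x⟩ : ℂ) := fun ha hb =>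
    Complex.equivRealProdCLM.symm.continuous.comp (ha.prodMk hb)
  have hβ : Continuous fun x : chartU => betaOf x := by
    refine harg (hmk (by fun_prop) hre) fun x h0 => ?_
    have hp := (alphaOf_mem x.2).1
    have h1 : (x : Amb).1.1 = 0 := congrArg Complex.re h0
    have h2 : (x : Amb).1.2.re = 0 := congrArg Complex.im h0
    rw [alphaOf, h1, h2] at hp
    simp at hp
  have hδ : Continuous fun x : chartU => deltaOf x := by
    refine harg (hmk hJ.neg hK.neg) ?_
    rintro ⟨_, g, α, β, s, t, δ, hα, hs, ht, rfl⟩ h0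
    have hc := cos_pos_of_mem hα
    have h1 := congrArg Complex.re h0
    have h2 := congrArg Complex.im h0
    simp only [hopf_act_slicePoint, imJ_quat, imK_quat, neg_neg, Complex.zero_re,
      Complex.zero_im] at h1 h2
    have hk : Real.cos α * (2 * s * t) ≠ 0 := by positivity
    have h3 := (mul_eq_zero.1 h1).resolve_left hk
    have h4 := (mul_eq_zero.1 h2).resolve_left hk
    have := Real.sin_sq_add_cos_sq δ
    rw [h3, h4] at this
    norm_num at this
  refine hβ.prodMk (hδ.prodMk ((hs.div ht ht0).prodMk ?_))
  have hα1 : Continuous fun x : chartU => Real.sin (alphaOf x) ^ (5 / 2 : ℝ) :=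
    (Real.continuous_sin.comp hα).rpow_const fun x => Or.inr (by norm_num)
  have hα2 : Continuous fun x : chartU => Real.cos (alphaOf x) ^ (1 / 2 : ℝ) :=
    (Real.continuous_cos.comp hα).rpow_const fun x => Or.inr (by norm_num)
  have hst : Continuous fun x : chartU => sOf x * tOf x / (sOf x ^ 2 + tOf x ^ 2) :=
    (hs.mul ht).div ((hs.pow 2).add (ht.pow 2)) fun x =>
      (add_pos_of_nonneg_of_pos (sq_nonneg _) (pow_pos (lt_of_le_of_ne (Real.sqrt_nonneg _)
        (ht0 x).symm) 2)).ne'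
  exact (((continuous_const.mul hα1).mul hα2).mul (hs.mul ht)).add
    ((continuous_const.mul hst).mul (hH.comp hα))

lemma continuous_quat {X : Type*} [TopologicalSpace X] {a b c d : X → ℝ} (ha : Continuous a)
    (hb : Continuous b) (hc : Continuous c) (hd : Continuous d) :
    Continuous fun x => quat (a x) (b x) (c x) (d x) := by
  have h : Continuous fun p : ℝ × ℝ × ℝ × ℝ => quat p.1 p.2.1 p.2.2.1 p.2.2.2 := by
    rw [← continuousOn_univ]
    exact (contDiffOn_quat (by fun_prop) (by fun_prop) (by fun_prop) (by fun_prop)).continuousOn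
  exact h.comp (ha.prodMk (hb.prodMk (hc.prodMk hd)))

lemma continuous_slicePoint :
    Continuous fun z : ℝ × ℝ × ℝ × ℝ × ℝ => slicePoint z.1 z.2.1 z.2.2.1 z.2.2.2.1 z.2.2.2.2 := by
  have h0 : Continuous fun _ : ℝ × ℝ × ℝ × ℝ × ℝ => (0 : ℝ) := continuous_const
  have hA : Continuous fun z : ℝ × ℝ × ℝ × ℝ × ℝ => sinHalf z.1 := by unfold sinHalf; fun_prop
  have hB : Continuous fun z : ℝ × ℝ × ℝ × ℝ × ℝ => cosHalf z.1 := by unfold cosHalf; fun_prop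
  have h1 : Continuous fun z : ℝ × ℝ × ℝ × ℝ × ℝ => (rightMap z.2.2.2.2
      (slice₀ (sinHalf z.1) (cosHalf z.1) z.2.2.1 z.2.2.2.1).2).1 :=
    (continuous_quat (hA.mul (by fun_prop)) h0 h0 (hA.mul (by fun_prop))).mul
      (continuous_quat (by fun_prop) (by fun_prop) h0 h0)
  have h2 : Continuous fun z : ℝ × ℝ × ℝ × ℝ × ℝ => (rightMap z.2.2.2.2
      (slice₀ (sinHalf z.1) (cosHalf z.1) z.2.2.1 z.2.2.2.1).2).2 :=
    (continuous_quat h0 (hB.mul (by fun_prop)) (hB.mul (by fun_prop)).neg h0).mul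
      (continuous_quat (by fun_prop) (by fun_prop) h0 h0)
  have hc : Continuous fun z : ℝ × ℝ × ℝ × ℝ × ℝ => Real.cos (z.2.1 / 2) := by fun_prop
  have hs : Continuous fun z : ℝ × ℝ × ℝ × ℝ × ℝ => Real.sin (z.2.1 / 2) := by fun_prop
  have e : (fun z : ℝ × ℝ × ℝ × ℝ × ℝ => slicePoint z.1 z.2.1 z.2.2.1 z.2.2.2.1 z.2.2.2.2) =
      fun z => ((Real.sin z.1 * Real.cos z.2.1,
        quat (Real.sin z.1 * Real.sin z.2.1) (Real.cos z.1) 0 0),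
        (sliceMap z.2.1 z.2.2.2.2 (slice₀ (sinHalf z.1) (cosHalf z.1) z.2.2.1 z.2.2.2.1)).2) := by
    funext z
    have h := congrArg Prod.snd (slicePoint_eq z.1 z.2.1 z.2.2.1 z.2.2.2.1 z.2.2.2.2)
    exact Prod.ext rfl h
  rw [e]
  exact (Continuous.prodMk (by fun_prop)
    (continuous_quat (by fun_prop) (by fun_prop) h0 h0)).prodMk
    (((hc.smul h1).sub (hs.smul h2)).prodMk ((hs.smul h1).add (hc.smul h2)))

lemma continuous_act : Continuous fun z : SU2 × Amb => act z.1 z.2 := by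
  have hg : Continuous fun z : SU2 × Amb => (z.1 : ℍ[ℝ]) := by fun_prop
  have hs : Continuous fun z : SU2 × Amb => star (z.1 : ℍ[ℝ]) := starCLM.continuous.comp hg
  exact (Continuous.prodMk (by fun_prop) ((hg.mul (by fun_prop)).mul hs)).prodMk
    ((hg.mul (by fun_prop)).prodMk (hg.mul (by fun_prop)))

/-- The base set of the local trivialization around an image point with angles `β₀` and `δ₀`: the
angles opposite to these are excluded, and the last condition says that the level set of `(v, F)`
is not empty. -/
def trivBase (c : ℝ) (H : ℝ → ℝ) (β₀ δ₀ : ℝ) : Set (Real.Angle × Real.Angle × ℝ × ℝ) :=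
  {b | b.1 - β₀ ≠ Real.pi ∧ b.2.1 - δ₀ ≠ Real.pi ∧
    0 < b.2.2.1 ∧ levelConst c b.2.2.1 * H 0 < b.2.2.2}

/-- The coordinates on the fibre over `b`: the group element and
`log (tan α / (F - 5 c v / (v² + 1) H(α)))`. -/
def fibreCoord (c : ℝ) (H : ℝ → ℝ) (β₀ δ₀ : ℝ) (b : Real.Angle × Real.Angle × ℝ × ℝ) (x : Amb) :
    SU2 × ℝ :=
  (unitPart (groupPart (angleLift β₀ b.1) (angleLift δ₀ b.2.1) b.2.2.1 x),
    Real.log (Real.sin (alphaOf x) /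
      (Real.cos (alphaOf x) * levelGap c H b.2.2.1 b.2.2.2 (alphaOf x))))

/-- The point of the fibre over `b` with given fibre coordinates. -/
def fibrePoint (c : ℝ) (H : ℝ → ℝ) (β₀ δ₀ : ℝ)
    (z : (Real.Angle × Real.Angle × ℝ × ℝ) × (SU2 × ℝ)) : Amb :=
  levelPoint c H (angleLift β₀ z.1.1) (angleLift δ₀ z.1.2.1) z.1.2.2.1 z.1.2.2.2 z.2.1
    (levelRoot c H z.1.2.2.1 z.1.2.2.2 z.2.2)

lemma isOpen_trivBase (c : ℝ) (H : ℝ → ℝ) (β₀ δ₀ : ℝ) : IsOpen (trivBase c H β₀ δ₀) := by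
  have h1 : Continuous fun b : Real.Angle × Real.Angle × ℝ × ℝ => b.1 - (β₀ : Real.Angle) := by
    fun_prop
  have h2 : Continuous fun b : Real.Angle × Real.Angle × ℝ × ℝ => b.2.1 - (δ₀ : Real.Angle) := by
    fun_prop
  have h3 : Continuous fun b : Real.Angle × Real.Angle × ℝ × ℝ => levelConst c b.2.2.1 * H 0 := by
    have : ∀ b : Real.Angle × Real.Angle × ℝ × ℝ, b.2.2.1 ^ 2 + 1 ≠ 0 := fun b => by positivity
    unfold levelConst
    fun_prop (disch := exact this _)
  have h4 : Continuous fun b : Real.Angle × Real.Angle × ℝ × ℝ => b.2.2.1 := by fun_prop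
  have h5 : Continuous fun b : Real.Angle × Real.Angle × ℝ × ℝ => b.2.2.2 := by fun_prop
  exact (isOpen_compl_singleton.preimage h1).inter ((isOpen_compl_singleton.preimage h2).inter
    ((isOpen_lt continuous_const h4).inter (isOpen_lt h3 h5)))

lemma fibrationMap_eq_iff {β₀ δ₀ : ℝ} {b : Real.Angle × Real.Angle × ℝ × ℝ} {x : chartU} :
    fibrationMap c H x = b ↔ 0 < b.2.2.1 ∧ ∃ (g : SU2) (α : ℝ),
      α ∈ Set.Ioo 0 (Real.pi / 2) ∧ 0 < levelGap c H b.2.2.1 b.2.2.2 α ∧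
        (x : Amb) = levelPoint c H (angleLift β₀ b.1) (angleLift δ₀ b.2.1) b.2.2.1 b.2.2.2 g α := by
  rw [← mem_fibre_iff, coe_angleLift, coe_angleLift, Subtype.val_injective.mem_set_image]
  rfl

lemma eq_levelPoint (c : ℝ) (H : ℝ → ℝ) (β₀ δ₀ : ℝ) (x : chartU) :
    0 < (fibrationMap c H x).2.2.1 ∧ ∃ (g : SU2) (α : ℝ), α ∈ Set.Ioo 0 (Real.pi / 2) ∧
      0 < levelGap c H (fibrationMap c H x).2.2.1 (fibrationMap c H x).2.2.2 α ∧
      (x : Amb) = levelPoint c H (angleLift β₀ (fibrationMap c H x).1)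
        (angleLift δ₀ (fibrationMap c H x).2.1) (fibrationMap c H x).2.2.1
        (fibrationMap c H x).2.2.2 g α :=
  (fibrationMap_eq_iff (b := fibrationMap c H x)).1 rfl

lemma fibreCoord_levelPoint {β₀ δ₀ : ℝ} {b : Real.Angle × Real.Angle × ℝ × ℝ} (hv : 0 < b.2.2.1)
    {g : SU2} {α : ℝ} (hα : α ∈ levelDomain c H b.2.2.1 b.2.2.2) :
    fibreCoord c H β₀ δ₀ b
      (levelPoint c H (angleLift β₀ b.1) (angleLift δ₀ b.2.1) b.2.2.1 b.2.2.2 g α) =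
      (g, Real.log (Real.sin α / (Real.cos α * levelGap c H b.2.2.1 b.2.2.2 α))) := by
  rw [fibreCoord, groupPart_levelPoint, unitPart_smul (groupFactor_pos hv hα),
    alphaOf_levelPoint g hα.1]

/-- Over a point of the base, the fibre coordinates are inverse to `fibrePoint`. -/
lemma fibrePoint_fibreCoord (hc : 0 ≤ c) (hm : MonotoneOn H (Set.Icc 0 (Real.pi / 2)))
    {β₀ δ₀ : ℝ} (x : chartU) :
    fibrePoint c H β₀ δ₀ (fibrationMap c H x, fibreCoord c H β₀ δ₀ (fibrationMap c H x) x) = x := by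
  obtain ⟨b, hb⟩ : ∃ b, fibrationMap c H x = b := ⟨_, rfl⟩
  rw [hb]
  obtain ⟨hv, g, α, hα, hgap, hx⟩ := (fibrationMap_eq_iff (β₀ := β₀) (δ₀ := δ₀)).1 hb
  have hs := sin_pos_of_mem hα
  have hcos := cos_pos_of_mem hα
  rw [hx, fibreCoord_levelPoint hv ⟨hα, hgap⟩, fibrePoint, levelRoot_eq hc hm hv hα]
  rw [levelEquation, Real.exp_log (by positivity)]
  field_simp
  ring

lemma exists_fibrePoint_eq (hH : Continuous H) {β₀ δ₀ : ℝ}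
    {z : (Real.Angle × Real.Angle × ℝ × ℝ) × (SU2 × ℝ)} (hz : z.1 ∈ trivBase c H β₀ δ₀) :
    ∃ h : fibrePoint c H β₀ δ₀ z ∈ chartU, fibrationMap c H ⟨_, h⟩ = z.1 ∧
      fibreCoord c H β₀ δ₀ z.1 (fibrePoint c H β₀ δ₀ z) = z.2 := by
  obtain ⟨hα, he⟩ := levelRoot_spec hH z.2.2 hz.2.2.2
  have hgap := levelGap_pos_of_root hα he
  have hv := hz.2.2.1
  have ht := levelT_pos hα hv hgap
  have hmem : fibrePoint c H β₀ δ₀ z ∈ chartU :=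
    ⟨_, _, _, _, _, _, hα, mul_pos hv ht, ht, rfl⟩
  refine ⟨hmem, fibrationMap_eq_iff.2 ⟨hv, _, _, hα, hgap, rfl⟩, ?_⟩
  rw [fibrePoint, fibreCoord_levelPoint hv ⟨hα, hgap⟩]
  refine Prod.ext rfl ?_
  have hcos := cos_pos_of_mem hα
  have h2 : Real.sin (levelRoot c H z.1.2.2.1 z.1.2.2.2 z.2.2) / (Real.cos (levelRoot c H z.1.2.2.1
      z.1.2.2.2 z.2.2) * levelGap c H z.1.2.2.1 z.1.2.2.2
        (levelRoot c H z.1.2.2.1 z.1.2.2.2 z.2.2)) = Real.exp z.2.2 := by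
    rw [div_eq_iff (by positivity)]
    exact sub_eq_zero.1 he
  change Real.log _ = _
  rw [h2, Real.log_exp]


lemma continuous_groupPart_uncurried :
    Continuous fun p : ℝ × ℝ × ℝ × Amb => groupPart p.1 p.2.1 p.2.2.1 p.2.2.2 := by
  have := continuous_quat (X := ℝ × ℝ × ℝ × Amb)
    (a := fun p => p.2.2.1 * Real.cos (p.2.1 / 2)) (b := fun p => p.2.2.1 * Real.sin (p.2.1 / 2))
    (c := fun p => Real.sin (p.2.1 / 2)) (d := fun p => -Real.cos (p.2.1 / 2)) (by fun_prop)
    (by fun_prop) (by fun_prop) (by fun_prop)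
  exact Continuous.mul (by fun_prop) this

lemma continuous_levelGap (hH : Continuous H) :
    Continuous fun p : ℝ × ℝ × ℝ => levelGap c H p.1 p.2.1 p.2.2 := by
  have : ∀ p : ℝ × ℝ × ℝ, p.1 ^ 2 + 1 ≠ 0 := fun p => by positivity
  unfold levelGap levelConst
  fun_prop (disch := exact this _)

lemma continuousOn_fibreCoord (hH : Continuous H) (β₀ δ₀ : ℝ) :
    ContinuousOn (fun x : chartU => fibreCoord c H β₀ δ₀ (fibrationMap c H x) x)
      (fibrationMap c H ⁻¹' trivBase c H β₀ δ₀) := by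
  have hQ : Continuous (fibrationMap c H) := continuous_fibrationMap hH
  have hlevel := eq_levelPoint c H β₀ δ₀
  generalize fibrationMap c H = Q at hQ hlevel ⊢
  have hx : Continuous (Subtype.val : chartU → Amb) := continuous_subtype_val
  have hβ : ContinuousOn (fun x : chartU => angleLift β₀ (Q x).1)
      (Q ⁻¹' trivBase c H β₀ δ₀) := fun x hx' =>
    ((continuousAt_angleLift hx'.1).comp
      (f := fun x : chartU => (Q x).1) hQ.fst.continuousAt).continuousWithinAt
  have hδ : ContinuousOn (fun x : chartU => angleLift δ₀ (Q x).2.1)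
      (Q ⁻¹' trivBase c H β₀ δ₀) := fun x hx' =>
    ((continuousAt_angleLift hx'.2.1).comp
      (f := fun x : chartU => (Q x).2.1)
      hQ.snd.fst.continuousAt).continuousWithinAt
  have hα : Continuous fun x : chartU => alphaOf x := continuous_alphaOf.comp hx
  have hgap : Continuous fun x : chartU => levelGap c H (Q x).2.2.1
      (Q x).2.2.2 (alphaOf x) :=
    (continuous_levelGap hH).comp (hQ.snd.snd.fst.prodMk (hQ.snd.snd.snd.prodMk hα))
  have hp : ContinuousOn (fun x : chartU =>
      (angleLift β₀ (Q x).1, angleLift δ₀ (Q x).2.1, (Q x).2.2.1, (x : Amb)))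
      (Q ⁻¹' trivBase c H β₀ δ₀) :=
    hβ.prodMk (hδ.prodMk (hQ.snd.snd.fst.continuousOn.prodMk hx.continuousOn))
  have hg := continuous_groupPart_uncurried.comp_continuousOn hp
  simp only [Function.comp_def] at hg
  have hg0 : ∀ x : chartU, groupPart (angleLift β₀ (Q x).1)
      (angleLift δ₀ (Q x).2.1) (Q x).2.2.1 x ≠ 0 := fun x => by
    obtain ⟨hv, g, α, hα, hgap, hx⟩ := hlevel x
    rw [hx, groupPart_levelPoint]
    refine smul_ne_zero (groupFactor_pos hv ⟨hα, hgap⟩).ne' ?_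
    rw [← norm_ne_zero_iff, CStarRing.norm_coe_unitary g]
    exact one_ne_zero
  have hpos : ∀ x : chartU, 0 < levelGap c H (Q x).2.2.1
      (Q x).2.2.2 (alphaOf x) := fun x => by
    obtain ⟨hv, g, α, hα, hgap, hx⟩ :=
      hlevel x
    have : alphaOf x = α := by rw [hx, alphaOf_levelPoint g hα]
    rwa [this]
  have hden : ∀ x : chartU, 0 < Real.cos (alphaOf x) * levelGap c H (Q x).2.2.1
      (Q x).2.2.2 (alphaOf x) := fun x =>
    mul_pos (cos_pos_of_mem (alphaOf_mem x.2)) (hpos x)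
  have hquot : Continuous fun x : chartU => Real.sin (alphaOf x) /
      (Real.cos (alphaOf x) * levelGap c H (Q x).2.2.1
        (Q x).2.2.2 (alphaOf x)) :=
    (Real.continuous_sin.comp hα).div ((Real.continuous_cos.comp hα).mul hgap)
      fun x => (hden x).ne'
  have hlog := hquot.log fun x => (div_pos (sin_pos_of_mem (alphaOf_mem x.2)) (hden x)).ne'
  exact (continuousOn_unitPart.comp hg fun x _ => hg0 x).prodMk hlog.continuousOn

lemma continuousOn_fibrePoint (hc : 0 ≤ c) (hH : Continuous H)
    (hm : MonotoneOn H (Set.Icc 0 (Real.pi / 2))) (β₀ δ₀ : ℝ) :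
    ContinuousOn (fibrePoint c H β₀ δ₀) (trivBase c H β₀ δ₀ ×ˢ Set.univ) := by
  have hβ : ContinuousOn (fun z : (Real.Angle × Real.Angle × ℝ × ℝ) × (SU2 × ℝ) =>
      angleLift β₀ z.1.1) (trivBase c H β₀ δ₀ ×ˢ Set.univ) := fun z hz =>
    ((continuousAt_angleLift hz.1.1).comp
      (f := fun z : (Real.Angle × Real.Angle × ℝ × ℝ) × (SU2 × ℝ) => z.1.1)
      (by fun_prop)).continuousWithinAt
  have hδ : ContinuousOn (fun z : (Real.Angle × Real.Angle × ℝ × ℝ) × (SU2 × ℝ) =>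
      angleLift δ₀ z.1.2.1) (trivBase c H β₀ δ₀ ×ˢ Set.univ) := fun z hz =>
    ((continuousAt_angleLift hz.1.2.1).comp
      (f := fun z : (Real.Angle × Real.Angle × ℝ × ℝ) × (SU2 × ℝ) => z.1.2.1)
      (by fun_prop)).continuousWithinAt
  have hr : ContinuousOn (fun z : (Real.Angle × Real.Angle × ℝ × ℝ) × (SU2 × ℝ) =>
      levelRoot c H z.1.2.2.1 z.1.2.2.2 z.2.2) (trivBase c H β₀ δ₀ ×ˢ Set.univ) :=
    (continuousOn_levelRoot hc hH hm).comp
      (f := fun z : (Real.Angle × Real.Angle × ℝ × ℝ) × (SU2 × ℝ) =>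
        (z.1.2.2.1, z.1.2.2.2, z.2.2)) (by fun_prop) fun z hz => hz.1.2.2
  have hspec := fun (z : (Real.Angle × Real.Angle × ℝ × ℝ) × (SU2 × ℝ))
    (hz : z ∈ trivBase c H β₀ δ₀ ×ˢ Set.univ) => levelRoot_spec hH z.2.2 hz.1.2.2.2
  have hv : ContinuousOn (fun z : (Real.Angle × Real.Angle × ℝ × ℝ) × (SU2 × ℝ) => z.1.2.2.1)
      (trivBase c H β₀ δ₀ ×ˢ Set.univ) := by fun_prop
  have hgap : ContinuousOn (fun z : (Real.Angle × Real.Angle × ℝ × ℝ) × (SU2 × ℝ) =>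
      levelGap c H z.1.2.2.1 z.1.2.2.2 (levelRoot c H z.1.2.2.1 z.1.2.2.2 z.2.2))
      (trivBase c H β₀ δ₀ ×ˢ Set.univ) := by
    exact (continuous_levelGap hH).comp_continuousOn (hv.prodMk (ContinuousOn.prodMk
      (by fun_prop) hr))
  have hT : ContinuousOn (fun z : (Real.Angle × Real.Angle × ℝ × ℝ) × (SU2 × ℝ) =>
      levelT c H z.1.2.2.1 z.1.2.2.2 (levelRoot c H z.1.2.2.1 z.1.2.2.2 z.2.2))
      (trivBase c H β₀ δ₀ ×ˢ Set.univ) := by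
    refine (hgap.div ((continuousOn_const.mul hv).mul
      (((Real.continuous_sin.comp_continuousOn hr).rpow_const fun z _ => Or.inr (by norm_num)).mul
      ((Real.continuous_cos.comp_continuousOn hr).rpow_const fun z _ => Or.inr (by norm_num))))
      fun z hz => ?_).sqrt
    have hv0 := hz.1.2.2.1
    exact (mul_pos (mul_pos two_pos hv0) (weight_pos (hspec z hz).1)).ne'
  exact continuous_act.comp_continuousOn (ContinuousOn.prodMk (by fun_prop)
    (continuous_slicePoint.comp_continuousOn
      (hr.prodMk (hβ.prodMk ((hv.mul hT).prodMk (hT.prodMk hδ))))))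

lemma fibrationMap_mem_trivBase (hc : 0 ≤ c) (hm : MonotoneOn H (Set.Icc 0 (Real.pi / 2)))
    (x : chartU) : ∃ β₀ δ₀ : ℝ, fibrationMap c H x ∈ trivBase c H β₀ δ₀ := by
  obtain ⟨b, hb⟩ : ∃ b, fibrationMap c H x = b := ⟨_, rfl⟩
  obtain ⟨hv, g, α, hα, hgap, -⟩ := (fibrationMap_eq_iff (β₀ := 0) (δ₀ := 0)).1 hb
  rw [hb]
  obtain ⟨b, d, v, F⟩ := b
  induction b using Real.Angle.induction_on with | _ β
  induction d using Real.Angle.induction_on with | _ δ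
  have h0 := levelGap_anti (F := F) hc hm hv ⟨le_rfl, Real.pi_div_two_pos.le⟩
    ⟨hα.1.le, hα.2.le⟩ hα.1.le
  refine ⟨β, δ, ?_, ?_, hv, sub_pos.1 (hgap.trans_le h0)⟩
  · simpa using Real.Angle.pi_ne_zero.symm
  · simpa using Real.Angle.pi_ne_zero.symm

open Classical in
/-- The local trivialization of the fibration, with fibre `SU(2) × ℝ`. The point `x₀` is the value
of the inverse where `fibrePoint` is not in the chart, which does not happen over the base set. -/
def localTrivialization (hc : 0 ≤ c) (hH : Continuous H)
    (hm : MonotoneOn H (Set.Icc 0 (Real.pi / 2))) (x₀ : chartU) (β₀ δ₀ : ℝ) :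
    Bundle.Trivialization (SU2 × ℝ) (fibrationMap c H) where
  toFun x := (fibrationMap c H x, fibreCoord c H β₀ δ₀ (fibrationMap c H x) x)
  invFun z := if h : fibrePoint c H β₀ δ₀ z ∈ chartU then ⟨_, h⟩ else x₀
  source := fibrationMap c H ⁻¹' trivBase c H β₀ δ₀
  target := trivBase c H β₀ δ₀ ×ˢ Set.univ
  map_source' x hx := ⟨hx, trivial⟩
  map_target' z hz := by
    obtain ⟨h, h1, -⟩ := exists_fibrePoint_eq hH hz.1
    rw [dif_pos h, Set.mem_preimage, h1]
    exact hz.1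
  left_inv' x hx := by
    have e := fibrePoint_fibreCoord hc hm (β₀ := β₀) (δ₀ := δ₀) x
    rw [dif_pos (by rw [e]; exact x.2)]
    exact Subtype.ext e
  right_inv' z hz := by
    obtain ⟨h, h1, h2⟩ := exists_fibrePoint_eq hH hz.1
    rw [dif_pos h, h1, h2]
  open_source := (isOpen_trivBase c H β₀ δ₀).preimage (continuous_fibrationMap hH)
  open_target := (isOpen_trivBase c H β₀ δ₀).prod isOpen_univ
  continuousOn_toFun :=
    (continuous_fibrationMap hH).continuousOn.prodMk (continuousOn_fibreCoord hH β₀ δ₀)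
  continuousOn_invFun := by
    rw [Topology.IsEmbedding.subtypeVal.continuousOn_iff]
    refine (continuousOn_fibrePoint hc hH hm β₀ δ₀).congr fun z hz => ?_
    obtain ⟨h, -, -⟩ := exists_fibrePoint_eq hH hz.1
    rw [Function.comp_apply, dif_pos h]
  baseSet := trivBase c H β₀ δ₀
  open_baseSet := isOpen_trivBase c H β₀ δ₀
  source_eq := rfl
  target_eq := rfl
  proj_toFun _ _ := rfl

/-- The fibration is locally trivial. It only depends on `H` on `(0, π/2)`, so that `H` may be
replaced by its continuous extension. -/
theorem exists_localTrivialization (hc : 0 ≤ c)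
    (hH : ∀ a ∈ Set.Ioo 0 (Real.pi / 2), HasDerivAt H ((Real.cos a * Real.sin a) ^ (3 / 2 : ℝ)) a)
    (x : chartU) :
    ∃ e : Bundle.Trivialization (SU2 × ℝ) (fibrationMap c H), fibrationMap c H x ∈ e.baseSet := by
  have e : fibrationMap c H = fibrationMap c (extendedPrimitive H) := by
    funext y
    simp only [fibrationMap, integralF, extendedPrimitive_eq hH (alphaOf_mem y.2)]
  rw [e]
  obtain ⟨β₀, δ₀, h⟩ := fibrationMap_mem_trivBase hc (monotoneOn_extendedPrimitive H) x
  exact ⟨localTrivialization hc (continuous_extendedPrimitive H) (monotoneOn_extendedPrimitive H)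
    x β₀ δ₀, h⟩

end BryantSalamon

end

theorem mainTheorem6 (c : ℝ) (hc : 0 ≤ c) (H : ℝ → ℝ)
    (hH : ∀ a ∈ Set.Ioo 0 (Real.pi / 2),
      HasDerivAt H ((Real.cos a * Real.sin a) ^ (3 / 2 : ℝ)) a) :
    -- the invariant submanifold swept out by a regular curve of orbits in the chart is Cayley
    -- if and only if the four quantities are constant along the curve
    (∀ (ε : ℝ), 0 < ε → ∀ (α β s t δ : ℝ → ℝ),
      ContDiffOn ℝ 1 α (Set.Ioo (-ε) ε) → ContDiffOn ℝ 1 β (Set.Ioo (-ε) ε) →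
      ContDiffOn ℝ 1 s (Set.Ioo (-ε) ε) → ContDiffOn ℝ 1 t (Set.Ioo (-ε) ε) →
      ContDiffOn ℝ 1 δ (Set.Ioo (-ε) ε) →
      (∀ τ ∈ Set.Ioo (-ε) ε, α τ ∈ Set.Ioo 0 (Real.pi / 2) ∧ 0 < s τ ∧ 0 < t τ) →
      (∀ τ ∈ Set.Ioo (-ε) ε, ¬ (deriv α τ = 0 ∧ deriv β τ = 0 ∧ deriv s τ = 0 ∧
        deriv t τ = 0 ∧ deriv δ τ = 0)) →
      ((∀ (g : BryantSalamon.SU2), ∀ τ ∈ Set.Ioo (-ε) ε,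
          BryantSalamon.IsCayleyPlane c (BryantSalamon.orbitFamily α β s t δ g τ)
            (BryantSalamon.orbitFamilyTangent α β s t δ g τ)) ↔
        ∃ β₀ δ₀ v₀ F₀ : ℝ, ∀ τ ∈ Set.Ioo (-ε) ε,
          β τ = β₀ ∧ δ τ = δ₀ ∧ s τ / t τ = v₀ ∧
            BryantSalamon.integralF c H (α τ) (s τ) (t τ) = F₀)) ∧
    -- the four first integrals on the five-dimensional orbit space are smooth and
    -- functionally independent: the system is completely integrable
    (ContDiffOn ℝ ∞ (BryantSalamon.firstIntegrals c H) BryantSalamon.orbitDomain ∧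
      ∀ z ∈ BryantSalamon.orbitDomain,
        Function.Surjective (fderiv ℝ (BryantSalamon.firstIntegrals c H) z)) ∧
    -- the four quantities define a locally trivial fibration of the chart, whose fibres, their
    -- level sets, are invariant Cayley submanifolds
    (∃ Q : BryantSalamon.chartU → Real.Angle × Real.Angle × ℝ × ℝ,
      (∀ (x : BryantSalamon.chartU) (g : BryantSalamon.SU2) (α β s t δ : ℝ),
        α ∈ Set.Ioo 0 (Real.pi / 2) → 0 < s → 0 < t →
        (x : BryantSalamon.Amb) = BryantSalamon.act g (BryantSalamon.slicePoint α β s t δ) →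
        Q x = ((β : Real.Angle), (δ : Real.Angle), s / t,
          BryantSalamon.integralF c H α s t)) ∧
      (∀ x : BryantSalamon.chartU,
        ∃ e : Bundle.Trivialization (BryantSalamon.SU2 × ℝ) Q, Q x ∈ e.baseSet) ∧
      (∀ b : Real.Angle × Real.Angle × ℝ × ℝ,
        BryantSalamon.IsCayleySubmanifold c (Subtype.val '' (Q ⁻¹' {b})) ∧
        ∀ g : BryantSalamon.SU2, ∀ x ∈ (Subtype.val '' (Q ⁻¹' {b}) : Set BryantSalamon.Amb),
          BryantSalamon.act g x ∈ (Subtype.val '' (Q ⁻¹' {b}) : Set BryantSalamon.Amb))) := by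
  have hH' := BryantSalamon.contDiffOn_primitive hH
  refine ⟨fun ε hε α β s t δ hα hβ hs ht hδ hdom hreg =>
    BryantSalamon.cayley_iff_first_integrals_const hc hH hε hα hβ hs ht hδ hdom hreg,
    ⟨BryantSalamon.contDiffOn_firstIntegrals hH',
      fun z hz => BryantSalamon.surjective_fderiv_firstIntegrals hH hz⟩,
    BryantSalamon.fibrationMap c H,
    fun x g α β s t δ hα hs ht hx => BryantSalamon.fibrationMap_eq hα hs ht hx,
    BryantSalamon.exists_localTrivialization hc hH,
    fun b => ⟨BryantSalamon.isCayleySubmanifold_fibre hc hH b,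
      fun g x hx => BryantSalamon.act_mem_fibre g hx⟩⟩
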